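/- **Setting.** Let $\mathbb S_+^{\ell-1}$ be the set of unit vectors of $\mathbb R^\ell$ with nonnegative last coordinate. For $\alpha\in\mathbb R$, $u\in\mathbb S_+^{\ell-1}$ put $H(\alpha,u)=\{x:\langle x,u\rangle=\alpha\}$, $H^-(\alpha,u)=\{x:\langle x,u\rangle\le\alpha\}$, $H^+(\alpha,u)=\{x:\langle x,u\rangle\ge\alpha\}$. Let $\mathcal H$ be the space of hyperplanes given by their parameters $(\alpha,u)\in\mathbb R\times\mathbb S_+^{\ell-1}$, with the Borel $\sigma$-algebra of the parameter space, and $[B]=\{H\in\mathcal H: H\cap B\ne\emptyset\}$. Let $\Lambda$ be a nonzero measure on $\mathcal H$ that is translation invariant, satisfies $\Lambda([B])<\infty$ for every bounded Borel set $B$, and is such that there is no line to which all hyperplanes of its support are parallel. A cell (or window) is a polytope (the convex hull of a finite set) with nonempty interior. Fix a window $W$. A tessellation of $W$ is a finite set $T$ of cells with pairwise disjoint interiors and union $W$; $\partial T=\bigcup_{C\in T}\partial C$. The set $\mathbb T\wedge W$ of these tessellations carries the $\sigma$-algebra generated by the sets $\{T:\partial T\cap A=\emptyset\}$, $A\subseteq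 W$ compact. Let $\widehat\Lambda_{[W]}=\Lambda([W])^{-1}\Lambda|_{[W]}$. Let $\mathcal E^*$ be the set of finite words over $\{-,+\}$, with empty word $o$, ordered by length and, within each length, lexicographically with $-<+$. **STIT processes.** Let $(Z(e))_{e\in\mathcal E^*}$ and $(G_n)_{n\ge1}$ be two independent families of independent random variables, $Z(e)\sim\mathrm{Exponential}(1)$, $G_n\sim\widehat\Lambda_{[W]}$. Put $C(o)=W$, $\kappa(o)=1$, and recursively $\kappa(e)=\inf\{n: G_n\in[C(e)],\ n>\kappa(e')\text{ for all }e'<e\}$ for $e\neq o$, $H(e)=G_{\kappa(e)}$, $C(e\,\pm)=C(e)\cap H^{\pm}(e)$. The cell $C(e)$ has lifetime $t_l(e)=\Lambda([C(e)])^{-1}Z(e)$; $t_b(o)=0$ and $t_b(e\,\pm)=t_b(e)+t_l(e)$. Put $(Y\wedge W)_t=\{C(e): t_b(e)\le t<t_b(e)+t_l(e)\}$, $t\ge0$. A *STIT process in $W$ associated with $\Lambda_{[W]}$* is a process with the same law (with respect to the product $\sigma$-algebra over $t\ge0$) as $Y\wedge W=((Y\wedge W)_t:t\ge0)$. **The rejection-based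 chain.** Let $(U_n)_{n\ge1}$, $(V_n)_{n\ge1}$, $(G_n)_{n\ge1}$ be three independent sequences of i.i.d. random variables, with $U_n\sim\mathrm{Uniform}[0,1)$, $V_n\sim\mathrm{Exponential}(1)$, $G_n\sim\widehat\Lambda_{[W]}$. Start with $E_0=\{o\}$, $C(o)=W$, $\kappa_0=0$. Given the finite set $E_n\subset\mathcal E^*$, the cells $C(e)$, $e\in E_n$, and $\kappa_n$, let $\mathcal Y_n=\{C(e):e\in E_n\}$ and $\zeta(\mathcal Y_n)=\sum_{e\in E_n}\Lambda([C(e)])$. Partition $[0,1)$ into intervals $[a^n_e,b^n_e)$, $e\in E_n$, of lengths $\Lambda([C(e)])/\zeta(\mathcal Y_n)$, consecutive in the order of the words; let $e^*$ be the word with $U_{n+1}\in[a^n_{e^*},b^n_{e^*})$. Let $\kappa_{n+1}=\min\{j>\kappa_n: G_j\in[C(e^*)]\}$, $H_{n+1}=G_{\kappa_{n+1}}$, $C(e^*\,\pm)=C(e^*)\cap H_{n+1}^{\pm}$ and $E_{n+1}=(E_n\setminus\{e^*\})\cup\{e^*-,e^*+\}$. Put $\mathcal S_n=\sum_{j=1}^n\zeta(\mathcal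 Y_{j-1})^{-1}V_j$ and $$(\underline Y\wedge W)_t=\mathcal Y_n\quad\text{when } t\in[\mathcal S_n,\mathcal S_{n+1}),\ n\ge 0 .$$ **Proposition.** Almost surely all $\kappa_n$ are well defined, $\mathcal S_n\to\infty$, and $(\underline Y\wedge W)_t$ is a tessellation of $W$ for all $t\ge0$; and $\underline Y\wedge W=((\underline Y\wedge W)_t:t\ge0)$ is a STIT process in $W$ associated with $\Lambda_{[W]}$. -/

import Mathlib

open MeasureTheory ProbabilityTheory Filter Topology
open scoped NNReal

namespace STIT

/-! ### Cells, tessellations of a window -/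

/-- The Euclidean space `ℝ^ℓ`. -/
abbrev Space (ℓ : ℕ) : Type := EuclideanSpace ℝ (Fin ℓ)

/-- A cell (or a window): the convex hull of a finite set, with nonempty interior. -/
def IsCell {ℓ : ℕ} (K : Set (Space ℓ)) : Prop :=
  (∃ F : Set (Space ℓ), F.Finite ∧ K = convexHull ℝ F) ∧ (interior K).Nonempty

/-- A family of sets in the window `W`. The window only serves to select the `σ`-algebra below. -/
@[ext] structure Family {ℓ : ℕ} (W : Set (Space ℓ)) : Type where
  cells : Set (Set (Space ℓ))

/-- The union of the boundaries of the members of a family. -/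
def Family.boundary {ℓ : ℕ} {W : Set (Space ℓ)} (T : Family W) : Set (Space ℓ) :=
  ⋃ C ∈ T.cells, frontier C

/-- The family is a tessellation of the window `W`: finitely many cells
with pairwise disjoint interiors, covering `W`. -/
structure Family.IsTessellation {ℓ : ℕ} {W : Set (Space ℓ)} (T : Family W) : Prop where
  finite : T.cells.Finite
  isCell : ∀ C ∈ T.cells, IsCell C
  disjoint : T.cells.Pairwise fun C D => Disjoint (interior C) (interior D)
  cover : ⋃ C ∈ T.cells, C = W

/-- The `σ`-algebra generated by the sets `{T : ∂T ∩ A = ∅}`, for `A ⊆ W` compact. -/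
instance {ℓ : ℕ} (W : Set (Space ℓ)) : MeasurableSpace (Family W) :=
  MeasurableSpace.generateFrom
    {S | ∃ A : Set (Space ℓ), A ⊆ W ∧ IsCompact A ∧ S = {T : Family W | T.boundary ∩ A = ∅}}

/-! ### Hyperplanes -/

/-- The upper half of the unit sphere: unit vectors whose last coordinate is nonnegative. -/
abbrev HalfSphere (ℓ : ℕ) : Type :=
  {u : Space ℓ // ‖u‖ = 1 ∧ ∀ i : Fin ℓ, (i : ℕ) + 1 = ℓ → 0 ≤ u i}

/-- Hyperplanes `H(α, u)`, given by their parameters `(α, u)`, with the Borel `σ`-algebra of the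
parameter space. (A hyperplane whose normal direction has last coordinate zero occurs with both
of its orientations; the parameters tell which side is `H⁻` and which side is `H⁺`.) -/
abbrev Hyperplane (ℓ : ℕ) : Type := ℝ × HalfSphere ℓ

/-- The point set `H(α, u) = {x : ⟨x, u⟩ = α}`. -/
def pointSet {ℓ : ℕ} (h : Hyperplane ℓ) : Set (Space ℓ) :=
  {x | inner ℝ x (h.2 : Space ℓ) = h.1}

/-- The closed half-spaces of a hyperplane: `false` stands for `-`, `true` for `+`. -/
def halfSpace {ℓ : ℕ} (h : Hyperplane ℓ) : Bool → Set (Space ℓ)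
  | false => {x | inner ℝ x (h.2 : Space ℓ) ≤ h.1}
  | true => {x | h.1 ≤ inner ℝ x (h.2 : Space ℓ)}

/-- `[B]`, the set of hyperplanes that hit `B`. -/
def hit {ℓ : ℕ} (B : Set (Space ℓ)) : Set (Hyperplane ℓ) :=
  {h | (pointSet h ∩ B).Nonempty}

/-- The translate `H + x` of a hyperplane. -/
noncomputable def translate {ℓ : ℕ} (x : Space ℓ) (h : Hyperplane ℓ) : Hyperplane ℓ :=
  (h.1 + inner ℝ x (h.2 : Space ℓ), h.2)

/-- The parameters of `translate x h` are those of the translated point set. -/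
theorem pointSet_translate {ℓ : ℕ} (x : Space ℓ) (h : Hyperplane ℓ) :
    pointSet (translate x h) = (fun y => y + x) '' pointSet h := by
  ext z
  constructor
  · intro hz
    refine ⟨z - x, ?_, by simp⟩
    simp only [pointSet, translate, Set.mem_ofPred_eq] at hz ⊢
    rw [inner_sub_left]
    linarith
  · rintro ⟨y, hy, rfl⟩
    simp only [pointSet, translate, Set.mem_ofPred_eq] at hy ⊢
    rw [inner_add_left, hy]

/-- The assumptions on the hyperplane measure: it is nonzero, translation invariant, locally
finite, and there is no line to which all hyperplanes of its support are parallel. -/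
structure IsHyperplaneMeasure {ℓ : ℕ} (Λ : Measure (Hyperplane ℓ)) : Prop where
  ne_zero : Λ ≠ 0
  translation_invariant : ∀ x : Space ℓ, Λ.map (translate x) = Λ
  locally_finite : ∀ B : Set (Space ℓ), MeasurableSet B → Bornology.IsBounded B → Λ (hit B) < ⊤
  not_parallel : ¬ ∃ v : Space ℓ, v ≠ 0 ∧ ∀ h ∈ Λ.support, inner ℝ v (h.2 : Space ℓ) = 0

/-- `Λ([C])` as a real number. -/
noncomputable def mass {ℓ : ℕ} (Λ : Measure (Hyperplane ℓ)) (C : Set (Space ℓ)) : ℝ :=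
  Λ.real (hit C)

/-! ### Words over `{-, +}` -/

/-- The word `e₁ e₂ … e_k` is stored as the list `[e_k, …, e₂, e₁]`, with `false` for `-` and
`true` for `+`. So `[]` is the empty word and the successors of `e` are `false :: e` and
`true :: e`. -/
abbrev Word : Type := List Bool

/-- The total order on words: by length, and lexicographic (with `- < +`) within each length. -/
def Word.Before (e e' : Word) : Prop :=
  e.length < e'.length ∨ (e.length = e'.length ∧ List.Lex (· < ·) e.reverse e'.reverse)

/-- The rank of a word in the order `Word.Before`. -/
def Word.rank (e : Word) : ℕ :=
  e.foldr (fun b n => 2 * n + 1 + b.toNat) 0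

theorem Word.rank_bounds (e : Word) :
    2 ^ e.length ≤ Word.rank e + 1 ∧ Word.rank e + 1 < 2 ^ (e.length + 1) := by
  induction e with
  | nil => simp [Word.rank]
  | cons b e ih =>
    have h : Word.rank (b :: e) = 2 * Word.rank e + 1 + b.toNat := rfl
    rw [h, List.length_cons, pow_succ 2 (e.length + 1)]
    have h2 := pow_succ 2 e.length
    have h3 : b.toNat ≤ 1 := Bool.toNat_le b
    omega

theorem Word.foldl_lt {l l' : List Bool} (hlen : l.length = l'.length) :
    ∀ {a a' : ℕ}, (a < a' ∨ (a = a' ∧ List.Lex (· < ·) l l')) →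
      l.foldl (fun n b => 2 * n + 1 + b.toNat) a <
        l'.foldl (fun n b => 2 * n + 1 + b.toNat) a' := by
  induction l generalizing l' with
  | nil =>
    cases l' with
    | nil =>
      intro a a' h
      rcases h with h | ⟨_, h⟩
      · simpa using h
      · cases h
    | cons => simp at hlen
  | cons b l ih =>
    cases l' with
    | nil => simp at hlen
    | cons b' l' =>
      intro a a' h
      have hl : l.length = l'.length := by simpa using hlen
      refine ih hl ?_
      have h3 : b.toNat ≤ 1 := Bool.toNat_le b
      rcases h with h | ⟨rfl, h⟩
      · left; dsimp only; omega
      · cases h with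
        | rel hb =>
          left
          have hb' : b = false ∧ b' = true := by revert hb; cases b <;> cases b' <;> decide
          obtain ⟨rfl, rfl⟩ := hb'
          simp
        | cons h => exact Or.inr ⟨rfl, h⟩

theorem Word.rank_lt_of_before {e e' : Word} (h : Word.Before e e') :
    Word.rank e < Word.rank e' := by
  rcases h with h | ⟨hl, h⟩
  · have h1 := (Word.rank_bounds e).2
    have h2 := (Word.rank_bounds e').1
    have h3 : 2 ^ (e.length + 1) ≤ 2 ^ e'.length := Nat.pow_le_pow_right (by norm_num) h
    omega
  · have := Word.foldl_lt (l := e.reverse) (l' := e'.reverse) (by simpa using hl)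
      (a := 0) (a' := 0) (Or.inr ⟨rfl, h⟩)
    simpa [Word.rank, List.foldl_reverse] using this

theorem Word.before_wf : WellFounded Word.Before :=
  Subrelation.wf (fun h => Word.rank_lt_of_before h) (InvImage.wf Word.rank Nat.lt_wfRel.wf)

/-! ### The STIT process in a window: construction by independent lifetimes of the cells -/

/-- The cells `C(e)` obtained from hyperplanes `H(e)`: `C(o) = W`, `C(e -) = C(e) ∩ H⁻(e)`
and `C(e +) = C(e) ∩ H⁺(e)`. -/
def cell {ℓ : ℕ} (W : Set (Space ℓ)) (H : Word → Hyperplane ℓ) : Word → Set (Space ℓ)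
  | [] => W
  | b :: e => cell W H e ∩ halfSpace (H e) b

theorem cell_congr {ℓ : ℕ} (W : Set (Space ℓ)) (H H' : Word → Hyperplane ℓ) (e : Word)
    (h : ∀ e', Word.Before e' e → H e' = H' e') : cell W H e = cell W H' e := by
  induction e with
  | nil => rfl
  | cons b e ih =>
    have hb : Word.Before e (b :: e) := Or.inl (by simp)
    have hlt : ∀ e', Word.Before e' e → Word.Before e' (b :: e) := by
      intro e' he'
      left
      rcases he' with h' | h'
      · simp only [List.length_cons]; omega
      · simp only [List.length_cons]; omega
    simp only [cell, h e hb, ih fun e' he' => h e' (hlt e' he')]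

open Classical in
/-- The indices `κ(e)` of the dividing hyperplanes, by recursion along the order of the words:
`κ(o) = 1`, and for `e ≠ o` the index `κ(e)` is the first `n` greater than all `κ(e')`, `e' < e`,
such that `G_n` hits `C(e)`. See `kappa_nil` and `kappa_of_ne` for the defining equations. -/
noncomputable def kappa {ℓ : ℕ} (W : Set (Space ℓ)) (G : ℕ → Hyperplane ℓ) : Word → ℕ :=
  Word.before_wf.fix fun e previous =>
    let k : Word → ℕ := fun e' => if h : Word.Before e' e then previous e' h else 0
    if e = [] then 1
    else sInf {n | (∀ e', Word.Before e' e → k e' < n) ∧ G n ∈ hit (cell W (fun e' => G (k e')) e)}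

theorem kappa_nil {ℓ : ℕ} (W : Set (Space ℓ)) (G : ℕ → Hyperplane ℓ) : kappa W G [] = 1 := by
  rw [kappa, WellFounded.fix_eq]
  simp

theorem kappa_of_ne {ℓ : ℕ} (W : Set (Space ℓ)) (G : ℕ → Hyperplane ℓ) (e : Word) (he : e ≠ []) :
    kappa W G e = sInf {n | (∀ e', Word.Before e' e → kappa W G e' < n) ∧
      G n ∈ hit (cell W (fun e' => G (kappa W G e')) e)} := by
  conv_lhs => rw [kappa, WellFounded.fix_eq]
  simp only [he, if_false]
  congr 1
  ext n
  have hc : ∀ f : Word → ℕ, (∀ e', Word.Before e' e → f e' = kappa W G e') →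
      cell W (fun e' => G (f e')) e = cell W (fun e' => G (kappa W G e')) e :=
    fun f hf => cell_congr W _ _ e fun e' he' => by simp only [hf e' he']
  simp only [Set.mem_ofPred_eq]
  refine and_congr (forall₂_congr fun e' he' => ?_) ?_
  · rw [dif_pos he']; rfl
  · rw [hc _ fun e' he' => by rw [dif_pos he']; rfl]

/-- The cells `C(e)` built with the hyperplanes `H(e) = G_{κ(e)}`. -/
noncomputable def stitCell {ℓ : ℕ} (W : Set (Space ℓ)) (G : ℕ → Hyperplane ℓ) :
    Word → Set (Space ℓ) :=
  cell W fun e => G (kappa W G e)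

/-- The lifetime `Z(e) / Λ([C(e)])` of the cell `C(e)`. -/
noncomputable def lifetime {ℓ : ℕ} (Λ : Measure (Hyperplane ℓ)) (W : Set (Space ℓ))
    (Z : Word → ℝ) (G : ℕ → Hyperplane ℓ) (e : Word) : ℝ :=
  (mass Λ (stitCell W G e))⁻¹ * Z e

/-- The time of birth of the cell `C(e)`. -/
noncomputable def birth {ℓ : ℕ} (Λ : Measure (Hyperplane ℓ)) (W : Set (Space ℓ))
    (Z : Word → ℝ) (G : ℕ → Hyperplane ℓ) : Word → ℝ
  | [] => 0
  | _ :: e => birth Λ W Z G e + lifetime Λ W Z G e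

/-- The STIT process in the window: the state at time `t` is the family of the cells that
are alive at time `t`. -/
noncomputable def stit {ℓ : ℕ} (Λ : Measure (Hyperplane ℓ)) (W : Set (Space ℓ))
    (Z : Word → ℝ) (G : ℕ → Hyperplane ℓ) (t : ℝ≥0) : Family W :=
  ⟨{C | ∃ e : Word, birth Λ W Z G e ≤ t ∧ (t : ℝ) < birth Λ W Z G e + lifetime Λ W Z G e ∧
    C = stitCell W G e}⟩

/-- `X` is a STIT process in the window `W` associated with `Λ_{[W]}`: it has the same law, on the
space of functions of time with the product `σ`-algebra, as the process that is constructed from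
independent families of i.i.d. exponential variables `Z(e)` and of i.i.d. hyperplanes `G_n`
(`n ≥ 1`) whose law is the normalization of the restriction of `Λ` to `[W]`. -/
def IsSTITProcess {ℓ : ℕ} (Λ : Measure (Hyperplane ℓ)) (W : Set (Space ℓ))
    {Ω : Type*} [MeasurableSpace Ω] (P : Measure Ω) (X : ℝ≥0 → Ω → Family W) : Prop :=
  ∃ (Ω' : Type) (_ : MeasurableSpace Ω') (P' : Measure Ω') (_ : IsProbabilityMeasure P')
    (Z : Word → Ω' → ℝ) (G : ℕ → Ω' → Hyperplane ℓ),
    (∀ e, Measurable (Z e) ∧ P'.map (Z e) = expMeasure 1) ∧ iIndepFun Z P' ∧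
    (∀ n : ℕ+, Measurable (G n) ∧ P'.map (G n) = cond Λ (hit W)) ∧
    iIndepFun (fun n : ℕ+ => G n) P' ∧
    IndepFun (fun ω e => Z e ω) (fun ω (n : ℕ+) => G n ω) P' ∧
    IdentDistrib (fun ω t => X t ω)
      (fun ω t => stit Λ W (fun e => Z e ω) (fun n => G n ω) t) P P'

/-! ### The rejection-based chain -/

/-- The state of the algorithm after `n` steps: the set `E_n` of leaves, the cells `C(e)`
constructed so far, and the index `κ_n`. -/
structure State (ℓ : ℕ) : Type where
  leaves : Finset Word
  cell : Word → Set (Space ℓ)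
  index : ℕ

/-- `ζ(𝒴_n)`. -/
noncomputable def State.zeta {ℓ : ℕ} (Λ : Measure (Hyperplane ℓ)) (s : State ℓ) : ℝ :=
  ∑ e ∈ s.leaves, mass Λ (s.cell e)

open Classical in
/-- The left end point `a_e` of the interval of the leaf `e`; the intervals of the leaves are
consecutive with respect to the order of the words. -/
noncomputable def State.left {ℓ : ℕ} (Λ : Measure (Hyperplane ℓ)) (s : State ℓ) (e : Word) : ℝ :=
  ∑ e' ∈ s.leaves with Word.Before e' e, (s.zeta Λ)⁻¹ * mass Λ (s.cell e')

/-- The leaf whose interval `[a_e, b_e)`, of length `Λ([C(e)]) / ζ(𝒴_n)`, contains `u`. -/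
noncomputable def State.select {ℓ : ℕ} (Λ : Measure (Hyperplane ℓ)) (s : State ℓ) (u : ℝ) : Word :=
  Classical.epsilon fun e => e ∈ s.leaves ∧ s.left Λ e ≤ u ∧
    u < s.left Λ e + (s.zeta Λ)⁻¹ * mass Λ (s.cell e)

/-- The indices `j > κ_n` for which `G_j` hits the selected cell. -/
def State.candidates {ℓ : ℕ} (s : State ℓ) (G : ℕ → Hyperplane ℓ) (e : Word) : Set ℕ :=
  {j | s.index < j ∧ G j ∈ hit (s.cell e)}

/-- The state after division of the selected cell by the first `G_j`, `j > κ_n`, that hits it. -/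
noncomputable def State.next {ℓ : ℕ} (Λ : Measure (Hyperplane ℓ)) (s : State ℓ)
    (G : ℕ → Hyperplane ℓ) (u : ℝ) : State ℓ :=
  let e := s.select Λ u
  let k := sInf (s.candidates G e)
  { leaves := insert (false :: e) (insert (true :: e) (s.leaves.erase e))
    cell := Function.update
      (Function.update s.cell (false :: e) (s.cell e ∩ halfSpace (G k) false))
      (true :: e) (s.cell e ∩ halfSpace (G k) true)
    index := k }

/-- The states of the algorithm: `E_0 = {o}`, `C(o) = W`, `κ_0 = 0`, and step `n + 1` uses
`U_{n+1}`. -/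
noncomputable def chain {ℓ : ℕ} (Λ : Measure (Hyperplane ℓ)) (W : Set (Space ℓ))
    (U : ℕ → ℝ) (G : ℕ → Hyperplane ℓ) : ℕ → State ℓ
  | 0 => ⟨{[]}, fun _ => W, 0⟩
  | n + 1 => (chain Λ W U G n).next Λ G (U (n + 1))

/-- The jump times `S_n = ∑_{j=1}^n V_j / ζ(𝒴_{j-1})`. -/
noncomputable def jumpTime {ℓ : ℕ} (Λ : Measure (Hyperplane ℓ)) (W : Set (Space ℓ))
    (U V : ℕ → ℝ) (G : ℕ → Hyperplane ℓ) (n : ℕ) : ℝ :=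
  ∑ j ∈ Finset.range n, ((chain Λ W U G j).zeta Λ)⁻¹ * V (j + 1)

/-- The constructed process: its state at time `t` is `𝒴_n = {C(e) : e ∈ E_n}` when
`S_n ≤ t < S_{n+1}`. -/
noncomputable def rejectionProcess {ℓ : ℕ} (Λ : Measure (Hyperplane ℓ)) (W : Set (Space ℓ))
    (U V : ℕ → ℝ) (G : ℕ → Hyperplane ℓ) (t : ℝ≥0) : Family W :=
  ⟨{C | ∃ n : ℕ, jumpTime Λ W U V G n ≤ t ∧ (t : ℝ) < jumpTime Λ W U V G (n + 1) ∧
    ∃ e ∈ (chain Λ W U G n).leaves, C = (chain Λ W U G n).cell e}⟩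

end STIT

/-!
# The rejection-based chain is a STIT process

A leaf of the tree of divisions carries a cell `C`. In the STIT process this cell lives an
exponential time with parameter `Λ([C])`, independently of the other cells, and it is then divided
by a hyperplane with the law `Λ` conditioned on `[C]`. The first of several independent exponential
clocks rings after an exponential time whose parameter is the sum `ζ` of their parameters; it is the
clock of `C` with probability `Λ([C]) / ζ`, independently of the time; and given all this the other
clocks start afresh. So the next division (word, waiting time, hyperplane) has the law
`divisionLaw`: the leaf is chosen proportionally to `Λ([C])`, the waiting time is exponential with
parameter `ζ`, and the hyperplane has the law `Λ` conditioned on `[C]`. The rejection-based chain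
has the same transition law by construction, since the first term of an i.i.d. sequence that lies
in `[C]` has the conditional law and leaves behind an independent sequence of the same law
(`lintegral_hit`).

The comparison uses one notion: a `Driver` is a deterministic recursion that consumes a random
supply, and `Driver.IsDriven` states that from each good state the next output has a given law and
that the remaining supply is independent of it and distributed as before. Two drivers with the same
transition law have outputs with the same law (`Driver.IsDriven.map_outputs_eq`). This is applied
twice.

* The rejection-based chain (`chainDriver`) and the process of independent clocks in which every
  word has its own stream of hyperplanes (`clockDriver`) both have the transition law `divisionLaw`.
  For the clocks, the supply is replaced by the residual lifetimes, and only its restriction to the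
  words below the leaves matters.
* In the definition of the STIT process all words share one sequence `G`, which they consume in the
  order of the words (`singleStreamDriver`). The resulting hyperplanes have the same law as when
  every word takes the first suitable hyperplane of a stream of its own (`wordStreamDriver`).

Both processes are measurable functions of these outputs: `rejectionProcess_eq_divisionPath` reads
the chain off its divisions, `divisionPath_eq_lifetimePath` identifies the path of the divisions of
the clocks with the path of the lifetimes, and `hyperplane_kappa_eq` with `stit_eq_lifetimePath`
reads the STIT process off its hyperplanes and lifetimes.

Two facts hold only almost surely. First, all cells keep a nonempty interior: a hyperplane that
meets a cell without meeting its interior supports the cell, and on each side there is at most one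
supporting hyperplane for each normal direction. By translation invariance such a bounded set of
hyperplanes is null, because it has infinitely many disjoint translates in a bounded set
(`IsHyperplaneMeasure.ae_cut`). Second, the jump times tend to infinity: after `n` divisions there
are `n + 1` cells, each of parameter at most `Λ([W])`, so the jump times dominate a multiple of
`∑ V k / (k + 1)`, and this diverges by the law of large numbers (`ae_tendsto_harmonic_sum`).
Since this is a property of the law of the divisions, it carries over from the chain to the clocks.
-/

namespace STIT

open scoped ENNReal

/-! ### Cells cut by hyperplanes -/

/-- The open half-spaces of a hyperplane. -/
def openHalfSpace {ℓ : ℕ} (h : Hyperplane ℓ) : Bool → Set (Space ℓ)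
  | false => {x | inner ℝ x (h.2 : Space ℓ) < h.1}
  | true => {x | h.1 < inner ℝ x (h.2 : Space ℓ)}

theorem normal_ne_zero {ℓ : ℕ} (h : Hyperplane ℓ) : (h.2 : Space ℓ) ≠ 0 := by
  have := h.2.2.1
  intro h0
  rw [h0] at this
  simp at this

theorem isClosed_halfSpace {ℓ : ℕ} (h : Hyperplane ℓ) (b : Bool) : IsClosed (halfSpace h b) := by
  cases b
  · exact isClosed_le (by fun_prop) (by fun_prop)
  · exact isClosed_le (by fun_prop) (by fun_prop)

theorem isOpen_openHalfSpace {ℓ : ℕ} (h : Hyperplane ℓ) (b : Bool) :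
    IsOpen (openHalfSpace h b) := by
  cases b
  · exact isOpen_lt (by fun_prop) (by fun_prop)
  · exact isOpen_lt (by fun_prop) (by fun_prop)

theorem openHalfSpace_subset {ℓ : ℕ} (h : Hyperplane ℓ) (b : Bool) :
    openHalfSpace h b ⊆ halfSpace h b := by
  intro x hx
  cases b <;> simp only [openHalfSpace, halfSpace, Set.mem_ofPred_eq] at hx ⊢ <;> exact hx.le

theorem interior_halfSpace {ℓ : ℕ} (h : Hyperplane ℓ) (b : Bool) :
    interior (halfSpace h b) = openHalfSpace h b := by
  refine subset_antisymm ?_ (interior_maximal (openHalfSpace_subset h b) (isOpen_openHalfSpace h b))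
  intro x hx
  -- moving from `x` along the normal stays in the half-space for a short time
  have hu : (0 : ℝ) < inner ℝ (h.2 : Space ℓ) (h.2 : Space ℓ) := by
    rw [real_inner_self_eq_norm_sq, h.2.2.1]; norm_num
  have key : ∀ s : ℝ, Tendsto (fun t : ℝ => x + (t * s) • (h.2 : Space ℓ)) (𝓝[>] 0) (𝓝 x) := by
    intro s
    have : Tendsto (fun t : ℝ => x + (t * s) • (h.2 : Space ℓ)) (𝓝 0)
        (𝓝 (x + ((0 : ℝ) * s) • (h.2 : Space ℓ))) :=
      Continuous.tendsto (by fun_prop) 0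
    simp only [zero_mul, zero_smul, add_zero] at this
    exact this.mono_left nhdsWithin_le_nhds
  have ev : ∀ s : ℝ, ∃ t : ℝ, 0 < t ∧ x + (t * s) • (h.2 : Space ℓ) ∈ halfSpace h b := by
    intro s
    have := ((key s).eventually (mem_interior_iff_mem_nhds.1 hx)).and self_mem_nhdsWithin
    obtain ⟨t, ht, ht0⟩ := this.exists
    exact ⟨t, ht0, ht⟩
  cases b
  · obtain ⟨t, ht, h1⟩ := ev 1
    simp only [halfSpace, Set.mem_ofPred_eq, inner_add_left, inner_smul_left] at h1
    simp only [openHalfSpace, Set.mem_ofPred_eq]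
    have : 0 < t * inner ℝ (h.2 : Space ℓ) (h.2 : Space ℓ) := mul_pos ht hu
    simp at h1 this ⊢
    linarith
  · obtain ⟨t, ht, h1⟩ := ev (-1)
    simp only [halfSpace, Set.mem_ofPred_eq, inner_add_left, inner_smul_left] at h1
    simp only [openHalfSpace, Set.mem_ofPred_eq]
    have : 0 < t * inner ℝ (h.2 : Space ℓ) (h.2 : Space ℓ) := mul_pos ht hu
    simp at h1 this ⊢
    linarith

theorem disjoint_openHalfSpace {ℓ : ℕ} (h : Hyperplane ℓ) :
    Disjoint (openHalfSpace h false) (openHalfSpace h true) := by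
  rw [Set.disjoint_left]
  intro x hx hx'
  exact lt_asymm (show inner ℝ x (h.2 : Space ℓ) < h.1 from hx) hx'

theorem halfSpace_union {ℓ : ℕ} (h : Hyperplane ℓ) :
    halfSpace h false ∪ halfSpace h true = Set.univ := by
  ext x
  simpa [halfSpace] using le_total (inner ℝ x (h.2 : Space ℓ)) h.1

theorem cell_subset {ℓ : ℕ} (W : Set (Space ℓ)) (H : Word → Hyperplane ℓ) (e : Word) :
    cell W H e ⊆ W := by
  induction e with
  | nil => exact subset_rfl
  | cons b e ih => exact Set.inter_subset_left.trans ih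

/-- A cell depends only on the hyperplanes of the proper ancestors of its word. -/
theorem cell_congr_suffix {ℓ : ℕ} (W : Set (Space ℓ)) {H H' : Word → Hyperplane ℓ} {e : Word}
    (h : ∀ e', e' <:+ e → e' ≠ e → H e' = H' e') : cell W H e = cell W H' e := by
  induction e with
  | nil => rfl
  | cons b e ih =>
    have hb : H e = H' e := h e (List.suffix_cons b e) (by simp)
    rw [cell, cell, hb, ih]
    intro e' he' hne
    refine h e' (he'.trans (List.suffix_cons b e)) ?_
    rintro rfl
    have := he'.length_le
    simp at this

theorem isClosed_cell {ℓ : ℕ} {W : Set (Space ℓ)} (hW : IsClosed W) (H : Word → Hyperplane ℓ)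
    (e : Word) : IsClosed (cell W H e) := by
  induction e with
  | nil => exact hW
  | cons b e ih => exact ih.inter (isClosed_halfSpace _ _)

/-! ### Cutting a polytope -/

/-- A convex set contains the perspective images of convex combinations, if it contains those of
the two points. -/
theorem inv_smul_combo_mem_of_convex {E : Type*} [AddCommGroup E] [Module ℝ E] {X : Set E}
    (hX : Convex ℝ X) {d d' : ℝ} (hd : 0 < d) (hd' : 0 < d') {n n' : E} (hn : d⁻¹ • n ∈ X)
    (hn' : d'⁻¹ • n' ∈ X) {s t : ℝ} (hs : 0 ≤ s) (ht : 0 ≤ t) (hst : s + t = 1) :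
    (s * d + t * d')⁻¹ • (s • n + t • n') ∈ X := by
  have hpos : 0 < s * d + t * d' := by
    rcases hs.eq_or_lt with rfl | hs
    · have : t = 1 := by linarith
      subst this; simpa using hd'
    · have := mul_pos hs hd
      have := mul_nonneg ht hd'.le
      linarith
  have h := hX hn hn' (a := (s * d + t * d')⁻¹ * (s * d)) (b := (s * d + t * d')⁻¹ * (t * d'))
    (by positivity) (by positivity) (by rw [← mul_add, inv_mul_cancel₀ hpos.ne'])
  convert h using 1
  rw [smul_add, smul_smul, smul_smul, smul_smul, smul_smul]
  congr 2
  · field_simp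
  · field_simp

theorem isLinearMap_inner_left {ℓ : ℕ} (u : Space ℓ) :
    IsLinearMap ℝ fun x : Space ℓ => inner ℝ x u :=
  ⟨fun _ _ => inner_add_left _ _ _, fun _ _ => real_inner_smul_left _ _ _⟩

theorem convex_inner_le {ℓ : ℕ} (u : Space ℓ) (α : ℝ) :
    Convex ℝ {x : Space ℓ | inner ℝ x u ≤ α} :=
  convex_halfSpace_le (isLinearMap_inner_left u) α

theorem convex_lt_inner {ℓ : ℕ} (u : Space ℓ) (α : ℝ) :
    Convex ℝ {x : Space ℓ | α < inner ℝ x u} :=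
  convex_halfSpace_gt (isLinearMap_inner_left u) α

/-- The point where the segment from `a` to `b` meets the hyperplane `⟨x, u⟩ = α`, for `a` and `b`
on different sides of it. -/
noncomputable def crossing {ℓ : ℕ} (u : Space ℓ) (α : ℝ) (a b : Space ℓ) : Space ℓ :=
  (inner ℝ b u - inner ℝ a u)⁻¹ • ((inner ℝ b u - α) • a + (α - inner ℝ a u) • b)

theorem inner_crossing {ℓ : ℕ} {u : Space ℓ} {α : ℝ} {a b : Space ℓ} (ha : inner ℝ a u ≤ α)
    (hb : α < inner ℝ b u) : inner ℝ (crossing u α a b) u = α := by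
  have h : inner ℝ b u - inner ℝ a u ≠ 0 := by linarith
  rw [crossing, real_inner_smul_left, inner_add_left, real_inner_smul_left, real_inner_smul_left]
  field_simp
  ring

theorem crossing_mem_segment {ℓ : ℕ} {u : Space ℓ} {α : ℝ} {a b : Space ℓ} (ha : inner ℝ a u ≤ α)
    (hb : α < inner ℝ b u) : crossing u α a b ∈ segment ℝ a b := by
  have h : 0 < inner ℝ b u - inner ℝ a u := by linarith
  refine ⟨(inner ℝ b u - inner ℝ a u)⁻¹ * (inner ℝ b u - α),
    (inner ℝ b u - inner ℝ a u)⁻¹ * (α - inner ℝ a u), ?_, ?_, ?_, ?_⟩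
  · exact mul_nonneg (inv_nonneg.2 h.le) (by linarith)
  · exact mul_nonneg (inv_nonneg.2 h.le) (by linarith)
  · field_simp
    ring
  · rw [crossing, smul_add, smul_smul, smul_smul]

/-- The crossing points of the segments between two polytopes on different sides of a hyperplane
are convex combinations of the crossing points of the segments between their vertices. -/
theorem crossing_mem_convexHull {ℓ : ℕ} (u : Space ℓ) (α : ℝ) {A B : Set (Space ℓ)}
    (hA : ∀ a ∈ A, inner ℝ a u ≤ α) (hB : ∀ b ∈ B, α < inner ℝ b u)
    {a b : Space ℓ} (ha : a ∈ convexHull ℝ A) (hb : b ∈ convexHull ℝ B) :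
    crossing u α a b ∈ convexHull ℝ (Set.image2 (crossing u α) A B) := by
  set X := convexHull ℝ (Set.image2 (crossing u α) A B) with hXdef
  have hX : Convex ℝ X := convex_convexHull ℝ _
  -- first for a vertex `b`, by convexity in `a`
  have h1 : ∀ b ∈ B, convexHull ℝ A ⊆ {a | inner ℝ a u ≤ α ∧ crossing u α a b ∈ X} := by
    intro b hb
    refine convexHull_min (fun a ha => ⟨hA a ha, subset_convexHull ℝ _ ⟨a, ha, b, hb, rfl⟩⟩) ?_
    rintro a ⟨ha, hax⟩ a' ⟨ha', hax'⟩ s t hs ht hst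
    have hbα := hB b hb
    refine ⟨?_, ?_⟩
    · exact convex_inner_le u α ha ha' hs ht hst
    · have := inv_smul_combo_mem_of_convex hX (by linarith) (by linarith) hax hax' hs ht hst
      convert this using 1
      rw [crossing, inner_add_left, real_inner_smul_left, real_inner_smul_left]
      have hs' : s = 1 - t := by linarith
      subst hs'
      congr 1
      · congr 1; ring
      · module
  have h2 : convexHull ℝ B ⊆ {b | α < inner ℝ b u ∧ crossing u α a b ∈ X} := by
    refine convexHull_min (fun b hb => ⟨hB b hb, (h1 b hb ha).2⟩) ?_
    have haα : inner ℝ a u ≤ α := convexHull_min hA (convex_inner_le u α) ha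
    rintro b ⟨hb, hbx⟩ b' ⟨hb', hbx'⟩ s t hs ht hst
    refine ⟨?_, ?_⟩
    · exact convex_lt_inner u α hb hb' hs ht hst
    · have := inv_smul_combo_mem_of_convex hX (by linarith) (by linarith) hbx hbx' hs ht hst
      convert this using 1
      rw [crossing, inner_add_left, real_inner_smul_left, real_inner_smul_left]
      have hs' : s = 1 - t := by linarith
      subst hs'
      congr 1
      · congr 1; ring
      · module
  exact (h2 hb).2

/-- Cutting a polytope by a half-space gives a polytope: its vertices are among those on the
right side and the crossing points of the edges. -/
theorem exists_finite_convexHull_inter {ℓ : ℕ} (u : Space ℓ) (α : ℝ) {F : Set (Space ℓ)}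
    (hF : F.Finite) : ∃ F' : Set (Space ℓ), F'.Finite ∧
      convexHull ℝ F ∩ {x | inner ℝ x u ≤ α} = convexHull ℝ F' := by
  set A := F ∩ {x | inner ℝ x u ≤ α} with hAdef
  set B := F ∩ {x | α < inner ℝ x u} with hBdef
  have hF' : F = A ∪ B := by
    ext x
    simp only [hAdef, hBdef, Set.mem_union, Set.mem_inter_iff, Set.mem_ofPred_eq]
    have := le_or_gt (inner ℝ x u) α
    tauto
  have hA : ∀ a ∈ A, inner ℝ a u ≤ α := fun a ha => ha.2
  have hB : ∀ b ∈ B, α < inner ℝ b u := fun b hb => hb.2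
  have hAf : A.Finite := hF.inter_of_left _
  have hBf : B.Finite := hF.inter_of_left _
  refine ⟨A ∪ Set.image2 (crossing u α) A B, hAf.union (hAf.image2 _ hBf), ?_⟩
  refine subset_antisymm ?_ ?_
  · rintro x ⟨hx, hxα⟩
    rcases B.eq_empty_or_nonempty with hB0 | hB0
    · rw [hF', hB0, Set.union_empty] at hx
      exact convexHull_mono Set.subset_union_left hx
    rcases A.eq_empty_or_nonempty with hA0 | hA0
    · exfalso
      rw [hF', hA0, Set.empty_union] at hx
      have h : α < inner ℝ x u := convexHull_min hB (convex_lt_inner u α) hx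
      exact absurd h (not_lt.2 hxα)
    rw [hF', convexHull_union hA0 hB0, mem_convexJoin] at hx
    obtain ⟨a, ha, b, hb, hx⟩ := hx
    have haα : inner ℝ a u ≤ α := convexHull_min hA (convex_inner_le u α) ha
    have hbα : α < inner ℝ b u := convexHull_min hB (convex_lt_inner u α) hb
    have hc := crossing_mem_convexHull u α hA hB ha hb
    -- `x` lies between `a` and the crossing point of the segment from `a` to `b`
    have hseg : x ∈ segment ℝ a (crossing u α a b) := by
      obtain ⟨s, t, hs, ht, hst, rfl⟩ := hx
      simp only [Set.mem_ofPred_eq] at hxα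
      rw [inner_add_left, real_inner_smul_left, real_inner_smul_left] at hxα
      have hs' : s = 1 - t := by linarith
      subst hs'
      have hd : 0 < inner ℝ b u - inner ℝ a u := by linarith
      have htd : t * (inner ℝ b u - inner ℝ a u) ≤ α - inner ℝ a u := by linarith
      rcases haα.eq_or_lt with h0 | h0
      · have ht0 : t = 0 := by
          have : t * (inner ℝ b u - inner ℝ a u) ≤ 0 := by linarith
          nlinarith
        subst ht0
        simpa using left_mem_segment ℝ a (crossing u α a b)
      · have hpos : 0 < α - inner ℝ a u := by linarith
        refine ⟨1 - t * (inner ℝ b u - inner ℝ a u) / (α - inner ℝ a u),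
          t * (inner ℝ b u - inner ℝ a u) / (α - inner ℝ a u), ?_, by positivity, by ring, ?_⟩
        · rw [sub_nonneg, div_le_one hpos]
          exact htd
        · rw [crossing, smul_smul, smul_add, smul_smul, smul_smul, ← add_assoc, ← add_smul]
          congr 2
          · field_simp
            ring
          · field_simp
    exact (convex_convexHull ℝ _).segment_subset (convexHull_mono Set.subset_union_left ha)
      (convexHull_mono Set.subset_union_right hc) hseg
  · refine convexHull_min ?_ ((convex_convexHull ℝ F).inter (convex_inner_le u α))
    rintro x (hx | ⟨a, ha, b, hb, rfl⟩)
    · exact ⟨subset_convexHull ℝ F hx.1, hx.2⟩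
    · refine ⟨?_, (inner_crossing (hA a ha) (hB b hb)).le⟩
      exact (convex_convexHull ℝ F).segment_subset (subset_convexHull ℝ F ha.1)
        (subset_convexHull ℝ F hb.1) (crossing_mem_segment (hA a ha) (hB b hb))

theorem isCell_cell {ℓ : ℕ} {W : Set (Space ℓ)} (hW : IsCell W) (H : Word → Hyperplane ℓ)
    {e : Word} (he : (interior (cell W H e)).Nonempty) : IsCell (cell W H e) := by
  refine ⟨?_, he⟩
  clear he
  induction e with
  | nil => exact hW.1
  | cons b e ih =>
    obtain ⟨F, hF, hFe⟩ := ih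
    cases b
    · obtain ⟨F', hF', h⟩ := exists_finite_convexHull_inter ((H e).2 : Space ℓ) (H e).1 hF
      exact ⟨F', hF', by rw [← h, ← hFe]; rfl⟩
    · obtain ⟨F', hF', h⟩ := exists_finite_convexHull_inter (-((H e).2 : Space ℓ)) (-(H e).1) hF
      refine ⟨F', hF', ?_⟩
      rw [← h, ← hFe, cell]
      congr 1
      ext x
      simp [halfSpace]

theorem IsCell.isCompact {ℓ : ℕ} {W : Set (Space ℓ)} (hW : IsCell W) : IsCompact W := by
  obtain ⟨⟨F, hF, rfl⟩, -⟩ := hW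
  exact hF.isCompact_convexHull ℝ

theorem IsCell.convex {ℓ : ℕ} {W : Set (Space ℓ)} (hW : IsCell W) : Convex ℝ W := by
  obtain ⟨⟨F, hF, rfl⟩, -⟩ := hW
  exact convex_convexHull ℝ _

/-! ### Measurability of cells -/

theorem isClosed_exists_mem_of_isCompact {X Y : Type*} [TopologicalSpace X] [TopologicalSpace Y]
    {K : Set Y} (hK : IsCompact K) {S : Set (X × Y)} (hS : IsClosed S) :
    IsClosed {x | ∃ y ∈ K, (x, y) ∈ S} := by
  have : CompactSpace K := isCompact_iff_compactSpace.1 hK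
  have h : IsClosed ((fun p : X × K => (p.1, (p.2 : Y))) ⁻¹' S) := hS.preimage (by fun_prop)
  convert isClosedMap_fst_of_compactSpace _ h using 1
  ext x
  simp

theorem isClosed_setOf_mem_cell {ℓ : ℕ} {W : Set (Space ℓ)} (hW : IsClosed W) (e : Word) :
    IsClosed {p : (Word → Hyperplane ℓ) × Space ℓ | p.2 ∈ cell W p.1 e} := by
  induction e with
  | nil => exact hW.preimage continuous_snd
  | cons b e ih =>
    refine ih.inter (?_ : IsClosed {p : (Word → Hyperplane ℓ) × Space ℓ |
      p.2 ∈ halfSpace (p.1 e) b})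
    cases b
    · change IsClosed {p : (Word → Hyperplane ℓ) × Space ℓ |
        inner ℝ p.2 ((p.1 e).2 : Space ℓ) ≤ (p.1 e).1}
      exact isClosed_le (by fun_prop) (by fun_prop)
    · change IsClosed {p : (Word → Hyperplane ℓ) × Space ℓ |
        (p.1 e).1 ≤ inner ℝ p.2 ((p.1 e).2 : Space ℓ)}
      exact isClosed_le (by fun_prop) (by fun_prop)

theorem interior_cell_cons {ℓ : ℕ} (W : Set (Space ℓ)) (H : Word → Hyperplane ℓ) (b : Bool)
    (e : Word) :
    interior (cell W H (b :: e)) = interior (cell W H e) ∩ openHalfSpace (H e) b := by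
  rw [cell, interior_inter, interior_halfSpace]

theorem isOpen_setOf_mem_interior_cell {ℓ : ℕ} (W : Set (Space ℓ)) (e : Word) :
    IsOpen {p : (Word → Hyperplane ℓ) × Space ℓ | p.2 ∈ interior (cell W p.1 e)} := by
  induction e with
  | nil => exact isOpen_interior.preimage continuous_snd
  | cons b e ih =>
    simp only [interior_cell_cons]
    refine ih.inter (?_ : IsOpen {p : (Word → Hyperplane ℓ) × Space ℓ |
      p.2 ∈ openHalfSpace (p.1 e) b})
    cases b
    · change IsOpen {p : (Word → Hyperplane ℓ) × Space ℓ |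
        inner ℝ p.2 ((p.1 e).2 : Space ℓ) < (p.1 e).1}
      exact isOpen_lt (by fun_prop) (by fun_prop)
    · change IsOpen {p : (Word → Hyperplane ℓ) × Space ℓ |
        (p.1 e).1 < inner ℝ p.2 ((p.1 e).2 : Space ℓ)}
      exact isOpen_lt (by fun_prop) (by fun_prop)

theorem measurableSet_interior_cell_nonempty {ℓ : ℕ} (W : Set (Space ℓ)) (e : Word) :
    MeasurableSet {H : Word → Hyperplane ℓ | (interior (cell W H e)).Nonempty} := by
  have h := isOpenMap_fst _ (isOpen_setOf_mem_interior_cell W e)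
  refine (IsOpen.measurableSet ?_)
  convert h using 1
  ext H
  simp [Set.Nonempty]

theorem measurableSet_frontier_cell {ℓ : ℕ} {W : Set (Space ℓ)} (hW : IsClosed W) (e : Word)
    {A : Set (Space ℓ)} (hA : IsCompact A) :
    MeasurableSet {H : Word → Hyperplane ℓ | (frontier (cell W H e) ∩ A).Nonempty} := by
  have h := isClosed_exists_mem_of_isCompact hA ((isClosed_setOf_mem_cell hW e).inter
    (isOpen_setOf_mem_interior_cell W e).isClosed_compl)
  refine (IsClosed.measurableSet ?_)
  convert h using 1
  ext H
  simp only [(isClosed_cell hW H e).frontier_eq, Set.Nonempty, Set.mem_inter_iff, Set.mem_sdiff,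
    Set.mem_ofPred_eq, Set.mem_compl_iff]
  exact exists_congr fun x => and_comm

/-- Whether a hyperplane hits a cell is jointly measurable in the hyperplane and in those that
bound the cell. -/
theorem measurableSet_setOf_mem_hit_cell {ℓ : ℕ} {W : Set (Space ℓ)} (hW : IsCompact W)
    (e : Word) :
    MeasurableSet {p : (Word → Hyperplane ℓ) × Hyperplane ℓ | p.2 ∈ hit (cell W p.1 e)} := by
  have h1 : IsClosed {q : ((Word → Hyperplane ℓ) × Hyperplane ℓ) × Space ℓ |
      inner ℝ q.2 (q.1.2.2 : Space ℓ) = q.1.2.1} := isClosed_eq (by fun_prop) (by fun_prop)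
  have h2 : IsClosed {q : ((Word → Hyperplane ℓ) × Hyperplane ℓ) × Space ℓ |
      q.2 ∈ cell W q.1.1 e} :=
    (isClosed_setOf_mem_cell hW.isClosed e).preimage
      (f := fun q : ((Word → Hyperplane ℓ) × Hyperplane ℓ) × Space ℓ => (q.1.1, q.2))
      (by fun_prop)
  have h := isClosed_exists_mem_of_isCompact hW (h1.inter h2)
  refine (IsClosed.measurableSet ?_)
  convert h using 1
  ext p
  simp only [hit, pointSet, Set.Nonempty, Set.mem_inter_iff, Set.mem_ofPred_eq]
  exact exists_congr fun x => ⟨fun hx => ⟨cell_subset _ _ _ hx.2, hx⟩, fun hx => hx.2⟩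

theorem measurableSet_hit {ℓ : ℕ} {C : Set (Space ℓ)} (hC : IsCompact C) :
    MeasurableSet (hit C) := by
  rcases isEmpty_or_nonempty (Hyperplane ℓ) with h | ⟨⟨h0⟩⟩
  · exact Set.Subsingleton.measurableSet fun x => (h.false x).elim
  · exact (measurableSet_setOf_mem_hit_cell hC []).preimage
      (f := fun h : Hyperplane ℓ => ((fun _ => h0), h)) (by fun_prop)

theorem hit_mono {ℓ : ℕ} {C D : Set (Space ℓ)} (h : C ⊆ D) : hit C ⊆ hit D :=
  fun _ hx => hx.mono (Set.inter_subset_inter_right _ h)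

theorem IsHyperplaneMeasure.hit_lt_top {ℓ : ℕ} {Λ : Measure (Hyperplane ℓ)}
    (hΛ : IsHyperplaneMeasure Λ) {C : Set (Space ℓ)} (hC : Bornology.IsBounded C) :
    Λ (hit C) < ⊤ :=
  (measure_mono (hit_mono subset_closure)).trans_lt
    (hΛ.locally_finite _ isClosed_closure.measurableSet hC.closure)

/-- The rates of the cells depend measurably on the hyperplanes. -/
theorem measurable_mass_cell {ℓ : ℕ} {Λ : Measure (Hyperplane ℓ)} (hΛ : IsHyperplaneMeasure Λ)
    {W : Set (Space ℓ)} (hW : IsCompact W) (e : Word) :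
    Measurable fun H : Word → Hyperplane ℓ => mass Λ (cell W H e) := by
  -- only the finite measure of the hyperplanes that hit the window matters
  have : IsFiniteMeasure (Λ.restrict (hit W)) :=
    ⟨by simpa using hΛ.hit_lt_top hW.isBounded⟩
  have h := measurable_measure_prodMk_left (ν := Λ.restrict (hit W))
    (measurableSet_setOf_mem_hit_cell hW e)
  convert h.ennreal_toReal using 2 with H
  have hs : hit (cell W H e) ⊆ hit W := hit_mono (cell_subset W H e)
  have hr := Measure.restrict_eq_self Λ hs
  exact (congrArg ENNReal.toReal hr).symm

/-! ### Hyperplanes that touch a cell -/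

theorem measurable_translate {ℓ : ℕ} (x : Space ℓ) : Measurable (translate (ℓ := ℓ) x) := by
  have : Continuous (translate (ℓ := ℓ) x) := by
    unfold translate
    fun_prop
  exact this.measurable

theorem IsHyperplaneMeasure.measure_preimage_translate {ℓ : ℕ} {Λ : Measure (Hyperplane ℓ)}
    (hΛ : IsHyperplaneMeasure Λ) (x : Space ℓ) {B : Set (Hyperplane ℓ)} (hB : MeasurableSet B) :
    Λ (translate x ⁻¹' B) = Λ B := by
  conv_rhs => rw [← hΛ.translation_invariant x, Measure.map_apply (measurable_translate x) hB]

/-- A bounded set of hyperplanes that contains at most one hyperplane for each normal direction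
is a null set, since it has infinitely many disjoint translates in a bounded set. -/
theorem IsHyperplaneMeasure.measure_eq_zero_of_unique {ℓ : ℕ} {Λ : Measure (Hyperplane ℓ)}
    (hΛ : IsHyperplaneMeasure Λ) {B : Set (Hyperplane ℓ)} (hB : MeasurableSet B)
    {C : Set (Space ℓ)} (hC : Bornology.IsBounded C) (hBC : B ⊆ hit C)
    (huniq : ∀ h ∈ B, ∀ h' ∈ B, h.2 = h'.2 → h = h') : Λ B = 0 := by
  have key : ∀ i : Fin ℓ, Λ (B ∩ {h | (h.2 : Space ℓ) i ≠ 0}) = 0 := by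
    intro i
    set Bi := B ∩ {h : Hyperplane ℓ | (h.2 : Space ℓ) i ≠ 0} with hBi
    have hBim : MeasurableSet Bi := by
      refine hB.inter (IsOpen.measurableSet ?_)
      exact isOpen_ne_fun (by fun_prop) (by fun_prop)
    -- bounded translations that move all hyperplanes of `Bi` by different amounts
    set v : ℕ → Space ℓ := fun k => (1 / ((k : ℝ) + 1)) • EuclideanSpace.single i (1 : ℝ) with hv
    have hvinj : ∀ k k', k ≠ k' → Disjoint (translate (v k) ⁻¹' Bi) (translate (v k') ⁻¹' Bi) := by
      intro k k' hkk'
      rw [Set.disjoint_left]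
      rintro h ⟨h1, h1'⟩ ⟨h2, -⟩
      have := congrArg Prod.fst (huniq _ h1 _ h2 rfl)
      simp only [translate, hv, real_inner_smul_left, EuclideanSpace.inner_single_left, map_one,
        one_mul] at this
      have hi : (h.2 : Space ℓ) i ≠ 0 := h1'
      have h3 := mul_right_cancel₀ hi (add_left_cancel this)
      rw [one_div, one_div, inv_inj, add_left_inj, Nat.cast_inj] at h3
      exact hkk' h3
    by_contra hne
    have hsum : Λ (⋃ k, translate (v k) ⁻¹' Bi) = ∑' _ : ℕ, Λ Bi := by
      rw [measure_iUnion (fun k k' h => hvinj k k' h) fun k => measurable_translate _ hBim]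
      exact tsum_congr fun k => hΛ.measure_preimage_translate _ hBim
    rw [ENNReal.tsum_const_eq_top_of_ne_zero hne] at hsum
    have hbdd : Bornology.IsBounded (Metric.cthickening 1 C) := hC.cthickening
    refine absurd hsum ((measure_mono ?_).trans_lt (hΛ.hit_lt_top hbdd)).ne
    refine Set.iUnion_subset fun k h hh => ?_
    obtain ⟨y, hy, hyC⟩ := hBC hh.1
    rw [pointSet_translate] at hy
    obtain ⟨z, hz, rfl⟩ := hy
    refine ⟨z, hz, Metric.mem_cthickening_of_dist_le z (z + v k) 1 C hyC ?_⟩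
    rw [dist_self_add_right, hv]
    simp only [norm_smul, PiLp.norm_single, norm_one, mul_one, Real.norm_eq_abs]
    rw [abs_of_pos (by positivity), div_le_one (by positivity)]
    linarith [(Nat.cast_nonneg k : (0 : ℝ) ≤ k)]
  refine measure_mono_null (t := ⋃ i : Fin ℓ, B ∩ {h | (h.2 : Space ℓ) i ≠ 0}) ?_
    (measure_iUnion_null key)
  intro h hh
  have : ∃ i, (h.2 : Space ℓ) i ≠ 0 := by
    by_contra! h0
    exact normal_ne_zero h (by ext i; simpa using h0 i)
  obtain ⟨i, hi⟩ := this
  exact Set.mem_iUnion.2 ⟨i, hh, hi⟩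

/-- Almost every hyperplane that hits a cell divides it into two cells. -/
theorem IsHyperplaneMeasure.ae_cut {ℓ : ℕ} {Λ : Measure (Hyperplane ℓ)}
    (hΛ : IsHyperplaneMeasure Λ) {C : Set (Space ℓ)} (hC : IsCompact C) (hconv : Convex ℝ C)
    (hint : (interior C).Nonempty) :
    ∀ᵐ h ∂Λ, h ∈ hit C → ∀ b, (interior (C ∩ halfSpace h b)).Nonempty := by
  have hcl : C ⊆ closure (interior C) := by
    rw [hconv.closure_interior_eq_closure_of_nonempty_interior hint]
    exact subset_closure
  -- on each side of `C` there is at most one supporting hyperplane for each normal direction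
  have hnull : ∀ b, Λ (hit C ∩ {h | C ∩ openHalfSpace h b = ∅}) = 0 := by
    intro b
    refine hΛ.measure_eq_zero_of_unique ?_ hC.isBounded Set.inter_subset_left ?_
    · refine (measurableSet_hit hC).inter ?_
      have hopen : IsOpen (⋃ x ∈ C, {h : Hyperplane ℓ | x ∈ openHalfSpace h b}) := by
        refine isOpen_biUnion fun x _ => ?_
        cases b
        · change IsOpen {h : Hyperplane ℓ | inner ℝ x (h.2 : Space ℓ) < h.1}
          exact isOpen_lt (by fun_prop) (by fun_prop)
        · change IsOpen {h : Hyperplane ℓ | h.1 < inner ℝ x (h.2 : Space ℓ)}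
          exact isOpen_lt (by fun_prop) (by fun_prop)
      convert hopen.measurableSet.compl using 1
      ext h
      simp [Set.eq_empty_iff_forall_notMem]
    · rintro ⟨α, u⟩ ⟨⟨x, hx, hxC⟩, h1⟩ ⟨α', u'⟩ ⟨⟨x', hx', hxC'⟩, h2⟩ rfl
      have e1 := Set.eq_empty_iff_forall_notMem.1 h1 x'
      have e2 := Set.eq_empty_iff_forall_notMem.1 h2 x
      simp only [pointSet, Set.mem_ofPred_eq] at hx hx'
      cases b <;>
      · simp only [openHalfSpace, Set.mem_inter_iff, hxC', hxC, true_and, Set.mem_ofPred_eq,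
          not_lt] at e1 e2
        rw [hx'] at e1
        rw [hx] at e2
        exact Prod.ext (by dsimp only; linarith) rfl
  have hae : ∀ b, ∀ᵐ h ∂Λ, ¬ (h ∈ hit C ∩ {h | C ∩ openHalfSpace h b = ∅}) := by
    intro b
    exact measure_eq_zero_iff_ae_notMem.1 (hnull b)
  filter_upwards [hae false, hae true] with h h1 h2 hh b
  have : (C ∩ openHalfSpace h b).Nonempty := by
    rw [Set.nonempty_iff_ne_empty]
    intro h0
    cases b
    · exact h1 ⟨hh, h0⟩
    · exact h2 ⟨hh, h0⟩
  obtain ⟨x, hxC, hx⟩ := this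
  obtain ⟨y, hy, hyi⟩ := mem_closure_iff.1 (hcl hxC) _ (isOpen_openHalfSpace h b) hx
  rw [interior_inter, interior_halfSpace]
  exact ⟨y, hyi, hy⟩

/-- The hyperplanes that hit a cell have positive measure, since countably many translates of
this set of hyperplanes are all of them. -/
theorem IsHyperplaneMeasure.hit_ne_zero {ℓ : ℕ} {Λ : Measure (Hyperplane ℓ)}
    (hΛ : IsHyperplaneMeasure Λ) {C : Set (Space ℓ)}
    (hint : (interior C).Nonempty) : Λ (hit C) ≠ 0 := by
  intro h0
  obtain ⟨x, hx⟩ := hint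
  apply hΛ.ne_zero
  rw [← Measure.measure_univ_eq_zero]
  set q := TopologicalSpace.denseSeq (Space ℓ) with hq
  refine measure_mono_null (t := ⋃ k, translate (q k) ⁻¹' hit C) ?_
    (measure_iUnion_null fun k => ?_)
  · intro h _
    have hne : (pointSet h).Nonempty := by
      refine ⟨h.1 • (h.2 : Space ℓ), ?_⟩
      have := real_inner_self_eq_norm_sq (h.2 : Space ℓ)
      rw [h.2.2.1] at this
      simp only [pointSet, Set.mem_ofPred_eq, real_inner_smul_left, this]
      norm_num
    obtain ⟨y, hy⟩ := hne
    have hopen : IsOpen ((fun z => y + z) ⁻¹' interior C) := isOpen_interior.preimage (by fun_prop)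
    obtain ⟨k, hk⟩ := (TopologicalSpace.denseRange_denseSeq (Space ℓ)).exists_mem_open hopen
      ⟨x - y, by simpa using hx⟩
    refine Set.mem_iUnion.2 ⟨k, y + q k, ?_, interior_subset hk⟩
    rw [pointSet_translate]
    exact ⟨y, hy, rfl⟩
  · have hmp : MeasurePreserving (translate (q k)) Λ Λ :=
      ⟨measurable_translate _, hΛ.translation_invariant _⟩
    exact hmp.quasiMeasurePreserving.preimage_null h0

/-! ### Words -/

/-- The word of a given rank. -/
def unrank : ℕ → Word
  | 0 => []
  | n + 1 => (n % 2 == 1) :: unrank (n / 2)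
decreasing_by omega

theorem rank_cons (b : Bool) (e : Word) : Word.rank (b :: e) = 2 * Word.rank e + 1 + b.toNat := rfl

theorem rank_unrank (n : ℕ) : Word.rank (unrank n) = n := by
  induction n using Nat.strong_induction_on with
  | _ n ih =>
    cases n with
    | zero => simp [unrank, Word.rank]
    | succ n =>
      rw [unrank, rank_cons, ih (n / 2) (by omega)]
      rcases Nat.mod_two_eq_zero_or_one n with h | h <;> simp [h] <;> omega

theorem unrank_rank (e : Word) : unrank (Word.rank e) = e := by
  induction e with
  | nil => simp [unrank, Word.rank]
  | cons b e ih =>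
    rw [rank_cons]
    cases b
    · have h : 2 * Word.rank e / 2 = Word.rank e := by omega
      simp [unrank, ih]
    · have h : (2 * Word.rank e + 1) / 2 = Word.rank e := by omega
      simp [unrank, h, ih, Nat.add_mod]

theorem rank_injective : Function.Injective Word.rank :=
  Function.LeftInverse.injective unrank_rank

theorem rank_lt_iff {e e' : Word} : Word.rank e < Word.rank e' ↔ Word.Before e e' := by
  refine ⟨fun h => ?_, Word.rank_lt_of_before⟩
  have h1 : ¬ Word.Before e' e := fun h' => lt_asymm h (Word.rank_lt_of_before h')
  have h2 : e ≠ e' := by rintro rfl; exact lt_irrefl _ h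
  simp only [Word.Before, not_or, not_and] at h1 ⊢
  rcases lt_trichotomy e.length e'.length with hl | hl | hl
  · exact Or.inl hl
  · refine Or.inr ⟨hl, ?_⟩
    rcases trichotomous_of (List.Lex (· < ·)) e.reverse e'.reverse with h | h | h
    · exact h
    · exact absurd (List.reverse_injective h) h2
    · exact absurd h (h1.2 hl.symm)
  · exact absurd hl h1.1

theorem rank_lt_of_suffix {e e' : Word} (h : e <:+ e') (hne : e ≠ e') :
    Word.rank e < Word.rank e' := by
  refine Word.rank_lt_of_before (Or.inl ?_)
  refine lt_of_le_of_ne h.length_le fun hl => hne (h.eq_of_length hl)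

theorem exists_cons_suffix {w e : Word} (h : w <:+ e) (hne : w ≠ e) : ∃ b, b :: w <:+ e := by
  obtain ⟨l, rfl⟩ := h
  rcases List.eq_nil_or_concat l with rfl | ⟨l', b, rfl⟩
  · simp at hne
  · exact ⟨b, l', by simp⟩

/-- The words of the cells of a tessellation that arises by successive divisions: none of them is
a descendant of another one, and every word is an ancestor or a descendant of one of them.
(With reversed words, `e` is an ancestor of `e'` if it is a suffix of `e'`.) -/
structure IsLeafSet (E : Finset Word) : Prop where
  eq_of_suffix : ∀ e ∈ E, ∀ e' ∈ E, e <:+ e' → e = e'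
  comparable : ∀ e, ∃ e' ∈ E, e <:+ e' ∨ e' <:+ e

/-- The set of leaves after the division of `w`. -/
def splitLeaves (E : Finset Word) (w : Word) : Finset Word :=
  insert (false :: w) (insert (true :: w) (E.erase w))

theorem mem_splitLeaves {E : Finset Word} {w e : Word} :
    e ∈ splitLeaves E w ↔ (∃ b, e = b :: w) ∨ (e ≠ w ∧ e ∈ E) := by
  simp [splitLeaves, or_assoc]

theorem cons_ne_self' {w : Word} (b : Bool) : b :: w ≠ w := fun h => by
  simpa using congrArg List.length h

theorem IsLeafSet.singleton_nil : IsLeafSet {[]} :=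
  ⟨by simp, by simp⟩

theorem IsLeafSet.cons_notMem {E : Finset Word} (hE : IsLeafSet E) {w : Word} (hw : w ∈ E)
    (b : Bool) : b :: w ∉ E := fun h =>
  cons_ne_self' b (hE.eq_of_suffix _ hw _ h (List.suffix_cons _ _)).symm

theorem IsLeafSet.split {E : Finset Word} (hE : IsLeafSet E) {w : Word} (hw : w ∈ E) :
    IsLeafSet (splitLeaves E w) := by
  refine ⟨?_, ?_⟩
  · intro e he e' he' hs
    rw [mem_splitLeaves] at he he'
    rcases he with ⟨b, rfl⟩ | ⟨hne, he⟩ <;> rcases he' with ⟨b', rfl⟩ | ⟨hne', he'⟩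
    · exact hs.eq_of_length (by simp)
    · exact absurd (hE.eq_of_suffix _ hw _ he' ((List.suffix_cons _ _).trans hs)).symm hne'
    · rcases List.suffix_cons_iff.1 hs with h | h
      · exact h
      · exact absurd (hE.eq_of_suffix _ he _ hw h) hne
    · exact hE.eq_of_suffix _ he _ he' hs
  · intro e
    obtain ⟨e', he', h⟩ := hE.comparable e
    rcases eq_or_ne e' w with rfl | hne
    · by_cases h' : e <:+ e'
      · exact ⟨false :: e', mem_splitLeaves.2 (Or.inl ⟨_, rfl⟩),
          Or.inl (h'.trans (List.suffix_cons _ _))⟩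
      · have h'' := h.resolve_left h'
        obtain ⟨b, hb⟩ := exists_cons_suffix h'' (by rintro rfl; exact h' List.suffix_rfl)
        exact ⟨b :: e', mem_splitLeaves.2 (Or.inl ⟨_, rfl⟩), Or.inr hb⟩
    · exact ⟨e', mem_splitLeaves.2 (Or.inr ⟨hne, he'⟩), h⟩

theorem IsLeafSet.card_split {E : Finset Word} (hE : IsLeafSet E) {w : Word} (hw : w ∈ E) :
    (splitLeaves E w).card = E.card + 1 := by
  rw [splitLeaves, Finset.card_insert_of_notMem, Finset.card_insert_of_notMem,
    Finset.card_erase_add_one hw]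
  · simp [hE.cons_notMem hw]
  · simp [hE.cons_notMem hw]

/-! ### Streams of independent variables -/

/-- The stream with first term `a` and remaining terms `x`. -/
def scons {α : Type*} (a : α) (x : ℕ → α) : ℕ → α
  | 0 => a
  | k + 1 => x k

theorem measurable_scons {α : Type*} [MeasurableSpace α] :
    Measurable fun p : α × (ℕ → α) => scons p.1 p.2 := by
  refine measurable_pi_lambda _ fun k => ?_
  cases k with
  | zero => exact measurable_fst
  | succ k => exact (measurable_pi_apply k).comp measurable_snd

theorem measurable_update_prod {ι α : Type*} [DecidableEq ι] [MeasurableSpace α] (i : ι) :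
    Measurable fun p : α × (ι → α) => Function.update p.2 i p.1 := by
  refine measurable_pi_lambda _ fun j => ?_
  by_cases h : j = i
  · subst h; simpa using measurable_fst
  · simp only [Function.update_of_ne h]; fun_prop

/-- Replacing one coordinate of an independent family by an independent copy. -/
theorem map_update_infinitePi {ι α : Type*} [DecidableEq ι] [MeasurableSpace α] (ρ : Measure α)
    [IsProbabilityMeasure ρ] (i : ι) :
    (ρ.prod (Measure.infinitePi fun _ : ι => ρ)).map (fun p => Function.update p.2 i p.1) =
      Measure.infinitePi fun _ : ι => ρ := by
  have hm := measurable_update_prod (α := α) i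
  refine Measure.eq_infinitePi _ fun s t ht => ?_
  rw [Measure.map_apply hm (MeasurableSet.pi s.countable_toSet fun i _ => ht i)]
  have hpre : (fun p : α × (ι → α) => Function.update p.2 i p.1) ⁻¹' (Set.pi s t) =
      (if i ∈ s then t i else Set.univ) ×ˢ Set.pi (s.erase i : Finset ι) t := by
    ext ⟨a, x⟩
    simp only [Set.mem_preimage, Set.mem_pi, Finset.mem_coe, Set.mem_prod, Finset.mem_erase]
    constructor
    · intro h
      refine ⟨?_, fun j hj => by simpa [hj.1] using h j hj.2⟩
      split_ifs with hi
      · simpa using h i hi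
      · trivial
    · rintro ⟨h1, h2⟩ j hj
      by_cases hji : j = i
      · subst hji; simpa [hj] using h1
      · simpa [hji] using h2 j ⟨hji, hj⟩
  rw [hpre, Measure.prod_prod, Measure.infinitePi_pi _ fun i _ => ht i]
  split_ifs with hi
  · exact Finset.mul_prod_erase s (fun i => ρ (t i)) hi
  · rw [measure_univ, one_mul, Finset.erase_eq_of_notMem hi]

/-- One member of an independent family can be integrated separately. -/
theorem lintegral_infinitePi_update {ι α : Type*} [DecidableEq ι] [MeasurableSpace α]
    (ρ : Measure α) [IsProbabilityMeasure ρ] (i : ι) {f : (ι → α) → ℝ≥0∞} (hf : Measurable f) :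
    ∫⁻ x, f x ∂(Measure.infinitePi fun _ : ι => ρ) =
      ∫⁻ a, ∫⁻ x, f (Function.update x i a) ∂(Measure.infinitePi fun _ : ι => ρ) ∂ρ := by
  conv_lhs => rw [← map_update_infinitePi ρ i]
  rw [lintegral_map hf (measurable_update_prod i),
    lintegral_prod (fun p : α × (ι → α) => f (Function.update p.2 i p.1))
      (hf.comp (measurable_update_prod i)).aemeasurable]

/-- The first term of an i.i.d. sequence can be integrated separately. -/
theorem lintegral_stream {α : Type*} [MeasurableSpace α] (ρ : Measure α) [IsProbabilityMeasure ρ]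
    {f : (ℕ → α) → ℝ≥0∞} (hf : Measurable f) :
    ∫⁻ x, f x ∂(Measure.infinitePi fun _ : ℕ => ρ) =
      ∫⁻ a, ∫⁻ x, f (scons a x) ∂(Measure.infinitePi fun _ : ℕ => ρ) ∂ρ := by
  rw [lintegral_infinitePi_update ρ 0 hf]
  refine lintegral_congr fun a => ?_
  have h := Measure.map_infinitePi_infinitePi_of_inj (P := fun _ : ℕ => ρ) Nat.succ_injective
  conv_rhs => rw [← h]
  rw [lintegral_map (f := fun x => f (scons a x))
    (hf.comp (measurable_scons.comp measurable_prodMk_left)) (by fun_prop)]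
  refine lintegral_congr fun x => ?_
  congr 1
  funext k
  cases k <;> simp [scons]

/-! ### Rejection sampling -/

/-- The index of the first term of a stream in `A` (zero if there is none). -/
noncomputable def firstHit {α : Type*} (A : Set α) (G : ℕ → α) : ℕ := sInf {n | G n ∈ A}

/-- The first term of a stream that belongs to `A` (the first of all terms if there is none). -/
noncomputable def hitValue {α : Type*} (A : Set α) (G : ℕ → α) : α := G (firstHit A G)

/-- The terms of a stream after the first one that belongs to `A`. -/
noncomputable def hitTail {α : Type*} (A : Set α) (G : ℕ → α) : ℕ → α :=
  fun k => G (firstHit A G + 1 + k)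

theorem exists_of_hitValue_mem {α : Type*} {A : Set α} {G : ℕ → α} (h : hitValue A G ∈ A) :
    ∃ n, G n ∈ A := ⟨_, h⟩

theorem firstHit_scons_of_mem {α : Type*} {A : Set α} {a : α} (x : ℕ → α) (h : a ∈ A) :
    firstHit A (scons a x) = 0 := by
  have : (0 : ℕ) ∈ {n | scons a x n ∈ A} := h
  exact Nat.sInf_eq_zero.2 (Or.inl this)

theorem firstHit_scons_of_notMem {α : Type*} {A : Set α} {a : α} {x : ℕ → α} (h : a ∉ A)
    (hx : ∃ n, x n ∈ A) : firstHit A (scons a x) = firstHit A x + 1 := by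
  classical
  have hx' : ∃ n, scons a x n ∈ A := by
    obtain ⟨n, hn⟩ := hx
    exact ⟨n + 1, hn⟩
  have e1 : firstHit A (scons a x) = Nat.find hx' := Nat.sInf_def hx'
  have e2 : firstHit A x = Nat.find hx := Nat.sInf_def hx
  rw [e1, e2]
  exact Nat.find_comp_succ hx' hx h

theorem measurable_sInf_nat {α : Type*} [MeasurableSpace α] {p : α → ℕ → Prop}
    (hp : ∀ n, MeasurableSet {a | p a n}) : Measurable fun a => sInf {n | p a n} := by
  classical
  have hq : ∀ a, ∃ n, p a n ∨ ∀ m, ¬ p a m := by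
    intro a
    by_cases h : ∃ n, p a n
    · exact h.imp fun n hn => Or.inl hn
    · exact ⟨0, Or.inr (not_exists.1 h)⟩
  have hm : Measurable fun a => Nat.find (hq a) := by
    refine measurable_find hq fun n => (hp n).union ?_
    have : MeasurableSet (⋂ m, {a | p a m}ᶜ) := MeasurableSet.iInter fun m => (hp m).compl
    have e : {a | ∀ m, ¬ p a m} = ⋂ m, {a | p a m}ᶜ := by
      ext a
      simp
    change MeasurableSet {a | ∀ m, ¬ p a m}
    rw [e]
    exact this
  convert hm using 2 with a
  by_cases h : ∃ n, p a n
  · rw [Nat.sInf_def (show {n | p a n}.Nonempty from h)]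
    refine Nat.find_congr' fun {n} => ?_
    exact ⟨Or.inl, fun h' => h'.resolve_right (fun h0 => h.elim fun n hn => h0 n hn)⟩
  · have h0 : Nat.find (hq a) = 0 := (Nat.find_eq_zero _).2 (Or.inr (not_exists.1 h))
    rw [h0]
    refine Nat.sInf_eq_zero.2 (Or.inr ?_)
    ext n
    simpa using not_exists.1 h n

theorem measurable_hitValue {α β : Type*} [MeasurableSpace α] [MeasurableSpace β]
    {A : β → Set α} (hA : MeasurableSet {p : β × α | p.2 ∈ A p.1}) {f : β → ℕ → α}
    (hf : Measurable f) : Measurable fun p : β => hitValue (A p) (f p) := by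
  have h1 : Measurable fun p : β => firstHit (A p) (f p) :=
    measurable_sInf_nat fun n => hA.preimage
      (f := fun p : β => (p, f p n)) (by fun_prop)
  have h2 : Measurable fun q : (ℕ → α) × ℕ => q.1 q.2 :=
    measurable_from_prod_countable_left fun n => measurable_pi_apply n
  exact h2.comp (hf.prodMk h1)

theorem measurable_hitTail {α β : Type*} [MeasurableSpace α] [MeasurableSpace β]
    {A : β → Set α} (hA : MeasurableSet {p : β × α | p.2 ∈ A p.1}) {f : β → ℕ → α}
    (hf : Measurable f) : Measurable fun p : β => hitTail (A p) (f p) := by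
  have h1 : Measurable fun p : β => firstHit (A p) (f p) :=
    measurable_sInf_nat fun n => hA.preimage
      (f := fun p : β => (p, f p n)) (by fun_prop)
  have h2 : ∀ k, Measurable fun q : (ℕ → α) × ℕ => q.1 (q.2 + 1 + k) := fun k =>
    measurable_from_prod_countable_left fun n => measurable_pi_apply (n + 1 + k)
  exact measurable_pi_lambda _ fun k => (h2 k).comp (hf.prodMk h1)

/-- A set of positive probability is hit almost surely: the probability `p` to miss it
satisfies `p = ρ(Aᶜ) p`. -/
theorem ae_exists_mem {α : Type*} [MeasurableSpace α] (ρ : Measure α) [IsProbabilityMeasure ρ]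
    {A : Set α} (hA : MeasurableSet A) (h0 : ρ A ≠ 0) :
    ∀ᵐ G ∂(Measure.infinitePi fun _ : ℕ => ρ), ∃ n, G n ∈ A := by
  set P := Measure.infinitePi fun _ : ℕ => ρ
  have hN : MeasurableSet {G : ℕ → α | ∀ n, G n ∉ A} := by
    have : MeasurableSet (⋂ n, {G : ℕ → α | G n ∈ A}ᶜ) :=
      MeasurableSet.iInter fun n => ((measurable_pi_apply n) hA).compl
    convert this using 1
    ext G; simp
  have key : P {G | ∀ n, G n ∉ A} = ρ Aᶜ * P {G | ∀ n, G n ∉ A} := by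
    conv_lhs => rw [← lintegral_indicator_one hN,
      lintegral_stream ρ (measurable_one.indicator hN)]
    rw [← lintegral_indicator_one hA.compl, ← lintegral_mul_const _
      (measurable_one.indicator hA.compl)]
    refine lintegral_congr fun a => ?_
    rw [← lintegral_indicator_one hN, ← lintegral_const_mul _ (measurable_one.indicator hN)]
    refine lintegral_congr fun x => ?_
    by_cases ha : a ∈ A
    · have : scons a x ∉ {G | ∀ n, G n ∉ A} := fun h => h 0 ha
      simp [Set.indicator_of_notMem this, ha]
    · have : scons a x ∈ {G : ℕ → α | ∀ n, G n ∉ A} ↔ x ∈ {G : ℕ → α | ∀ n, G n ∉ A} := by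
        constructor
        · intro h n; exact h (n + 1)
        · intro h n
          cases n with
          | zero => exact ha
          | succ n => exact h n
      by_cases hx : x ∈ {G : ℕ → α | ∀ n, G n ∉ A}
      · simp [Set.indicator_of_mem hx, Set.indicator_of_mem (this.2 hx), ha]
      · simp [Set.indicator_of_notMem hx, Set.indicator_of_notMem (mt this.1 hx)]
  have hz : P {G | ∀ n, G n ∉ A} = 0 := by
    by_contra hne
    have h1 : ρ Aᶜ = 1 := by
      have := (ENNReal.mul_left_inj hne (measure_ne_top P _)).1 (key.symm.trans (one_mul _).symm)
      exact this
    rw [prob_compl_eq_one_iff hA] at h1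
    exact h0 h1
  rw [ae_iff]
  simpa using hz

/-- The first term in `A` has the conditional law and is independent of the terms after it, which
are again independent and identically distributed. -/
theorem map_hitValue_hitTail {α : Type*} [MeasurableSpace α] (ρ : Measure α)
    [IsProbabilityMeasure ρ] {A : Set α} (hA : MeasurableSet A) (h0 : ρ A ≠ 0) :
    (Measure.infinitePi fun _ : ℕ => ρ).map (fun G => (hitValue A G, hitTail A G)) =
      (cond ρ A).prod (Measure.infinitePi fun _ : ℕ => ρ) := by
  set P := Measure.infinitePi fun _ : ℕ => ρ with hP
  have hA' : MeasurableSet {p : (ℕ → α) × α | p.2 ∈ A} := measurable_snd hA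
  have hm : Measurable fun G : ℕ → α => (hitValue A G, hitTail A G) :=
    (measurable_hitValue (A := fun _ => A) hA' measurable_id).prodMk
      (measurable_hitTail (A := fun _ => A) hA' measurable_id)
  ext B hB
  -- the probability `L` of the event satisfies `L = ∫_A … + ρ(Aᶜ) L`
  set f : (ℕ → α) → ℝ≥0∞ := fun G => B.indicator 1 (hitValue A G, hitTail A G) with hf
  have hfm : Measurable f := (measurable_one.indicator hB).comp hm
  have hL : P.map (fun G => (hitValue A G, hitTail A G)) B = ∫⁻ G, f G ∂P := by
    rw [← lintegral_indicator_one hB, lintegral_map (measurable_one.indicator hB) hm]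
  have hLtop : ∫⁻ G, f G ∂P ≠ ⊤ := by
    rw [← hL]
    have := Measure.isProbabilityMeasure_map (μ := P) hm.aemeasurable
    exact measure_ne_top _ _
  have step : ∫⁻ G, f G ∂P =
      (∫⁻ a in A, ∫⁻ x, B.indicator 1 (a, x) ∂P ∂ρ) + ρ Aᶜ * ∫⁻ G, f G ∂P := by
    conv_lhs => rw [lintegral_stream ρ hfm, ← lintegral_add_compl _ hA]
    congr 1
    · refine setLIntegral_congr_fun hA fun a ha => ?_
      refine lintegral_congr fun x => ?_
      have e := firstHit_scons_of_mem x ha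
      simp only [hf, hitValue, e]
      congr 2
      funext k
      rw [hitTail, e, show 0 + 1 + k = k + 1 by omega]
      rfl
    · rw [mul_comm, ← setLIntegral_const]
      refine setLIntegral_congr_fun hA.compl fun a ha => ?_
      refine lintegral_congr_ae ?_
      filter_upwards [ae_exists_mem ρ hA h0] with x hx
      have e := firstHit_scons_of_notMem ha hx
      simp only [hf, hitValue, e]
      congr 2
      funext k
      rw [hitTail, e, show firstHit A x + 1 + 1 + k = (firstHit A x + 1 + k) + 1 by omega]
      rfl
  have hAtop : ρ A ≠ ⊤ := measure_ne_top _ _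
  have e1 : ρ A * ∫⁻ G, f G ∂P = ∫⁻ a in A, ∫⁻ x, B.indicator 1 (a, x) ∂P ∂ρ := by
    have h1 : ρ A * (∫⁻ G, f G ∂P) + ρ Aᶜ * (∫⁻ G, f G ∂P) = ∫⁻ G, f G ∂P := by
      rw [← add_mul, prob_add_prob_compl hA, one_mul]
    exact (ENNReal.add_left_inj (ENNReal.mul_ne_top (measure_ne_top _ _) hLtop)).1
      (h1.trans step)
  rw [hL, ← lintegral_indicator_one hB, lintegral_prod _ (measurable_one.indicator hB).aemeasurable,
    ProbabilityTheory.cond, lintegral_smul_measure, ← e1, smul_eq_mul, ← mul_assoc,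
    ENNReal.inv_mul_cancel h0 hAtop, one_mul]

/-- Rejection sampling restarts the stream: a function of the first term in `A` and of the terms
after it is integrated as if these were independent. -/
theorem lintegral_hit {α : Type*} [MeasurableSpace α] (ρ : Measure α)
    [IsProbabilityMeasure ρ] {A : Set α} (hA : MeasurableSet A) (h0 : ρ A ≠ 0)
    {f : α × (ℕ → α) → ℝ≥0∞} (hf : Measurable f) :
    ∫⁻ G, f (hitValue A G, hitTail A G) ∂(Measure.infinitePi fun _ : ℕ => ρ) =
      ∫⁻ a, ∫⁻ x, f (a, x) ∂(Measure.infinitePi fun _ : ℕ => ρ) ∂(cond ρ A) := by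
  have hA' : MeasurableSet {p : (ℕ → α) × α | p.2 ∈ A} := measurable_snd hA
  have hm : Measurable fun G : ℕ → α => (hitValue A G, hitTail A G) :=
    (measurable_hitValue (A := fun _ => A) hA' measurable_id).prodMk
      (measurable_hitTail (A := fun _ => A) hA' measurable_id)
  rw [← lintegral_prod _ hf.aemeasurable, ← map_hitValue_hitTail ρ hA h0, lintegral_map hf hm]

theorem lintegral_hitValue {α : Type*} [MeasurableSpace α] (ρ : Measure α)
    [IsProbabilityMeasure ρ] {A : Set α} (hA : MeasurableSet A) (h0 : ρ A ≠ 0)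
    {f : α → ℝ≥0∞} (hf : Measurable f) :
    ∫⁻ G, f (hitValue A G) ∂(Measure.infinitePi fun _ : ℕ => ρ) = ∫⁻ a, f a ∂(cond ρ A) := by
  rw [lintegral_hit ρ hA h0 (f := fun p => f p.1) (hf.comp measurable_fst)]
  simp

/-! ### Recursions driven by a random supply -/

/-- A recursion with a state in `S` and a supply of randomness in `D`: each step emits an output
and leaves a new supply. -/
structure Driver (S O D : Type*) where
  /-- The output of a step. -/
  out : S → D → O
  /-- The supply that is left after a step. -/
  nxt : S → D → D

/-- The states that belong to a sequence of outputs, when a state `s` and an output `o` give the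
state `upd s o`. -/
def stateAt {S O : Type*} (upd : S → O → S) (s : S) (x : ℕ → O) : ℕ → S
  | 0 => s
  | n + 1 => upd (stateAt upd s x n) (x n)

/-- One step of the recursion. -/
def Driver.step {S O D : Type*} (A : Driver S O D) (upd : S → O → S) (p : S × D) : S × D :=
  (upd p.1 (A.out p.1 p.2), A.nxt p.1 p.2)

/-- The sequence of outputs. -/
def Driver.outputs {S O D : Type*} (A : Driver S O D) (upd : S → O → S) (s : S) (d : D) : ℕ → O :=
  fun n => A.out ((A.step upd)^[n] (s, d)).1 ((A.step upd)^[n] (s, d)).2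

/-- The supply after `n` steps. -/
def Driver.supply {S O D : Type*} (A : Driver S O D) (upd : S → O → S) (s : S) (d : D)
    (n : ℕ) : D :=
  ((A.step upd)^[n] (s, d)).2

section
variable {S O D : Type*} (A : Driver S O D) (upd : S → O → S)

theorem Driver.iterate_fst (s : S) (d : D) (n : ℕ) :
    ((A.step upd)^[n] (s, d)).1 = stateAt upd s (A.outputs upd s d) n := by
  induction n with
  | zero => rfl
  | succ n ih =>
    rw [Function.iterate_succ_apply', stateAt, ← ih]
    rfl

theorem Driver.outputs_eq (s : S) (d : D) (n : ℕ) :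
    A.outputs upd s d n = A.out (stateAt upd s (A.outputs upd s d) n) (A.supply upd s d n) := by
  rw [← A.iterate_fst upd]
  rfl

theorem Driver.supply_succ (s : S) (d : D) (n : ℕ) :
    A.supply upd s d (n + 1) =
      A.nxt (stateAt upd s (A.outputs upd s d) n) (A.supply upd s d n) := by
  rw [Driver.supply, Function.iterate_succ_apply', ← A.iterate_fst upd]
  rfl

theorem Driver.outputs_succ (s : S) (d : D) (n : ℕ) :
    A.outputs upd s d (n + 1) = A.outputs upd (upd s (A.out s d)) (A.nxt s d) n := rfl

theorem stateAt_succ' (s : S) (x : ℕ → O) (n : ℕ) :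
    stateAt upd s x (n + 1) = stateAt upd (upd s (x 0)) (fun k => x (k + 1)) n := by
  induction n with
  | zero => rfl
  | succ n ih => rw [stateAt, ih]; rfl

variable [MeasurableSpace S] [MeasurableSpace O] [MeasurableSpace D]

theorem measurable_stateAt (hupd : Measurable fun p : S × O => upd p.1 p.2) (n : ℕ) :
    Measurable fun p : S × (ℕ → O) => stateAt upd p.1 p.2 n := by
  induction n with
  | zero => exact measurable_fst
  | succ n ih =>
    exact hupd.comp (ih.prodMk ((measurable_pi_apply n).comp measurable_snd))

/-- The supply `m` drives the recursion with the transition law `K`: from a good state `s`, the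
output has the law `K s` and the supply that is left is independent of it and again has the law
`m`. The last statement is only required for what the recursion can still use of the supply:
`R s d d'` says that `d` and `d'` cannot be distinguished from the state `s` on.

The predicates `pre` and `ok` hold for all supplies and are needed to make sense of `R`. The
predicates `good` and `valid` are the ones under which the law is as stated; from a good state the
output is valid almost surely, and then the new state is good. -/
structure Driver.IsDriven (A : Driver S O D) (upd : S → O → S) (m : Measure D)
    (K : S → Measure O) (pre good : S → Prop) (ok valid : S → O → Prop)
    (R : S → D → D → Prop) : Prop where
  measurable_out : Measurable fun p : S × D => A.out p.1 p.2
  measurable_nxt : Measurable fun p : S × D => A.nxt p.1 p.2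
  pre_of_good : ∀ s, good s → pre s
  pre_upd : ∀ s o, pre s → ok s o → pre (upd s o)
  ok_out : ∀ s d, pre s → ok s (A.out s d)
  out_congr : ∀ s d d', pre s → R s d d' → A.out s d = A.out s d'
  nxt_congr : ∀ s d d', pre s → R s d d' → R (upd s (A.out s d)) (A.nxt s d) (A.nxt s d')
  law : ∀ s, good s → ∀ F : O → D → ℝ≥0∞, Measurable (fun p : O × D => F p.1 p.2) →
    (∀ o d d', ok s o → R (upd s o) d d' → F o d = F o d') →
    ∫⁻ d, F (A.out s d) (A.nxt s d) ∂m = ∫⁻ o, ∫⁻ d, F o d ∂m ∂(K s)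
  good_upd : ∀ s o, good s → valid s o → good (upd s o)
  ae_valid : ∀ s, good s → ∀ᵐ o ∂(K s), valid s o

variable {A upd} {m : Measure D} {K : S → Measure O} {pre good : S → Prop}
  {ok valid : S → O → Prop} {R : S → D → D → Prop}

theorem Driver.IsDriven.outputs_congr (h : A.IsDriven upd m K pre good ok valid R) (n : ℕ) :
    ∀ s d d', pre s → R s d d' → A.outputs upd s d n = A.outputs upd s d' n := by
  induction n with
  | zero => exact fun s d d' hs hR => h.out_congr s d d' hs hR
  | succ n ih =>
    intro s d d' hs hR
    rw [A.outputs_succ, A.outputs_succ, ← h.out_congr s d d' hs hR]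
    exact ih _ _ _ (h.pre_upd _ _ hs (h.ok_out s d hs)) (h.nxt_congr s d d' hs hR)

theorem Driver.IsDriven.measurable_outputs (h : A.IsDriven upd m K pre good ok valid R)
    (hupd : Measurable fun p : S × O => upd p.1 p.2) :
    Measurable fun p : S × D => A.outputs upd p.1 p.2 := by
  have hstep : Measurable (A.step upd) :=
    (hupd.comp (measurable_fst.prodMk h.measurable_out)).prodMk h.measurable_nxt
  refine measurable_pi_lambda _ fun n => h.measurable_out.comp ?_
  exact hstep.iterate n

theorem Driver.IsDriven.measurable_outputs_right (h : A.IsDriven upd m K pre good ok valid R)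
    (hupd : Measurable fun p : S × O => upd p.1 p.2) (s : S) : Measurable (A.outputs upd s) :=
  (h.measurable_outputs hupd).comp measurable_prodMk_left

/-- The expectation of a function of the first `n` outputs, by iteration of the transition law. -/
noncomputable def iterLaw (upd : S → O → S) (K : S → Measure O) :
    (n : ℕ) → ((Fin n → O) → ℝ≥0∞) → S → ℝ≥0∞
  | 0, f, _ => f Fin.elim0
  | n + 1, f, s => ∫⁻ o, iterLaw upd K n (fun x => f (Fin.cons o x)) (upd s o) ∂(K s)

theorem measurable_fin_cons (n : ℕ) :
    Measurable fun p : O × (Fin n → O) => (Fin.cons p.1 p.2 : Fin (n + 1) → O) := by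
  refine measurable_pi_lambda _ fun k => ?_
  refine Fin.cases ?_ (fun k => ?_) k
  · exact measurable_fst
  · exact (measurable_pi_apply k).comp measurable_snd

/-- The law of the outputs is determined by the transition law `K` alone. -/
theorem Driver.IsDriven.lintegral_outputs (h : A.IsDriven upd m K pre good ok valid R)
    [IsProbabilityMeasure m]
    (hupd : Measurable fun p : S × O => upd p.1 p.2) (n : ℕ) :
    ∀ (s : S), good s → ∀ f : (Fin n → O) → ℝ≥0∞, Measurable f →
      ∫⁻ d, f (fun k => A.outputs upd s d k) ∂m = iterLaw upd K n f s := by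
  induction n with
  | zero =>
    intro s _ f _
    simp only [iterLaw]
    have : ∀ d, (fun k : Fin 0 => A.outputs upd s d k) = Fin.elim0 := fun d => Subsingleton.elim _ _
    simp [this]
  | succ n ih =>
    intro s hs f hf
    have hout := h.measurable_outputs hupd
    have hF : Measurable fun p : O × D =>
        f (Fin.cons p.1 (fun k : Fin n => A.outputs upd (upd s p.1) p.2 k)) := by
      refine hf.comp ((measurable_fin_cons n).comp (measurable_fst.prodMk ?_))
      have h1 : Measurable fun p : O × D => A.outputs upd (upd s p.1) p.2 :=
        hout.comp ((hupd.comp (measurable_const.prodMk measurable_fst)).prodMk measurable_snd)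
      exact measurable_pi_lambda _ fun k => (measurable_pi_apply (k : ℕ)).comp h1
    have hlaw := h.law s hs
      (fun o d => f (Fin.cons o (fun k : Fin n => A.outputs upd (upd s o) d k))) hF ?_
    · have e : ∀ d, f (fun k : Fin (n + 1) => A.outputs upd s d k) =
          f (Fin.cons (A.out s d)
            (fun k : Fin n => A.outputs upd (upd s (A.out s d)) (A.nxt s d) k)) := by
        intro d
        congr 1
        funext k
        refine Fin.cases ?_ (fun k => ?_) k
        · rfl
        · rfl
      simp only [e]
      rw [hlaw, iterLaw]
      refine lintegral_congr_ae ?_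
      filter_upwards [h.ae_valid s hs] with o ho
      exact ih _ (h.good_upd s o hs ho) _ (hf.comp ((measurable_fin_cons n).comp
        measurable_prodMk_left))
    · intro o d d' hok hR
      have : ∀ k, A.outputs upd (upd s o) d k = A.outputs upd (upd s o) d' k := fun k =>
        h.outputs_congr k _ _ _ (h.pre_upd _ _ (h.pre_of_good s hs) hok) hR
      simp only [this]

/-- Laws of sequences are determined by the laws of their initial segments. -/
theorem ext_of_initial_segments {μ μ' : Measure (ℕ → O)} [IsProbabilityMeasure μ]
    [IsProbabilityMeasure μ']
    (h : ∀ (n : ℕ) (B : Set (Fin n → O)), MeasurableSet B →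
      μ {x | (fun k : Fin n => x k) ∈ B} = μ' {x | (fun k : Fin n => x k) ∈ B}) : μ = μ' := by
  refine ext_of_generate_finite (measurableCylinders fun _ : ℕ => O)
    generateFrom_measurableCylinders.symm isPiSystem_measurableCylinders (fun s hs => ?_) (by simp)
  obtain ⟨I, B, hB, rfl⟩ := (mem_measurableCylinders _).mp hs
  obtain ⟨n, hn⟩ := I.exists_nat_subset_range
  have hm : Measurable fun x : Fin n → O => fun i : I => x ⟨i, Finset.mem_range.1 (hn i.2)⟩ :=
    measurable_pi_lambda _ fun i => measurable_pi_apply _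
  exact h n _ (hm hB)

/-- Two recursions with the same transition law have outputs with the same law. -/
theorem Driver.IsDriven.map_outputs_eq {D' : Type*} [MeasurableSpace D'] {A' : Driver S O D'}
    {m' : Measure D'} {pre' : S → Prop} {ok' : S → O → Prop} {R' : S → D' → D' → Prop}
    [IsProbabilityMeasure m] [IsProbabilityMeasure m']
    (hupd : Measurable fun p : S × O => upd p.1 p.2)
    (h : A.IsDriven upd m K pre good ok valid R)
    (h' : A'.IsDriven upd m' K pre' good ok' valid R') {s : S} (hs : good s) :
    m.map (A.outputs upd s) = m'.map (A'.outputs upd s) := by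
  have hm := h.measurable_outputs_right hupd s
  have hm' := h'.measurable_outputs_right hupd s
  have := Measure.isProbabilityMeasure_map (μ := m) hm.aemeasurable
  have := Measure.isProbabilityMeasure_map (μ := m') hm'.aemeasurable
  refine ext_of_initial_segments fun n B hB => ?_
  have hr : Measurable fun x : ℕ → O => fun k : Fin n => x k :=
    measurable_pi_lambda _ fun k => measurable_pi_apply _
  have e1 := h.lintegral_outputs hupd n s hs _ (measurable_one.indicator hB)
  have e2 := h'.lintegral_outputs hupd n s hs _ (measurable_one.indicator hB)
  rw [← e2] at e1
  have hBm : MeasurableSet {x : ℕ → O | (fun k : Fin n => x k) ∈ B} := hr hB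
  rw [← lintegral_indicator_one hBm, ← lintegral_indicator_one hBm,
    lintegral_map (measurable_one.indicator hBm) hm,
    lintegral_map (measurable_one.indicator hBm) hm']
  exact e1

/-- Almost surely all steps are valid. -/
theorem Driver.IsDriven.ae_valid_outputs (h : A.IsDriven upd m K pre good ok valid R)
    (hupd : Measurable fun p : S × O => upd p.1 p.2)
    (hvalid : MeasurableSet {p : S × O | valid p.1 p.2}) {s : S} (hs : good s) :
    ∀ᵐ d ∂m, ∀ n, valid (stateAt upd s (A.outputs upd s d) n) (A.outputs upd s d n) := by
  rw [ae_all_iff]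
  intro n
  have hout := h.measurable_outputs hupd
  set bad : ℕ → S → D → ℝ≥0∞ := fun n s d => {p : S × O | valid p.1 p.2}ᶜ.indicator 1
    (stateAt upd s (A.outputs upd s d) n, A.outputs upd s d n) with hbad
  have hm : ∀ n, Measurable fun p : S × D => bad n p.1 p.2 := by
    intro n
    refine (measurable_one.indicator hvalid.compl).comp ?_
    exact ((measurable_stateAt upd hupd n).comp (measurable_fst.prodMk hout)).prodMk
      ((measurable_pi_apply n).comp hout)
  have key : ∀ n s, good s → ∫⁻ d, bad n s d ∂m = 0 := by
    intro n
    induction n with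
    | zero =>
      intro s hs
      have hF : Measurable fun o : O => {p : S × O | valid p.1 p.2}ᶜ.indicator
          (1 : S × O → ℝ≥0∞) (s, o) :=
        (measurable_one.indicator hvalid.compl).comp measurable_prodMk_left
      have := h.law s hs (fun o _ => {p : S × O | valid p.1 p.2}ᶜ.indicator 1 (s, o))
        (hF.comp measurable_fst) (fun _ _ _ _ _ => rfl)
      refine Eq.trans this ?_
      rw [lintegral_eq_zero_iff' (by simpa using (hF.mul_const _).aemeasurable)]
      filter_upwards [h.ae_valid s hs] with o ho
      simp [ho]
    | succ n ih =>
      intro s hs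
      have hF : Measurable fun p : O × D => bad n (upd s p.1) p.2 :=
        (hm n).comp ((hupd.comp (measurable_const.prodMk measurable_fst)).prodMk measurable_snd)
      have hlaw := h.law s hs (fun o d => bad n (upd s o) d) hF ?_
      · have e : ∀ d, bad (n + 1) s d = bad n (upd s (A.out s d)) (A.nxt s d) := by
          intro d
          simp only [hbad, stateAt_succ']
          rfl
        simp only [e]
        rw [hlaw]
        refine lintegral_eq_zero_of_ae_eq_zero ?_
        filter_upwards [h.ae_valid s hs] with o ho
        exact ih _ (h.good_upd s o hs ho)
      · intro o d d' hok hR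
        have : A.outputs upd (upd s o) d = A.outputs upd (upd s o) d' := funext fun k =>
          h.outputs_congr k _ _ _ (h.pre_upd _ _ (h.pre_of_good s hs) hok) hR
        simp only [hbad, this]
  have h0 := key n s hs
  rw [lintegral_eq_zero_iff (f := bad n s) ((hm n).comp measurable_prodMk_left)] at h0
  filter_upwards [h0] with d hd
  by_contra hv
  simp [hbad, hv] at hd

end

/-! ### Exponential clocks -/

instance : IsProbabilityMeasure (expMeasure 1) := isProbabilityMeasure_expMeasure one_pos

theorem lintegral_expMeasure (f : ℝ → ℝ≥0∞) (hf : Measurable f) :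
    ∫⁻ x, f x ∂(expMeasure 1) =
      ∫⁻ x, (Set.Ici (0 : ℝ)).indicator (fun x => ENNReal.ofReal (Real.exp (-x)) * f x) x := by
  have hpdf : Measurable (gammaPDF 1 1) := (measurable_gammaPDFReal 1 1).ennreal_ofReal
  rw [expMeasure, gammaMeasure, lintegral_withDensity_eq_lintegral_mul _ hpdf hf]
  refine lintegral_congr fun x => ?_
  have h := exponentialPDF_eq 1 x
  rw [exponentialPDF, exponentialPDFReal] at h
  simp only [Pi.mul_apply, gammaPDF, h]
  by_cases hx : 0 ≤ x <;> simp [hx]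

theorem ae_nonneg_expMeasure : ∀ᵐ x ∂(expMeasure 1), 0 ≤ x := by
  have hm : Measurable ((Set.Iio (0 : ℝ)).indicator (1 : ℝ → ℝ≥0∞)) :=
    measurable_one.indicator measurableSet_Iio
  have h := lintegral_expMeasure _ hm
  rw [lintegral_indicator_one measurableSet_Iio] at h
  have h0 : (expMeasure 1) (Set.Iio 0) = 0 := by
    rw [h]
    refine (lintegral_congr fun x => ?_).trans lintegral_zero
    by_cases hx : 0 ≤ x <;> simp [hx]
  rw [ae_iff]
  simpa [Set.Iio] using h0

instance : NullSingletonClass (expMeasure 1) := by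
  rw [expMeasure, gammaMeasure]
  infer_instance

/-- The lack of memory of the exponential law. -/
theorem lintegral_expMeasure_memoryless {a : ℝ} (ha : 0 ≤ a) {f : ℝ → ℝ≥0∞} (hf : Measurable f) :
    ∫⁻ x, (Set.Ici a).indicator (fun x => f (x - a)) x ∂(expMeasure 1) =
      ENNReal.ofReal (Real.exp (-a)) * ∫⁻ x, f x ∂(expMeasure 1) := by
  have hm : Measurable ((Set.Ici a).indicator (fun x => f (x - a))) :=
    (hf.comp (measurable_id.sub_const a)).indicator measurableSet_Ici
  have hm' : Measurable ((Set.Ici (0 : ℝ)).indicator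
      (fun x => ENNReal.ofReal (Real.exp (-x)) * f x)) :=
    (Measurable.mul (by fun_prop) hf).indicator measurableSet_Ici
  rw [lintegral_expMeasure _ hm, lintegral_expMeasure _ hf, ← lintegral_const_mul _ hm',
    ← lintegral_add_right_eq_self _ a]
  refine lintegral_congr fun x => ?_
  by_cases hx : 0 ≤ x
  · have h1 : 0 ≤ x + a := by linarith
    have h2 : a ≤ x + a := by linarith
    simp only [Set.indicator, Set.mem_Ici, h1, h2, hx, if_true, add_sub_cancel_right]
    rw [← mul_assoc, ← ENNReal.ofReal_mul (Real.exp_pos _).le, ← Real.exp_add]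
    congr 3
    ring
  · have h2 : ¬ a ≤ x + a := by linarith
    simp [Set.indicator, hx]

/-- A change of scale of the exponential law: tilted by the probability that all other clocks ring
later, the law of one clock becomes, up to a factor, that of the first ring. -/
theorem lintegral_expMeasure_scale {k : ℝ} (hk : 0 < k) {f : ℝ → ℝ≥0∞} (hf : Measurable f) :
    ∫⁻ x, ENNReal.ofReal (Real.exp (-((k - 1) * x))) * f x ∂(expMeasure 1) =
      ENNReal.ofReal k⁻¹ * ∫⁻ x, f (k⁻¹ * x) ∂(expMeasure 1) := by
  have hf' : Measurable fun x => f (k⁻¹ * x) := hf.comp (measurable_const_mul k⁻¹)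
  have hm : Measurable fun x => (Set.Ici (0 : ℝ)).indicator
      (fun x => ENNReal.ofReal (Real.exp (-(k * x))) * f x) x :=
    (Measurable.mul (by fun_prop) hf).indicator measurableSet_Ici
  rw [lintegral_expMeasure (fun x => ENNReal.ofReal (Real.exp (-((k - 1) * x))) * f x)
    (Measurable.mul (by fun_prop) hf), lintegral_expMeasure _ hf']
  have h := Real.map_volume_mul_left (a := k⁻¹) (inv_ne_zero hk.ne')
  rw [inv_inv, abs_of_pos hk] at h
  have e1 : ∫⁻ x, (Set.Ici (0 : ℝ)).indicator
      (fun x => ENNReal.ofReal (Real.exp (-x)) * f (k⁻¹ * x)) x =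
      ∫⁻ x, (Set.Ici (0 : ℝ)).indicator
        (fun x => ENNReal.ofReal (Real.exp (-(k * x))) * f x) x ∂(volume.map (k⁻¹ * ·)) := by
    rw [lintegral_map hm (measurable_const_mul k⁻¹)]
    refine lintegral_congr fun x => ?_
    have hx : 0 ≤ k⁻¹ * x ↔ 0 ≤ x := by
      rw [mul_nonneg_iff_of_pos_left (inv_pos.2 hk)]
    simp only [Set.indicator, Set.mem_Ici, hx, mul_inv_cancel_left₀ hk.ne']
  rw [e1, h, lintegral_smul_measure, smul_eq_mul, ← mul_assoc,
    ← ENNReal.ofReal_mul (inv_nonneg.2 hk.le), inv_mul_cancel₀ hk.ne', ENNReal.ofReal_one, one_mul]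
  refine lintegral_congr fun x => ?_
  by_cases hx : 0 ≤ x
  · simp only [Set.indicator, Set.mem_Ici, hx, if_true]
    rw [← mul_assoc, ← ENNReal.ofReal_mul (Real.exp_pos _).le, ← Real.exp_add]
    congr 3
    ring
  · simp [Set.indicator, hx]

/-- The lack of memory for finitely many members of a family of independent exponential
variables. -/
theorem lintegral_infinitePi_memoryless {ι : Type*} [DecidableEq ι] (A : Finset ι)
    {a : ι → ℝ} (ha : ∀ i, 0 ≤ a i) {F : (ι → ℝ) → ℝ≥0∞} (hF : Measurable F) :
    ∫⁻ z, {z : ι → ℝ | ∀ i ∈ A, a i ≤ z i}.indicator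
        (fun z => F fun i => if i ∈ A then z i - a i else z i) z
        ∂(Measure.infinitePi fun _ : ι => expMeasure 1) =
      ENNReal.ofReal (Real.exp (-∑ i ∈ A, a i)) *
        ∫⁻ z, F z ∂(Measure.infinitePi fun _ : ι => expMeasure 1) := by
  induction A using Finset.induction_on generalizing F with
  | empty => simp
  | insert i A hi ih =>
    set P := Measure.infinitePi fun _ : ι => expMeasure 1
    set G : (ι → ℝ) → ℝ≥0∞ := fun z => {z : ι → ℝ | a i ≤ z i}.indicator
      (fun z => F (Function.update z i (z i - a i))) z with hG
    have hupd : Measurable fun z : ι → ℝ => Function.update z i (z i - a i) :=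
      (measurable_update_prod i).comp (f := fun z : ι → ℝ => (z i - a i, z))
        (by fun_prop)
    have hset : MeasurableSet {z : ι → ℝ | a i ≤ z i} :=
      measurableSet_le measurable_const (measurable_pi_apply i)
    have hGm : Measurable G := (hF.comp hupd).indicator hset
    have h1 : ∫⁻ z, {z : ι → ℝ | ∀ j ∈ insert i A, a j ≤ z j}.indicator
        (fun z => F fun j => if j ∈ insert i A then z j - a j else z j) z ∂P =
        ∫⁻ z, {z : ι → ℝ | ∀ j ∈ A, a j ≤ z j}.indicator
        (fun z => G fun j => if j ∈ A then z j - a j else z j) z ∂P := by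
      refine lintegral_congr fun z => ?_
      simp only [hG, Set.indicator, Set.mem_ofPred_eq, Finset.forall_mem_insert, if_neg hi]
      by_cases hA : ∀ j ∈ A, a j ≤ z j <;> by_cases hz : a i ≤ z i <;> simp only [hA, hz, if_true,
        if_false, true_and, false_and, and_false, ite_self]
      refine if_congr Iff.rfl (congrArg F (funext fun j => ?_)) rfl
      by_cases hj : j = i
      · subst hj; simp
      · simp [hj]
    have h2 : ∫⁻ z, G z ∂P = ENNReal.ofReal (Real.exp (-a i)) * ∫⁻ z, F z ∂P := by
      have hFi : Measurable fun y : ℝ => ∫⁻ z, F (Function.update z i y) ∂P :=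
        (hF.comp (measurable_update_prod i)).lintegral_prod_right'
      rw [lintegral_infinitePi_update _ i hGm, lintegral_infinitePi_update _ i hF,
        ← lintegral_expMeasure_memoryless (ha i) hFi]
      refine lintegral_congr fun y => ?_
      by_cases hy : a i ≤ y <;> simp [hG, Set.indicator, hy, P]
    rw [h1, ih hGm, h2, Finset.sum_insert hi, neg_add, Real.exp_add,
      ENNReal.ofReal_mul (Real.exp_pos _).le, ← mul_assoc,
      mul_comm (ENNReal.ofReal (Real.exp (-a i)))]

/-- Independent exponential clocks almost surely ring at different times. -/
theorem ae_clocks_ne {ι : Type*} [DecidableEq ι] [Countable ι] {c : ι → ℝ} {A : Finset ι}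
    (hc : ∀ i ∈ A, c i ≠ 0) : ∀ᵐ z ∂(Measure.infinitePi fun _ : ι => expMeasure 1),
      ∀ i ∈ A, ∀ j ∈ A, i ≠ j → c i * z i ≠ c j * z j := by
  simp only [ae_all_iff]
  intro i hi j hj hij
  have hm : MeasurableSet {z : ι → ℝ | c i * z i = c j * z j} :=
    measurableSet_eq_fun (by fun_prop) (by fun_prop)
  rw [ae_iff]
  simp only [ne_eq, not_not]
  rw [← lintegral_indicator_one hm, lintegral_infinitePi_update _ i
    (measurable_one.indicator hm), lintegral_lintegral_swap]
  · refine (lintegral_congr fun z => ?_).trans lintegral_zero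
    have : ∀ y, {z : ι → ℝ | c i * z i = c j * z j}.indicator (1 : (ι → ℝ) → ℝ≥0∞)
        (Function.update z i y) = ({(c i)⁻¹ * (c j * z j)} : Set ℝ).indicator 1 y := by
      intro y
      have hiff : c i * y = c j * z j ↔ y = (c i)⁻¹ * (c j * z j) := by
        rw [eq_inv_mul_iff_mul_eq₀ (hc i hi)]
      simp [Set.indicator, Function.update_of_ne hij.symm, hiff]
    simp only [this]
    rw [lintegral_indicator_one (measurableSet_singleton _), measure_singleton]
  · exact ((measurable_one.indicator hm).comp (measurable_update_prod i)).aemeasurable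

/-! ### Trees of divisions -/

instance : MeasurableSpace Word := ⊤

instance : DiscreteMeasurableSpace Word := ⟨fun _ => trivial⟩

/-- A set of leaves together with the hyperplanes that divide the cells of the other words. -/
abbrev Tree (ℓ : ℕ) : Type := Finset Word × (Word → Hyperplane ℓ)

/-- A division: the word of the divided cell, the time since the last division, and the dividing
hyperplane. -/
abbrev Division (ℓ : ℕ) : Type := Word × ℝ × Hyperplane ℓ

/-- The tree after a division. -/
def divide {ℓ : ℕ} (s : Tree ℓ) (o : Division ℓ) : Tree ℓ :=
  (splitLeaves s.1 o.1, Function.update s.2 o.1 o.2.2)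

/-- The rate at which the cell of the word `e` is divided. -/
noncomputable def rate {ℓ : ℕ} (Λ : Measure (Hyperplane ℓ)) (W : Set (Space ℓ)) (s : Tree ℓ)
    (e : Word) : ℝ :=
  mass Λ (cell W s.2 e)

/-- The rate of the divisions in the tree. -/
noncomputable def totalRate {ℓ : ℕ} (Λ : Measure (Hyperplane ℓ)) (W : Set (Space ℓ))
    (s : Tree ℓ) : ℝ :=
  ∑ e ∈ s.1, rate Λ W s e

/-- The words at the ends of the tree form a set of leaves, and their cells have nonempty
interior. -/
structure IsGoodTree {ℓ : ℕ} (W : Set (Space ℓ)) (s : Tree ℓ) : Prop where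
  isLeafSet : IsLeafSet s.1
  interior_nonempty : ∀ e ∈ s.1, (interior (cell W s.2 e)).Nonempty

/-- A hyperplane that hits the cell of a leaf divides it into two cells with nonempty interior. -/
structure IsValidDivision {ℓ : ℕ} (W : Set (Space ℓ)) (s : Tree ℓ) (o : Division ℓ) : Prop where
  mem : o.1 ∈ s.1
  nonneg : 0 ≤ o.2.1
  hits : o.2.2 ∈ hit (cell W s.2 o.1)
  interior_nonempty : ∀ b, (interior (cell W s.2 o.1 ∩ halfSpace o.2.2 b)).Nonempty

theorem cell_update_self {ℓ : ℕ} (W : Set (Space ℓ)) (H : Word → Hyperplane ℓ) (w : Word)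
    (h : Hyperplane ℓ) : cell W (Function.update H w h) w = cell W H w :=
  cell_congr_suffix W fun _ _ hne => Function.update_of_ne hne _ _

theorem cell_update_cons {ℓ : ℕ} (W : Set (Space ℓ)) (H : Word → Hyperplane ℓ) (w : Word)
    (h : Hyperplane ℓ) (b : Bool) :
    cell W (Function.update H w h) (b :: w) = cell W H w ∩ halfSpace h b := by
  rw [cell, cell_update_self, Function.update_self]

theorem IsLeafSet.cell_update {ℓ : ℕ} {E : Finset Word} (hE : IsLeafSet E) (W : Set (Space ℓ))
    (H : Word → Hyperplane ℓ) {w e : Word} (hw : w ∈ E) (he : e ∈ E)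
    (h : Hyperplane ℓ) : cell W (Function.update H w h) e = cell W H e := by
  refine cell_congr_suffix W fun e' he' hne => Function.update_of_ne ?_ _ _
  rintro rfl
  exact hne (hE.eq_of_suffix _ hw _ he he')

theorem IsGoodTree.divide {ℓ : ℕ} {W : Set (Space ℓ)} {s : Tree ℓ} {o : Division ℓ}
    (hs : IsGoodTree W s) (ho : IsValidDivision W s o) : IsGoodTree W (divide s o) := by
  refine ⟨hs.isLeafSet.split ho.mem, fun e he => ?_⟩
  rcases mem_splitLeaves.1 he with ⟨b, rfl⟩ | ⟨hne, he⟩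
  · rw [STIT.divide, cell_update_cons]
    exact ho.interior_nonempty b
  · rw [STIT.divide, hs.isLeafSet.cell_update W s.2 ho.mem he]
    exact hs.interior_nonempty e he

theorem isGoodTree_root {ℓ : ℕ} {W : Set (Space ℓ)} (hW : IsCell W) (H : Word → Hyperplane ℓ) :
    IsGoodTree W ({[]}, H) :=
  ⟨IsLeafSet.singleton_nil, by simpa [cell] using hW.2⟩

theorem mass_pos {ℓ : ℕ} {Λ : Measure (Hyperplane ℓ)} (hΛ : IsHyperplaneMeasure Λ)
    {C : Set (Space ℓ)} (hC : Bornology.IsBounded C) (hint : (interior C).Nonempty) :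
    0 < mass Λ C :=
  ENNReal.toReal_pos (hΛ.hit_ne_zero hint) (hΛ.hit_lt_top hC).ne

theorem isBounded_cell {ℓ : ℕ} {W : Set (Space ℓ)} (hW : IsCell W) (H : Word → Hyperplane ℓ)
    (e : Word) : Bornology.IsBounded (cell W H e) :=
  hW.isCompact.isBounded.subset (cell_subset W H e)

theorem isCompact_cell {ℓ : ℕ} {W : Set (Space ℓ)} (hW : IsCell W) (H : Word → Hyperplane ℓ)
    (e : Word) : IsCompact (cell W H e) :=
  hW.isCompact.of_isClosed_subset (isClosed_cell hW.isCompact.isClosed H e) (cell_subset W H e)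

theorem IsGoodTree.rate_pos {ℓ : ℕ} {Λ : Measure (Hyperplane ℓ)} (hΛ : IsHyperplaneMeasure Λ)
    {W : Set (Space ℓ)} (hW : IsCell W) {s : Tree ℓ} (hs : IsGoodTree W s) {e : Word}
    (he : e ∈ s.1) : 0 < rate Λ W s e :=
  mass_pos hΛ (isBounded_cell hW _ _) (hs.interior_nonempty e he)

theorem IsLeafSet.nonempty {E : Finset Word} (hE : IsLeafSet E) : E.Nonempty := by
  obtain ⟨e, he, -⟩ := hE.comparable []
  exact ⟨e, he⟩

theorem IsGoodTree.totalRate_pos {ℓ : ℕ} {Λ : Measure (Hyperplane ℓ)}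
    (hΛ : IsHyperplaneMeasure Λ) {W : Set (Space ℓ)} (hW : IsCell W) {s : Tree ℓ}
    (hs : IsGoodTree W s) : 0 < totalRate Λ W s :=
  Finset.sum_pos (fun _ he => hs.rate_pos hΛ hW he) hs.isLeafSet.nonempty

/-- The law of a hyperplane that hits the window. -/
noncomputable abbrev windowLaw {ℓ : ℕ} (Λ : Measure (Hyperplane ℓ)) (W : Set (Space ℓ)) :
    Measure (Hyperplane ℓ) := cond Λ (hit W)

theorem isProbabilityMeasure_windowLaw {ℓ : ℕ} {Λ : Measure (Hyperplane ℓ)}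
    (hΛ : IsHyperplaneMeasure Λ) {W : Set (Space ℓ)} (hW : IsCell W) :
    IsProbabilityMeasure (windowLaw Λ W) :=
  cond_isProbabilityMeasure_of_finite (hΛ.hit_ne_zero hW.2)
    (hΛ.hit_lt_top hW.isCompact.isBounded).ne

theorem windowLaw_hit_ne_zero {ℓ : ℕ} {Λ : Measure (Hyperplane ℓ)}
    (hΛ : IsHyperplaneMeasure Λ) {W : Set (Space ℓ)} (hW : IsCell W) {C : Set (Space ℓ)}
    (hC : C ⊆ W) (hint : (interior C).Nonempty) : windowLaw Λ W (hit C) ≠ 0 := by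
  rw [cond_apply (measurableSet_hit hW.isCompact), Set.inter_eq_self_of_subset_right (hit_mono hC)]
  exact mul_ne_zero (ENNReal.inv_ne_zero.2 (hΛ.hit_lt_top hW.isCompact.isBounded).ne)
    (hΛ.hit_ne_zero hint)

/-- Almost every hyperplane that hits a cell gives a valid division. -/
theorem ae_cond_hit {ℓ : ℕ} {Λ : Measure (Hyperplane ℓ)} (hΛ : IsHyperplaneMeasure Λ)
    {W : Set (Space ℓ)} (hW : IsCell W) {H : Word → Hyperplane ℓ} {e : Word}
    (hint : (interior (cell W H e)).Nonempty) :
    ∀ᵐ h ∂(cond (windowLaw Λ W) (hit (cell W H e))), h ∈ hit (cell W H e) ∧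
      ∀ b, (interior (cell W H e ∩ halfSpace h b)).Nonempty := by
  have hcell := isCell_cell hW H hint
  have h1 : cond (windowLaw Λ W) (hit (cell W H e)) ≪ Λ :=
    cond_absolutelyContinuous.trans cond_absolutelyContinuous
  have h2 : ∀ᵐ h ∂(cond (windowLaw Λ W) (hit (cell W H e))), h ∈ hit (cell W H e) :=
    ae_cond_mem (measurableSet_hit (isCompact_cell hW H e))
  filter_upwards [h2, h1.ae_le (hΛ.ae_cut hcell.isCompact hcell.convex hint)] with h hh hcut
  exact ⟨hh, hcut hh⟩

/-! ### Measurability of the operations on trees -/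

theorem measurable_of_countable_index {α ι β : Type*} [MeasurableSpace α] [MeasurableSpace β]
    [MeasurableSpace ι] [Countable ι] [MeasurableSingletonClass ι] {f : α → ι} (hf : Measurable f)
    {g : ι → α → β} (hg : ∀ i, Measurable (g i)) : Measurable fun a => g (f a) a := by
  have h : Measurable fun p : ι × α => g p.1 p.2 := measurable_from_prod_countable_right hg
  exact h.comp (hf.prodMk measurable_id)

theorem measurableSet_of_countable_index {α ι : Type*} [MeasurableSpace α]
    [MeasurableSpace ι] [Countable ι] [MeasurableSingletonClass ι] {f : α → ι} (hf : Measurable f)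
    {T : ι → Set α} (hT : ∀ i, MeasurableSet (T i)) : MeasurableSet {a | a ∈ T (f a)} := by
  have : {a | a ∈ T (f a)} = ⋃ i, f ⁻¹' {i} ∩ T i := by
    ext a; simp
  rw [this]
  exact MeasurableSet.iUnion fun i => (hf (measurableSet_singleton i)).inter (hT i)

theorem measurable_update_family {ι α : Type*} [DecidableEq ι] [MeasurableSpace α] (i : ι) :
    Measurable fun p : (ι → α) × α => Function.update p.1 i p.2 :=
  (measurable_update_prod i).comp measurable_swap

theorem measurable_divide {ℓ : ℕ} : Measurable fun p : Tree ℓ × Division ℓ => divide p.1 p.2 := by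
  refine Measurable.prodMk ?_ ?_
  · exact (measurable_of_countable fun q : Finset Word × Word => splitLeaves q.1 q.2).comp
      (measurable_fst.fst.prodMk measurable_snd.fst)
  · exact measurable_of_countable_index (f := fun p : Tree ℓ × Division ℓ => p.2.1)
      (g := fun w p => Function.update p.1.2 w p.2.2.2) measurable_snd.fst fun w =>
      (measurable_update_family w).comp (measurable_fst.snd.prodMk measurable_snd.snd.snd)

theorem measurable_rate {ℓ : ℕ} {Λ : Measure (Hyperplane ℓ)} (hΛ : IsHyperplaneMeasure Λ)
    {W : Set (Space ℓ)} (hW : IsCell W) (e : Word) : Measurable fun s : Tree ℓ => rate Λ W s e :=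
  (measurable_mass_cell hΛ hW.isCompact e).comp measurable_snd

theorem measurable_totalRate {ℓ : ℕ} {Λ : Measure (Hyperplane ℓ)} (hΛ : IsHyperplaneMeasure Λ)
    {W : Set (Space ℓ)} (hW : IsCell W) : Measurable fun s : Tree ℓ => totalRate Λ W s :=
  measurable_of_countable_index (f := fun s : Tree ℓ => s.1)
    (g := fun E s => ∑ e ∈ E, rate Λ W s e) measurable_fst fun E =>
    Finset.measurable_sum E fun e _ => measurable_rate hΛ hW e

theorem measurableSet_leaf {ℓ : ℕ} :
    MeasurableSet {p : Tree ℓ × Division ℓ | p.2.1 ∈ p.1.1} := by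
  have h : Measurable fun p : Tree ℓ × Division ℓ => (p.1.1, p.2.1) :=
    measurable_fst.fst.prodMk measurable_snd.fst
  exact h (Set.to_countable {q : Finset Word × Word | q.2 ∈ q.1}).measurableSet

theorem measurableSet_hits {ℓ : ℕ} {W : Set (Space ℓ)} (hW : IsCell W) :
    MeasurableSet {p : Tree ℓ × Division ℓ | p.2.2.2 ∈ hit (cell W p.1.2 p.2.1)} := by
  have h : Measurable fun p : Tree ℓ × Division ℓ => (p.1.2, p.2.2.2) :=
    measurable_fst.snd.prodMk measurable_snd.snd.snd
  exact measurableSet_of_countable_index (f := fun p : Tree ℓ × Division ℓ => p.2.1)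
    measurable_snd.fst fun w => h (measurableSet_setOf_mem_hit_cell hW.isCompact w)

theorem measurableSet_cut {ℓ : ℕ} (W : Set (Space ℓ)) (b : Bool) :
    MeasurableSet {p : Tree ℓ × Division ℓ |
      (interior (cell W p.1.2 p.2.1 ∩ halfSpace p.2.2.2 b)).Nonempty} := by
  have h : Measurable fun p : Tree ℓ × Division ℓ => (p.1.2, p.2.2.2) :=
    measurable_fst.snd.prodMk measurable_snd.snd.snd
  have h1 : ∀ w : Word, MeasurableSet {p : Tree ℓ × Division ℓ |
      (interior (cell W p.1.2 w ∩ halfSpace p.2.2.2 b)).Nonempty} := by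
    intro w
    have h2 : MeasurableSet {q : (Word → Hyperplane ℓ) × Hyperplane ℓ |
        (interior (cell W (Function.update q.1 w q.2) (b :: w))).Nonempty} :=
      measurable_update_family w (measurableSet_interior_cell_nonempty W (b :: w))
    simp only [cell_update_cons] at h2
    exact h h2
  exact measurableSet_of_countable_index (f := fun p : Tree ℓ × Division ℓ => p.2.1)
    measurable_snd.fst h1

theorem measurableSet_isValidDivision {ℓ : ℕ} {W : Set (Space ℓ)} (hW : IsCell W) :
    MeasurableSet {p : Tree ℓ × Division ℓ | IsValidDivision W p.1 p.2} := by
  have h2 : MeasurableSet {p : Tree ℓ × Division ℓ | 0 ≤ p.2.2.1} :=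
    measurableSet_le measurable_const measurable_snd.snd.fst
  convert ((measurableSet_leaf.inter h2).inter (measurableSet_hits hW)).inter
    (MeasurableSet.iInter (measurableSet_cut W)) using 1
  ext p
  simp only [Set.mem_inter_iff, Set.mem_iInter, Set.mem_ofPred_eq]
  exact ⟨fun h => ⟨⟨⟨h.1, h.2⟩, h.3⟩, h.4⟩, fun h => ⟨h.1.1.1, h.1.1.2, h.1.2, h.2⟩⟩

/-! ### Choosing a word -/

/-- The first word with a property (the empty word if there is none). -/
noncomputable def firstWord (p : Word → Prop) : Word := unrank (sInf {n | p (unrank n)})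

theorem firstWord_spec {p : Word → Prop} (h : ∃ e, p e) : p (firstWord p) := by
  obtain ⟨e, he⟩ := h
  have hne : {n | p (unrank n)}.Nonempty := ⟨Word.rank e, by simpa [unrank_rank] using he⟩
  exact Nat.sInf_mem hne

theorem firstWord_eq {p : Word → Prop} {e : Word} (he : p e) (h : ∀ e', p e' → e' = e) :
    firstWord p = e :=
  h _ (firstWord_spec ⟨e, he⟩)

theorem measurable_firstWord {α : Type*} [MeasurableSpace α] {p : α → Word → Prop}
    (hp : ∀ e, MeasurableSet {a | p a e}) : Measurable fun a => firstWord (p a) :=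
  (measurable_of_countable unrank).comp (measurable_sInf_nat fun n => hp (unrank n))

/-- Consecutive intervals of lengths `p` cover an interval. -/
theorem exists_mem_slot {E : Finset Word} {p : Word → ℝ} {u : ℝ}
    (h0 : 0 ≤ u) (hu : u < ∑ e ∈ E, p e) : ∃ e ∈ E,
      ∑ e' ∈ E with Word.rank e' < Word.rank e, p e' ≤ u ∧
        u < (∑ e' ∈ E with Word.rank e' < Word.rank e, p e') + p e := by
  induction E using Finset.induction_on_max_value Word.rank with
  | empty => simp at hu; linarith
  | insert a E ha hmax ih =>
    have hlt : ∀ e ∈ E, Word.rank e < Word.rank a := fun e he =>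
      lt_of_le_of_ne (hmax e he) fun h => ha (rank_injective h ▸ he)
    by_cases h : u < ∑ e ∈ E, p e
    · obtain ⟨e, he, h1⟩ := ih h
      refine ⟨e, Finset.mem_insert_of_mem he, ?_⟩
      rwa [Finset.filter_insert, if_neg (hlt e he).not_gt]
    · refine ⟨a, Finset.mem_insert_self _ _, ?_⟩
      rw [Finset.filter_insert, if_neg (lt_irrefl _), Finset.filter_true_of_mem hlt]
      rw [Finset.sum_insert ha] at hu
      exact ⟨not_lt.1 h, by linarith⟩

/-- Consecutive intervals of nonnegative lengths are disjoint. -/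
theorem slot_unique {E : Finset Word} {p : Word → ℝ} (hp : ∀ e ∈ E, 0 ≤ p e) {u : ℝ}
    {e e' : Word} (he : e ∈ E)
    (h1 : u < (∑ x ∈ E with Word.rank x < Word.rank e, p x) + p e)
    (h2 : ∑ x ∈ E with Word.rank x < Word.rank e', p x ≤ u) :
    Word.rank e' ≤ Word.rank e := by
  by_contra! hlt
  have hsub : insert e (E.filter fun x => Word.rank x < Word.rank e) ⊆
      E.filter fun x => Word.rank x < Word.rank e' := by
    intro x hx
    rcases Finset.mem_insert.1 hx with rfl | hx
    · exact Finset.mem_filter.2 ⟨he, hlt⟩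
    · exact Finset.mem_filter.2 ⟨(Finset.mem_filter.1 hx).1, (Finset.mem_filter.1 hx).2.trans hlt⟩
  have := Finset.sum_le_sum_of_subset_of_nonneg hsub
    (f := p) fun x hx _ => hp x (Finset.mem_filter.1 hx).1
  rw [Finset.sum_insert (by simp)] at this
  linarith

/-! ### The transition law of the divisions -/

/-- The law of the next division: the leaf `e` is divided with probability proportional to its
rate, the waiting time is exponential with the total rate, and the hyperplane has the law of a
hyperplane that hits the cell of `e`. -/
noncomputable def divisionLaw {ℓ : ℕ} (Λ : Measure (Hyperplane ℓ)) (W : Set (Space ℓ))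
    (s : Tree ℓ) : Measure (Division ℓ) :=
  ∑ e ∈ s.1, ENNReal.ofReal ((totalRate Λ W s)⁻¹ * rate Λ W s e) •
    ((expMeasure 1).prod (cond (windowLaw Λ W) (hit (cell W s.2 e)))).map
      fun p => (e, (totalRate Λ W s)⁻¹ * p.1, p.2)

theorem lintegral_divisionLaw {ℓ : ℕ} (Λ : Measure (Hyperplane ℓ)) (W : Set (Space ℓ))
    (s : Tree ℓ) {f : Division ℓ → ℝ≥0∞} (hf : Measurable f) :
    ∫⁻ o, f o ∂(divisionLaw Λ W s) =
      ∑ e ∈ s.1, ENNReal.ofReal ((totalRate Λ W s)⁻¹ * rate Λ W s e) *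
        ∫⁻ v, ∫⁻ h, f (e, (totalRate Λ W s)⁻¹ * v, h)
          ∂(cond (windowLaw Λ W) (hit (cell W s.2 e))) ∂(expMeasure 1) := by
  have : SFinite (windowLaw Λ W) := inferInstance
  rw [divisionLaw, lintegral_finsetSum_measure]
  refine Finset.sum_congr rfl fun e _ => ?_
  have hm : Measurable fun p : ℝ × Hyperplane ℓ => (e, (totalRate Λ W s)⁻¹ * p.1, p.2) := by
    fun_prop
  rw [lintegral_smul_measure, smul_eq_mul, lintegral_map hf hm,
    lintegral_prod (fun p : ℝ × Hyperplane ℓ => f (e, (totalRate Λ W s)⁻¹ * p.1, p.2))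
      (hf.comp hm).aemeasurable]

/-- Almost surely the next division is valid. -/
theorem ae_divisionLaw {ℓ : ℕ} {Λ : Measure (Hyperplane ℓ)} (hΛ : IsHyperplaneMeasure Λ)
    {W : Set (Space ℓ)} (hW : IsCell W) {s : Tree ℓ} (hs : IsGoodTree W s) :
    ∀ᵐ o ∂(divisionLaw Λ W s), IsValidDivision W s o := by
  have hm : MeasurableSet {o : Division ℓ | IsValidDivision W s o} :=
    measurable_prodMk_left (measurableSet_isValidDivision hW)
  rw [ae_iff]
  change divisionLaw Λ W s {o | IsValidDivision W s o}ᶜ = 0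
  rw [← lintegral_indicator_one hm.compl, lintegral_divisionLaw _ _ _
    (measurable_one.indicator hm.compl)]
  refine Finset.sum_eq_zero fun e he => ?_
  have : ∀ᵐ v ∂(expMeasure 1), ∫⁻ h, {o | IsValidDivision W s o}ᶜ.indicator
      (1 : Division ℓ → ℝ≥0∞) (e, (totalRate Λ W s)⁻¹ * v, h)
      ∂(cond (windowLaw Λ W) (hit (cell W s.2 e))) = 0 := by
    filter_upwards [ae_nonneg_expMeasure] with v hv
    refine lintegral_eq_zero_of_ae_eq_zero ?_
    filter_upwards [ae_cond_hit hΛ hW (hs.interior_nonempty e he)] with h hh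
    have : IsValidDivision W s (e, (totalRate Λ W s)⁻¹ * v, h) :=
      ⟨he, mul_nonneg (inv_nonneg.2 (hs.totalRate_pos hΛ hW).le) hv, hh.1, hh.2⟩
    simp [this]
  rw [lintegral_congr_ae this]
  simp

/-! ### The rejection-based chain as a driven recursion -/

/-- The number `u` lies in the interval of the leaf `e`. -/
def InSlot {ℓ : ℕ} (Λ : Measure (Hyperplane ℓ)) (W : Set (Space ℓ)) (s : Tree ℓ) (u : ℝ)
    (e : Word) : Prop :=
  e ∈ s.1 ∧
    ∑ e' ∈ s.1 with Word.rank e' < Word.rank e, (totalRate Λ W s)⁻¹ * rate Λ W s e' ≤ u ∧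
    u < (∑ e' ∈ s.1 with Word.rank e' < Word.rank e, (totalRate Λ W s)⁻¹ * rate Λ W s e') +
      (totalRate Λ W s)⁻¹ * rate Λ W s e

/-- The leaf whose interval contains `u`. -/
noncomputable def selectWord {ℓ : ℕ} (Λ : Measure (Hyperplane ℓ)) (W : Set (Space ℓ))
    (s : Tree ℓ) (u : ℝ) : Word := firstWord (InSlot Λ W s u)

theorem IsGoodTree.inSlot_unique {ℓ : ℕ} {Λ : Measure (Hyperplane ℓ)}
    (hΛ : IsHyperplaneMeasure Λ) {W : Set (Space ℓ)} (hW : IsCell W) {s : Tree ℓ}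
    (hs : IsGoodTree W s) {u : ℝ} {e e' : Word} (he : InSlot Λ W s u e)
    (he' : InSlot Λ W s u e') : e = e' := by
  have hp : ∀ x ∈ s.1, 0 ≤ (totalRate Λ W s)⁻¹ * rate Λ W s x := fun x hx =>
    mul_nonneg (inv_nonneg.2 (hs.totalRate_pos hΛ hW).le) (hs.rate_pos hΛ hW hx).le
  exact rank_injective (le_antisymm (slot_unique hp he'.1 he'.2.2 he.2.1)
    (slot_unique hp he.1 he.2.2 he'.2.1))

theorem IsGoodTree.exists_inSlot {ℓ : ℕ} {Λ : Measure (Hyperplane ℓ)}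
    (hΛ : IsHyperplaneMeasure Λ) {W : Set (Space ℓ)} (hW : IsCell W) {s : Tree ℓ}
    (hs : IsGoodTree W s) {u : ℝ} (hu : u ∈ Set.Ico (0 : ℝ) 1) : ∃ e, InSlot Λ W s u e := by
  have : u < ∑ e ∈ s.1, (totalRate Λ W s)⁻¹ * rate Λ W s e := by
    rw [← Finset.mul_sum]
    change u < (totalRate Λ W s)⁻¹ * totalRate Λ W s
    rw [inv_mul_cancel₀ (hs.totalRate_pos hΛ hW).ne']
    exact hu.2
  obtain ⟨e, he, h⟩ := exists_mem_slot hu.1 this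
  exact ⟨e, he, h⟩

theorem IsGoodTree.selectWord_eq {ℓ : ℕ} {Λ : Measure (Hyperplane ℓ)}
    (hΛ : IsHyperplaneMeasure Λ) {W : Set (Space ℓ)} (hW : IsCell W) {s : Tree ℓ}
    (hs : IsGoodTree W s) {u : ℝ} {e : Word} (he : InSlot Λ W s u e) :
    selectWord Λ W s u = e :=
  firstWord_eq he fun _ he' => hs.inSlot_unique hΛ hW he' he

/-- A uniform variable selects each leaf with the probability proportional to its rate. -/
theorem IsGoodTree.lintegral_selectWord {ℓ : ℕ} {Λ : Measure (Hyperplane ℓ)}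
    (hΛ : IsHyperplaneMeasure Λ) {W : Set (Space ℓ)} (hW : IsCell W) {s : Tree ℓ}
    (hs : IsGoodTree W s) (g : Word → ℝ≥0∞) :
    ∫⁻ u in Set.Ico (0 : ℝ) 1, g (selectWord Λ W s u) =
      ∑ e ∈ s.1, ENNReal.ofReal ((totalRate Λ W s)⁻¹ * rate Λ W s e) * g e := by
  set p : Word → ℝ := fun e => (totalRate Λ W s)⁻¹ * rate Λ W s e with hp
  have hp0 : ∀ x ∈ s.1, 0 ≤ p x := fun x hx =>
    mul_nonneg (inv_nonneg.2 (hs.totalRate_pos hΛ hW).le) (hs.rate_pos hΛ hW hx).le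
  set a : Word → ℝ := fun e => ∑ e' ∈ s.1 with Word.rank e' < Word.rank e, p e' with ha
  have hsum : ∑ e ∈ s.1, p e = 1 := by
    rw [hp, ← Finset.mul_sum]
    exact inv_mul_cancel₀ (hs.totalRate_pos hΛ hW).ne'
  have hmem : ∀ e ∈ s.1, ∀ u, u ∈ Set.Ico (a e) (a e + p e) ↔ InSlot Λ W s u e :=
    fun e he u => ⟨fun h => ⟨he, h⟩, fun h => h.2⟩
  have hunion : Set.Ico (0 : ℝ) 1 = ⋃ e ∈ s.1, Set.Ico (a e) (a e + p e) := by
    ext u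
    simp only [Set.mem_iUnion, exists_prop]
    constructor
    · intro hu
      obtain ⟨e, he⟩ := hs.exists_inSlot hΛ hW hu
      exact ⟨e, he.1, he.2⟩
    · rintro ⟨e, he, h1, h2⟩
      refine ⟨le_trans (Finset.sum_nonneg fun x hx => hp0 x (Finset.mem_filter.1 hx).1) h1,
        h2.trans_le ?_⟩
      rw [← hsum, add_comm, ← Finset.sum_insert (by simp)]
      refine Finset.sum_le_sum_of_subset_of_nonneg ?_ fun x hx _ => hp0 x hx
      exact Finset.insert_subset he (Finset.filter_subset _ _)
  rw [hunion, lintegral_biUnion_finset]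
  · refine Finset.sum_congr rfl fun e he => ?_
    rw [setLIntegral_congr_fun (g := fun _ => g e) measurableSet_Ico, setLIntegral_const,
      Real.volume_Ico, add_sub_cancel_left, mul_comm]
    intro u hu
    exact congrArg g (hs.selectWord_eq hΛ hW ((hmem e he u).1 hu))
  · intro e he e' he' hne
    rw [Function.onFun, Set.disjoint_left]
    intro u hu hu'
    exact hne (hs.inSlot_unique hΛ hW ((hmem e he u).1 hu) ((hmem e' he' u).1 hu'))
  · exact fun e _ => measurableSet_Ico

theorem measurable_selectWord {ℓ : ℕ} {Λ : Measure (Hyperplane ℓ)}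
    (hΛ : IsHyperplaneMeasure Λ) {W : Set (Space ℓ)} (hW : IsCell W) :
    Measurable fun p : Tree ℓ × ℝ => selectWord Λ W p.1 p.2 := by
  refine measurable_firstWord fun e => ?_
  refine measurableSet_of_countable_index (f := fun p : Tree ℓ × ℝ => p.1.1)
    (T := fun E => {p : Tree ℓ × ℝ | e ∈ E ∧
    ∑ e' ∈ E with Word.rank e' < Word.rank e, (totalRate Λ W p.1)⁻¹ * rate Λ W p.1 e' ≤ p.2 ∧
    p.2 < (∑ e' ∈ E with Word.rank e' < Word.rank e,
      (totalRate Λ W p.1)⁻¹ * rate Λ W p.1 e') + (totalRate Λ W p.1)⁻¹ * rate Λ W p.1 e})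
    measurable_fst.fst fun E => ?_
  have h1 : ∀ e', Measurable fun p : Tree ℓ × ℝ => (totalRate Λ W p.1)⁻¹ * rate Λ W p.1 e' :=
    fun e' => ((measurable_totalRate hΛ hW).comp measurable_fst).inv.mul
      ((measurable_rate hΛ hW e').comp measurable_fst)
  have h2 := Finset.measurable_fun_sum (E.filter fun e' => Word.rank e' < Word.rank e)
    fun e' _ => h1 e'
  exact (MeasurableSet.const _).inter ((measurableSet_le h2 measurable_snd).inter
    (measurableSet_lt measurable_snd (h2.add (h1 e))))

/-- The randomness of the rejection-based chain: the streams of the `U_n`, the `V_n` and the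
`G_n`. -/
abbrev ChainSupply (ℓ : ℕ) : Type := (ℕ → ℝ) × (ℕ → ℝ) × (ℕ → Hyperplane ℓ)

/-- The steps of the rejection-based chain. -/
noncomputable def chainDriver {ℓ : ℕ} (Λ : Measure (Hyperplane ℓ)) (W : Set (Space ℓ)) :
    Driver (Tree ℓ) (Division ℓ) (ChainSupply ℓ) where
  out s d := (selectWord Λ W s (d.1 0), (totalRate Λ W s)⁻¹ * d.2.1 0,
    hitValue (hit (cell W s.2 (selectWord Λ W s (d.1 0)))) d.2.2)
  nxt s d := (fun k => d.1 (k + 1), fun k => d.2.1 (k + 1),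
    hitTail (hit (cell W s.2 (selectWord Λ W s (d.1 0)))) d.2.2)

/-- The law of the randomness of the rejection-based chain. -/
noncomputable def chainSupplyLaw {ℓ : ℕ} (Λ : Measure (Hyperplane ℓ)) (W : Set (Space ℓ)) :
    Measure (ChainSupply ℓ) :=
  (Measure.infinitePi fun _ : ℕ => volume.restrict (Set.Ico (0 : ℝ) 1)).prod
    ((Measure.infinitePi fun _ : ℕ => expMeasure 1).prod
      (Measure.infinitePi fun _ : ℕ => windowLaw Λ W))

instance : IsProbabilityMeasure (volume.restrict (Set.Ico (0 : ℝ) 1)) := ⟨by simp⟩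

theorem measurableSet_hit_word {ℓ : ℕ} {W : Set (Space ℓ)} (hW : IsCell W) {α : Type*}
    [MeasurableSpace α] {w : α → Word} (hw : Measurable w) {H : α → Word → Hyperplane ℓ}
    (hH : Measurable H) :
    MeasurableSet {p : α × Hyperplane ℓ | p.2 ∈ hit (cell W (H p.1) (w p.1))} := by
  have h : Measurable fun p : α × Hyperplane ℓ => (H p.1, p.2) :=
    (hH.comp measurable_fst).prodMk measurable_snd
  exact measurableSet_of_countable_index (f := fun p : α × Hyperplane ℓ => w p.1)
    (hw.comp measurable_fst) fun e => h (measurableSet_setOf_mem_hit_cell hW.isCompact e)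

/-- The first step of the three streams: it uses one `U`, one `V`, and the terms of the last
stream up to the first one in `A`. -/
theorem lintegral_three_streams {α β γ : Type*} [MeasurableSpace α] [MeasurableSpace β]
    [MeasurableSpace γ] (P : Measure α) (ρ : Measure β) (ν : Measure γ) [IsProbabilityMeasure P]
    [IsProbabilityMeasure ρ] [IsProbabilityMeasure ν] {A : Set γ} (hA : MeasurableSet A)
    (h0 : ν A ≠ 0) {F : β × γ → α × (ℕ → β) × (ℕ → γ) → ℝ≥0∞}
    (hF : Measurable fun p : (β × γ) × α × (ℕ → β) × (ℕ → γ) => F p.1 p.2) :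
    ∫⁻ x, ∫⁻ y, ∫⁻ z, F (y 0, hitValue A z) (x, fun k => y (k + 1), hitTail A z)
        ∂(Measure.infinitePi fun _ : ℕ => ν) ∂(Measure.infinitePi fun _ : ℕ => ρ) ∂P =
      ∫⁻ v, ∫⁻ h, ∫⁻ x, ∫⁻ y, ∫⁻ z, F (v, h) (x, y, z)
        ∂(Measure.infinitePi fun _ : ℕ => ν) ∂(Measure.infinitePi fun _ : ℕ => ρ) ∂P
        ∂(cond ν A) ∂ρ := by
  have hA' : MeasurableSet {p : (ℕ → γ) × γ | p.2 ∈ A} := measurable_snd hA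
  have hhv : Measurable fun z : ℕ → γ => hitValue A z :=
    measurable_hitValue (A := fun _ => A) hA' measurable_id
  have hht : Measurable fun z : ℕ → γ => hitTail A z :=
    measurable_hitTail (A := fun _ => A) hA' measurable_id
  have h1 : ∀ x, ∫⁻ y, ∫⁻ z, F (y 0, hitValue A z) (x, fun k => y (k + 1), hitTail A z)
        ∂(Measure.infinitePi fun _ : ℕ => ν) ∂(Measure.infinitePi fun _ : ℕ => ρ) =
      ∫⁻ v, ∫⁻ h, ∫⁻ y, ∫⁻ z, F (v, h) (x, y, z)
        ∂(Measure.infinitePi fun _ : ℕ => ν) ∂(Measure.infinitePi fun _ : ℕ => ρ)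
        ∂(cond ν A) ∂ρ := by
    intro x
    have m1 : Measurable fun p : (ℕ → β) × (ℕ → γ) =>
        F (p.1 0, hitValue A p.2) (x, fun k => p.1 (k + 1), hitTail A p.2) :=
      hF.comp (f := fun p : (ℕ → β) × (ℕ → γ) =>
        ((p.1 0, hitValue A p.2), (x, fun k => p.1 (k + 1), hitTail A p.2))) (by fun_prop)
    rw [lintegral_stream ρ m1.lintegral_prod_right']
    refine lintegral_congr fun v => ?_
    have m2 : Measurable fun p : ((ℕ → β) × γ) × (ℕ → γ) => F (v, p.1.2) (x, p.1.1, p.2) :=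
      hF.comp (f := fun p : ((ℕ → β) × γ) × (ℕ → γ) => ((v, p.1.2), (x, p.1.1, p.2)))
        (by fun_prop)
    refine Eq.trans (lintegral_congr fun y => ?_)
      (lintegral_lintegral_swap m2.lintegral_prod_right'.aemeasurable)
    exact lintegral_hit ν hA h0 (f := fun q => F (v, q.1) (x, y, q.2))
      (hF.comp (f := fun q : γ × (ℕ → γ) => ((v, q.1), (x, y, q.2))) (by fun_prop))
  have m3 : Measurable fun p : (α × β) × γ => ∫⁻ y, ∫⁻ z, F (p.1.2, p.2) (p.1.1, y, z)
        ∂(Measure.infinitePi fun _ : ℕ => ν) ∂(Measure.infinitePi fun _ : ℕ => ρ) := by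
    have m4 : Measurable fun p : (((α × β) × γ) × (ℕ → β)) × (ℕ → γ) =>
        F (p.1.1.1.2, p.1.1.2) (p.1.1.1.1, p.1.2, p.2) :=
      hF.comp (f := fun p : (((α × β) × γ) × (ℕ → β)) × (ℕ → γ) =>
        ((p.1.1.1.2, p.1.1.2), (p.1.1.1.1, p.1.2, p.2))) (by fun_prop)
    exact m4.lintegral_prod_right'.lintegral_prod_right'
  simp only [h1]
  rw [lintegral_lintegral_swap m3.lintegral_prod_right'.aemeasurable]
  refine lintegral_congr fun v => ?_
  rw [lintegral_lintegral_swap]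
  exact (m3.comp (f := fun p : α × γ => ((p.1, v), p.2)) (by fun_prop)).aemeasurable

/-- The rejection-based chain has the transition law `divisionLaw`. -/
theorem isDriven_chainDriver {ℓ : ℕ} {Λ : Measure (Hyperplane ℓ)}
    (hΛ : IsHyperplaneMeasure Λ) {W : Set (Space ℓ)} (hW : IsCell W) :
    (chainDriver Λ W).IsDriven divide (chainSupplyLaw Λ W) (divisionLaw Λ W) (fun _ => True)
      (IsGoodTree W) (fun _ _ => True) (IsValidDivision W) (fun _ d d' => d = d') := by
  have := isProbabilityMeasure_windowLaw hΛ hW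
  have hw : Measurable fun p : Tree ℓ × ChainSupply ℓ => selectWord Λ W p.1 (p.2.1 0) :=
    (measurable_selectWord hΛ hW).comp
      (measurable_fst.prodMk ((measurable_pi_apply 0).comp measurable_snd.fst))
  have hA := measurableSet_hit_word hW hw
    (measurable_fst.snd : Measurable fun p : Tree ℓ × ChainSupply ℓ => p.1.2)
  have hG : Measurable fun p : Tree ℓ × ChainSupply ℓ => p.2.2.2 := measurable_snd.snd.snd
  have mo : Measurable fun p : Tree ℓ × ChainSupply ℓ => (chainDriver Λ W).out p.1 p.2 := by
    refine hw.prodMk (Measurable.prodMk ?_ (measurable_hitValue hA hG))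
    exact ((measurable_totalRate hΛ hW).comp measurable_fst).inv.mul
      ((measurable_pi_apply 0).comp measurable_snd.snd.fst)
  have mn : Measurable fun p : Tree ℓ × ChainSupply ℓ => (chainDriver Λ W).nxt p.1 p.2 := by
    refine Measurable.prodMk ?_ (Measurable.prodMk ?_ (measurable_hitTail hA hG))
    · exact measurable_pi_lambda _ fun k => (measurable_pi_apply (k + 1)).comp measurable_snd.fst
    · exact measurable_pi_lambda _ fun k =>
        (measurable_pi_apply (k + 1)).comp measurable_snd.snd.fst
  refine ⟨mo, mn, fun _ _ => trivial, fun _ _ _ _ => trivial, fun _ _ _ => trivial, ?_, ?_, ?_,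
    fun s o hs ho => hs.divide ho, fun s hs => ae_divisionLaw hΛ hW hs⟩
  · rintro s d _ - rfl; rfl
  · rintro s d _ - rfl; rfl
  · intro s hs F hF _
    set PU := Measure.infinitePi fun _ : ℕ => volume.restrict (Set.Ico (0 : ℝ) 1)
    set PV := Measure.infinitePi fun _ : ℕ => expMeasure 1
    set PG := Measure.infinitePi fun _ : ℕ => windowLaw Λ W
    have hint : ∀ {f : ChainSupply ℓ → ℝ≥0∞}, Measurable f →
        ∫⁻ d, f d ∂(chainSupplyLaw Λ W) = ∫⁻ x, ∫⁻ y, ∫⁻ z, f (x, y, z) ∂PG ∂PV ∂PU := by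
      intro f hf
      rw [chainSupplyLaw, lintegral_prod _ hf.aemeasurable]
      refine lintegral_congr fun x => ?_
      exact lintegral_prod (fun y => f (x, y)) (hf.comp measurable_prodMk_left).aemeasurable
    set Q : Word → ℝ≥0∞ := fun e => ∫⁻ v, ∫⁻ h, ∫⁻ d, F (e, (totalRate Λ W s)⁻¹ * v, h) d
      ∂(chainSupplyLaw Λ W) ∂(cond (windowLaw Λ W) (hit (cell W s.2 e))) ∂(expMeasure 1) with hQ
    have hstep : ∀ e ∈ s.1, ∫⁻ x, ∫⁻ y, ∫⁻ z, F (e, (totalRate Λ W s)⁻¹ * y 0,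
        hitValue (hit (cell W s.2 e)) z)
        (x, fun k => y (k + 1), hitTail (hit (cell W s.2 e)) z) ∂PG ∂PV ∂PU = Q e := by
      intro e he
      have hFe : Measurable fun p : (ℝ × Hyperplane ℓ) × ChainSupply ℓ =>
          F (e, (totalRate Λ W s)⁻¹ * p.1.1, p.1.2) p.2 :=
        hF.comp (f := fun p : (ℝ × Hyperplane ℓ) × ChainSupply ℓ =>
          ((e, (totalRate Λ W s)⁻¹ * p.1.1, p.1.2), p.2)) (by fun_prop)
      rw [lintegral_three_streams PU (expMeasure 1) (windowLaw Λ W)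
        (measurableSet_hit (isCompact_cell hW s.2 e))
        (windowLaw_hit_ne_zero hΛ hW (cell_subset W s.2 e) (hs.interior_nonempty e he))
        (F := fun q d => F (e, (totalRate Λ W s)⁻¹ * q.1, q.2) d) hFe]
      simp only [hQ]
      refine lintegral_congr fun v => lintegral_congr fun h => ?_
      exact (hint (hF.comp measurable_prodMk_left)).symm
    have m1 : Measurable fun d : ChainSupply ℓ =>
        F ((chainDriver Λ W).out s d) ((chainDriver Λ W).nxt s d) :=
      hF.comp ((mo.comp measurable_prodMk_left).prodMk (mn.comp measurable_prodMk_left))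
    have m2 : Measurable fun x : ℕ → ℝ => ∫⁻ y, ∫⁻ z, F ((chainDriver Λ W).out s (x, y, z))
        ((chainDriver Λ W).nxt s (x, y, z)) ∂PG ∂PV := by
      have : Measurable fun p : ((ℕ → ℝ) × (ℕ → ℝ)) × (ℕ → Hyperplane ℓ) =>
          F ((chainDriver Λ W).out s (p.1.1, p.1.2, p.2))
            ((chainDriver Λ W).nxt s (p.1.1, p.1.2, p.2)) :=
        m1.comp (f := fun p : ((ℕ → ℝ) × (ℕ → ℝ)) × (ℕ → Hyperplane ℓ) =>
          (p.1.1, p.1.2, p.2)) (by fun_prop)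
      exact this.lintegral_prod_right'.lintegral_prod_right'
    have m3 : Measurable fun o : Division ℓ => ∫⁻ d, F o d ∂(chainSupplyLaw Λ W) := by
      have : IsProbabilityMeasure (chainSupplyLaw Λ W) := by
        unfold chainSupplyLaw; infer_instance
      exact hF.lintegral_prod_right'
    rw [hint m1, lintegral_stream _ m2, lintegral_divisionLaw Λ W s m3,
      ← hs.lintegral_selectWord hΛ hW Q]
    refine setLIntegral_congr_fun measurableSet_Ico fun u hu => ?_
    have hsel : selectWord Λ W s u ∈ s.1 := (firstWord_spec (hs.exists_inSlot hΛ hW hu)).1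
    exact hstep _ hsel

/-! ### Independent lifetimes as a driven recursion -/

/-- The randomness of the cells that divide independently: for each word a normalized lifetime
and a stream of hyperplanes. -/
abbrev ClockSupply (ℓ : ℕ) : Type := (Word → ℝ) × (Word → ℕ → Hyperplane ℓ)

/-- The law of the lifetimes and of the streams of hyperplanes. -/
noncomputable def clockSupplyLaw {ℓ : ℕ} (Λ : Measure (Hyperplane ℓ)) (W : Set (Space ℓ)) :
    Measure (ClockSupply ℓ) :=
  (Measure.infinitePi fun _ : Word => expMeasure 1).prod
    (Measure.infinitePi fun _ : Word => Measure.infinitePi fun _ : ℕ => windowLaw Λ W)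

/-- The leaf whose clock rings first. -/
noncomputable def ringingWord {ℓ : ℕ} (Λ : Measure (Hyperplane ℓ)) (W : Set (Space ℓ))
    (s : Tree ℓ) (z : Word → ℝ) : Word :=
  firstWord fun e => e ∈ s.1 ∧ ∀ e' ∈ s.1, (rate Λ W s e)⁻¹ * z e ≤ (rate Λ W s e')⁻¹ * z e'

open Classical in
/-- The residual normalized lifetimes of the other leaves when the clock of `w` rings. -/
noncomputable def residual {ℓ : ℕ} (Λ : Measure (Hyperplane ℓ)) (W : Set (Space ℓ))
    (s : Tree ℓ) (w : Word) (z : Word → ℝ) : Word → ℝ :=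
  fun e => if e ∈ s.1.erase w then z e - rate Λ W s e * ((rate Λ W s w)⁻¹ * z w) else z e

/-- The successive divisions of cells with independent lifetimes. The supply holds the residual
lifetimes of the leaves and the lifetimes of the words that are not yet born. -/
noncomputable def clockDriver {ℓ : ℕ} (Λ : Measure (Hyperplane ℓ)) (W : Set (Space ℓ)) :
    Driver (Tree ℓ) (Division ℓ) (ClockSupply ℓ) where
  out s d := (ringingWord Λ W s d.1,
    (rate Λ W s (ringingWord Λ W s d.1))⁻¹ * d.1 (ringingWord Λ W s d.1),
    hitValue (hit (cell W s.2 (ringingWord Λ W s d.1))) (d.2 (ringingWord Λ W s d.1)))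
  nxt s d := (residual Λ W s (ringingWord Λ W s d.1) d.1, d.2)

/-- Two supplies agree at the descendants of the leaves. -/
def AgreeBelow {ℓ : ℕ} (s : Tree ℓ) (d d' : ClockSupply ℓ) : Prop :=
  ∀ e, (∃ l ∈ s.1, l <:+ e) → d.1 e = d'.1 e ∧ d.2 e = d'.2 e

theorem ringingWord_spec {ℓ : ℕ} (Λ : Measure (Hyperplane ℓ)) (W : Set (Space ℓ))
    {s : Tree ℓ} (hs : s.1.Nonempty) (z : Word → ℝ) :
    ringingWord Λ W s z ∈ s.1 ∧ ∀ e' ∈ s.1,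
      (rate Λ W s (ringingWord Λ W s z))⁻¹ * z (ringingWord Λ W s z) ≤
        (rate Λ W s e')⁻¹ * z e' := by
  refine firstWord_spec (p := fun e => e ∈ s.1 ∧ ∀ e' ∈ s.1,
    (rate Λ W s e)⁻¹ * z e ≤ (rate Λ W s e')⁻¹ * z e') ?_
  obtain ⟨e, he, h⟩ := s.1.exists_min_image (fun e => (rate Λ W s e)⁻¹ * z e) hs
  exact ⟨e, he, h⟩

theorem ringingWord_congr {ℓ : ℕ} (Λ : Measure (Hyperplane ℓ)) (W : Set (Space ℓ))
    {s : Tree ℓ} {z z' : Word → ℝ} (h : ∀ e ∈ s.1, z e = z' e) :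
    ringingWord Λ W s z = ringingWord Λ W s z' := by
  unfold ringingWord
  congr 1
  funext e
  refine propext (and_congr_right fun he => forall₂_congr fun e' he' => ?_)
  rw [h e he, h e' he']

theorem measurable_ringingWord {ℓ : ℕ} {Λ : Measure (Hyperplane ℓ)}
    (hΛ : IsHyperplaneMeasure Λ) {W : Set (Space ℓ)} (hW : IsCell W) :
    Measurable fun p : Tree ℓ × (Word → ℝ) => ringingWord Λ W p.1 p.2 := by
  refine measurable_firstWord fun e => ?_
  refine measurableSet_of_countable_index (f := fun p : Tree ℓ × (Word → ℝ) => p.1.1)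
    (T := fun E => {p : Tree ℓ × (Word → ℝ) | e ∈ E ∧ ∀ e' ∈ E,
      (rate Λ W p.1 e)⁻¹ * p.2 e ≤ (rate Λ W p.1 e')⁻¹ * p.2 e'})
    measurable_fst.fst fun E => ?_
  have h1 : ∀ e, Measurable fun p : Tree ℓ × (Word → ℝ) => (rate Λ W p.1 e)⁻¹ * p.2 e :=
    fun e => ((measurable_rate hΛ hW e).comp measurable_fst).inv.mul
      ((measurable_pi_apply e).comp measurable_snd)
  refine (MeasurableSet.const _).inter ?_
  have : MeasurableSet (⋂ e' ∈ E, {p : Tree ℓ × (Word → ℝ) |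
      (rate Λ W p.1 e)⁻¹ * p.2 e ≤ (rate Λ W p.1 e')⁻¹ * p.2 e'}) :=
    Finset.measurableSet_biInter E fun e' _ => measurableSet_le (h1 e) (h1 e')
  simp only [Set.iInter_ofPred] at this
  exact this

theorem measurable_residual {ℓ : ℕ} {Λ : Measure (Hyperplane ℓ)}
    (hΛ : IsHyperplaneMeasure Λ) {W : Set (Space ℓ)} (hW : IsCell W) {α : Type*}
    [MeasurableSpace α] {s : α → Tree ℓ} (hs : Measurable s) {w : α → Word} (hw : Measurable w)
    {z : α → Word → ℝ} (hz : Measurable z) :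
    Measurable fun a => residual Λ W (s a) (w a) (z a) := by
  refine measurable_pi_lambda _ fun e => ?_
  have hr : ∀ e, Measurable fun a => rate Λ W (s a) e := fun e => (measurable_rate hΛ hW e).comp hs
  have hze : ∀ e, Measurable fun a => z a e := fun e => (measurable_pi_apply e).comp hz
  classical
  refine measurable_of_countable_index (f := fun a => ((s a).1, w a)) (hs.fst.prodMk hw)
    (g := fun q a => if e ∈ q.1.erase q.2 then
      z a e - rate Λ W (s a) e * ((rate Λ W (s a) q.2)⁻¹ * z a q.2) else z a e) fun q => ?_
  exact Measurable.ite (MeasurableSet.const _)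
    ((hze e).sub ((hr e).mul ((hr q.2).inv.mul (hze q.2)))) (hze e)

theorem measurableSet_rings_first (E : Finset Word) (r : Word → ℝ) (e : Word) :
    MeasurableSet {z : Word → ℝ | ∀ e' ∈ E.erase e, (r e)⁻¹ * z e ≤ (r e')⁻¹ * z e'} := by
  have : MeasurableSet (⋂ e' ∈ E.erase e, {z : Word → ℝ | (r e)⁻¹ * z e ≤ (r e')⁻¹ * z e'}) :=
    Finset.measurableSet_biInter _ fun e' _ => measurableSet_le (by fun_prop) (by fun_prop)
  convert this using 1
  ext z
  simp

theorem measurable_clockDriver_out {ℓ : ℕ} {Λ : Measure (Hyperplane ℓ)}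
    (hΛ : IsHyperplaneMeasure Λ) {W : Set (Space ℓ)} (hW : IsCell W) :
    Measurable fun p : Tree ℓ × ClockSupply ℓ => (clockDriver Λ W).out p.1 p.2 := by
  have hw : Measurable fun p : Tree ℓ × ClockSupply ℓ => ringingWord Λ W p.1 p.2.1 :=
    (measurable_ringingWord hΛ hW).comp (measurable_fst.prodMk measurable_snd.fst)
  have hA := measurableSet_hit_word hW hw
    (measurable_fst.snd : Measurable fun p : Tree ℓ × ClockSupply ℓ => p.1.2)
  refine hw.prodMk (Measurable.prodMk ?_ (measurable_hitValue hA ?_))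
  · exact measurable_of_countable_index hw
      (g := fun w p => (rate Λ W p.1 w)⁻¹ * p.2.1 w) fun w =>
      ((measurable_rate hΛ hW w).comp measurable_fst).inv.mul
        ((measurable_pi_apply w).comp measurable_snd.fst)
  · exact measurable_of_countable_index hw (g := fun w p => p.2.2 w) fun w =>
      (measurable_pi_apply w).comp measurable_snd.snd

theorem measurable_clockDriver_nxt {ℓ : ℕ} {Λ : Measure (Hyperplane ℓ)}
    (hΛ : IsHyperplaneMeasure Λ) {W : Set (Space ℓ)} (hW : IsCell W) :
    Measurable fun p : Tree ℓ × ClockSupply ℓ => (clockDriver Λ W).nxt p.1 p.2 := by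
  have hw : Measurable fun p : Tree ℓ × ClockSupply ℓ => ringingWord Λ W p.1 p.2.1 :=
    (measurable_ringingWord hΛ hW).comp (measurable_fst.prodMk measurable_snd.fst)
  exact (measurable_residual hΛ hW measurable_fst hw measurable_snd.fst).prodMk measurable_snd.snd

/-- When the clock of `e` rings first, the residual lifetimes of the other leaves are again
independent exponential variables. -/
theorem lintegral_ring_first {ℓ : ℕ} {Λ : Measure (Hyperplane ℓ)}
    (hΛ : IsHyperplaneMeasure Λ) {W : Set (Space ℓ)} (hW : IsCell W) {s : Tree ℓ}
    (hs : IsGoodTree W s) {e : Word} (he : e ∈ s.1) {Ψ : ℝ → (Word → ℝ) → ℝ≥0∞}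
    (hΨ : Measurable fun p : ℝ × (Word → ℝ) => Ψ p.1 p.2)
    (hinv : ∀ t z y, Ψ t (Function.update z e y) = Ψ t z) :
    ∫⁻ z, {z : Word → ℝ | ∀ e' ∈ s.1.erase e,
        (rate Λ W s e)⁻¹ * z e ≤ (rate Λ W s e')⁻¹ * z e'}.indicator
        (fun z => Ψ ((rate Λ W s e)⁻¹ * z e) (residual Λ W s e z)) z
        ∂(Measure.infinitePi fun _ : Word => expMeasure 1) =
      ENNReal.ofReal ((totalRate Λ W s)⁻¹ * rate Λ W s e) *
        ∫⁻ v, ∫⁻ z, Ψ ((totalRate Λ W s)⁻¹ * v) z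
          ∂(Measure.infinitePi fun _ : Word => expMeasure 1) ∂(expMeasure 1) := by
  classical
  set r := rate Λ W s with hr
  set R := totalRate Λ W s with hR
  set P := Measure.infinitePi fun _ : Word => expMeasure 1
  have hre : 0 < r e := hs.rate_pos hΛ hW he
  have hRpos : 0 < R := hs.totalRate_pos hΛ hW
  have hr0 : ∀ e', 0 ≤ r e' := fun e' => ENNReal.toReal_nonneg
  have hset := measurableSet_rings_first s.1 r e
  have hm : Measurable fun z => {z : Word → ℝ | ∀ e' ∈ s.1.erase e,
      (r e)⁻¹ * z e ≤ (r e')⁻¹ * z e'}.indicator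
      (fun z => Ψ ((r e)⁻¹ * z e) (residual Λ W s e z)) z := by
    refine Measurable.indicator ?_ hset
    exact hΨ.comp (Measurable.prodMk (by fun_prop)
      (measurable_residual hΛ hW measurable_const measurable_const measurable_id))
  have hPsi : ∀ t, Measurable (Ψ t) := fun t => hΨ.comp measurable_prodMk_left
  rw [lintegral_infinitePi_update _ e hm]
  -- the integral for a given lifetime `y` of the cell of `e`
  have h1 : ∀ y, 0 ≤ y → ∫⁻ z, {z : Word → ℝ | ∀ e' ∈ s.1.erase e,
      (r e)⁻¹ * z e ≤ (r e')⁻¹ * z e'}.indicator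
      (fun z => Ψ ((r e)⁻¹ * z e) (residual Λ W s e z)) (Function.update z e y) ∂P =
      ENNReal.ofReal (Real.exp (-((R / r e - 1) * y))) * ∫⁻ z, Ψ ((r e)⁻¹ * y) z ∂P := by
    intro y hy
    have hsum : ∑ e' ∈ s.1.erase e, r e' * ((r e)⁻¹ * y) = (R / r e - 1) * y := by
      rw [← Finset.sum_mul, Finset.sum_erase_eq_sub he]
      change (R - r e) * _ = _
      field_simp
    rw [← hsum, ← lintegral_infinitePi_memoryless (s.1.erase e)
      (a := fun e' => r e' * ((r e)⁻¹ * y))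
      (fun e' => mul_nonneg (hr0 e') (mul_nonneg (inv_nonneg.2 hre.le) hy)) (hPsi _)]
    refine lintegral_congr fun z => ?_
    have hmem : Function.update z e y ∈ {z : Word → ℝ | ∀ e' ∈ s.1.erase e,
        (r e)⁻¹ * z e ≤ (r e')⁻¹ * z e'} ↔
        z ∈ {z : Word → ℝ | ∀ e' ∈ s.1.erase e, r e' * ((r e)⁻¹ * y) ≤ z e'} := by
      simp only [Set.mem_ofPred_eq, Function.update_self]
      refine forall₂_congr fun e' he' => ?_
      have hpos : 0 < r e' := hs.rate_pos hΛ hW (Finset.mem_of_mem_erase he')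
      rw [Function.update_of_ne (Finset.ne_of_mem_erase he'), le_inv_mul_iff₀ hpos]
    by_cases hz : z ∈ {z : Word → ℝ | ∀ e' ∈ s.1.erase e, r e' * ((r e)⁻¹ * y) ≤ z e'}
    · rw [Set.indicator_of_mem (hmem.2 hz), Set.indicator_of_mem hz, Function.update_self,
        ← hinv _ (fun e' => if e' ∈ s.1.erase e then z e' - r e' * ((r e)⁻¹ * y) else z e') y]
      congr 1
      funext e'
      by_cases hee : e' = e
      · subst hee; simp [residual]
      · simp [residual, hee, hr]
    · rw [Set.indicator_of_notMem (mt hmem.1 hz), Set.indicator_of_notMem hz]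
  have h2 : Measurable fun y : ℝ => ∫⁻ z, Ψ ((r e)⁻¹ * y) z ∂P := by
    have : Measurable fun p : ℝ × (Word → ℝ) => Ψ ((r e)⁻¹ * p.1) p.2 :=
      hΨ.comp (f := fun p : ℝ × (Word → ℝ) => ((r e)⁻¹ * p.1, p.2)) (by fun_prop)
    exact this.lintegral_prod_right'
  rw [lintegral_congr_ae (ae_nonneg_expMeasure.mono h1),
    lintegral_expMeasure_scale (div_pos hRpos hre) h2, inv_div, div_eq_inv_mul]
  congr 1
  refine lintegral_congr fun v => ?_
  congr 1
  funext z
  congr 1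
  field_simp

theorem isProbabilityMeasure_clockSupplyLaw {ℓ : ℕ} {Λ : Measure (Hyperplane ℓ)}
    (hΛ : IsHyperplaneMeasure Λ) {W : Set (Space ℓ)} (hW : IsCell W) :
    IsProbabilityMeasure (clockSupplyLaw Λ W) := by
  have := isProbabilityMeasure_windowLaw hΛ hW
  unfold clockSupplyLaw
  infer_instance

theorem isProbabilityMeasure_chainSupplyLaw {ℓ : ℕ} {Λ : Measure (Hyperplane ℓ)}
    (hΛ : IsHyperplaneMeasure Λ) {W : Set (Space ℓ)} (hW : IsCell W) :
    IsProbabilityMeasure (chainSupplyLaw Λ W) := by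
  have := isProbabilityMeasure_windowLaw hΛ hW
  unfold chainSupplyLaw
  infer_instance

/-- A word without a leaf above it plays no role below the leaves. -/
theorem agreeBelow_update {ℓ : ℕ} {s : Tree ℓ} {e : Word} (he : ∀ l ∈ s.1, ¬ l <:+ e)
    (z z' : Word → ℝ) (ξ ξ' : Word → ℕ → Hyperplane ℓ) (hz : ∀ e', e' ≠ e → z e' = z' e')
    (hξ : ∀ e', e' ≠ e → ξ e' = ξ' e') : AgreeBelow s (z, ξ) (z', ξ') := by
  rintro e' ⟨l, hl, hle⟩
  have : e' ≠ e := by rintro rfl; exact he l hl hle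
  exact ⟨hz e' this, hξ e' this⟩

theorem IsLeafSet.not_suffix_of_split {E : Finset Word} (hE : IsLeafSet E) {w : Word}
    (hw : w ∈ E) : ∀ l ∈ splitLeaves E w, ¬ l <:+ w := by
  intro l hl hlw
  rcases mem_splitLeaves.1 hl with ⟨b, rfl⟩ | ⟨hne, hlE⟩
  · have := hlw.length_le
    simp at this
  · exact hne (hE.eq_of_suffix _ hlE _ hw hlw)

/-- The first ring of independent clocks: sum over the leaf that rings first, and use the lack of
memory of the other clocks. What the supply holds at the divided word is not used any more. -/
theorem clockDriver_law {ℓ : ℕ} {Λ : Measure (Hyperplane ℓ)}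
    (hΛ : IsHyperplaneMeasure Λ) {W : Set (Space ℓ)} (hW : IsCell W) {s : Tree ℓ}
    (hs : IsGoodTree W s) {F : Division ℓ → ClockSupply ℓ → ℝ≥0∞}
    (hF : Measurable fun p : Division ℓ × ClockSupply ℓ => F p.1 p.2)
    (hinv : ∀ o d d', o.1 ∈ s.1 → AgreeBelow (divide s o) d d' → F o d = F o d') :
    ∫⁻ d, F ((clockDriver Λ W).out s d) ((clockDriver Λ W).nxt s d) ∂(clockSupplyLaw Λ W) =
      ∫⁻ o, ∫⁻ d, F o d ∂(clockSupplyLaw Λ W) ∂(divisionLaw Λ W s) := by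
  have := isProbabilityMeasure_windowLaw hΛ hW
  have := isProbabilityMeasure_clockSupplyLaw hΛ hW
  set PZ := Measure.infinitePi fun _ : Word => expMeasure 1
  set PG := Measure.infinitePi fun _ : ℕ => windowLaw Λ W
  set PX := Measure.infinitePi fun _ : Word => PG
  set Ψ : Word → ℝ → (Word → ℝ) → ℝ≥0∞ := fun e t z =>
    ∫⁻ h, ∫⁻ ξ, F (e, t, h) (z, ξ) ∂PX ∂(cond (windowLaw Λ W) (hit (cell W s.2 e))) with hΨdef
  have hinvZ : ∀ e ∈ s.1, ∀ t h z ξ y, F (e, t, h) (Function.update z e y, ξ) =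
      F (e, t, h) (z, ξ) := fun e he t h z ξ y => hinv _ _ _ he (agreeBelow_update
        (hs.isLeafSet.not_suffix_of_split he) _ _ _ _
        (fun e' he' => Function.update_of_ne he' _ _) fun _ _ => rfl)
  have hinvX : ∀ e ∈ s.1, ∀ t h z ξ y, F (e, t, h) (z, Function.update ξ e y) =
      F (e, t, h) (z, ξ) := fun e he t h z ξ y => hinv _ _ _ he (agreeBelow_update
        (hs.isLeafSet.not_suffix_of_split he) _ _ _ _ (fun _ _ => rfl)
        fun e' he' => Function.update_of_ne he' _ _)
  have hΨm' : ∀ e, Measurable fun p : (ℝ × (Word → ℝ)) × Hyperplane ℓ =>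
      ∫⁻ ξ, F (e, p.1.1, p.2) (p.1.2, ξ) ∂PX := by
    intro e
    have : Measurable fun p : ((ℝ × (Word → ℝ)) × Hyperplane ℓ) × (Word → ℕ → Hyperplane ℓ) =>
        F (e, p.1.1.1, p.1.2) (p.1.1.2, p.2) :=
      hF.comp (f := fun p : ((ℝ × (Word → ℝ)) × Hyperplane ℓ) × (Word → ℕ → Hyperplane ℓ) =>
        ((e, p.1.1.1, p.1.2), (p.1.1.2, p.2))) (by fun_prop)
    exact this.lintegral_prod_right'
  have hΨm : ∀ e, Measurable fun p : ℝ × (Word → ℝ) => Ψ e p.1 p.2 := fun e =>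
    (hΨm' e).lintegral_prod_right'
  -- the streams of hyperplanes
  have hX : ∀ e ∈ s.1, ∀ t z, ∫⁻ ξ, F (e, t, hitValue (hit (cell W s.2 e)) (ξ e)) (z, ξ) ∂PX =
      Ψ e t z := by
    intro e he t z
    have hA := measurableSet_hit (isCompact_cell hW s.2 e)
    have hv : Measurable fun x : ℕ → Hyperplane ℓ => hitValue (hit (cell W s.2 e)) x :=
      measurable_hitValue (A := fun _ => hit (cell W s.2 e)) (measurable_snd hA) measurable_id
    have hm : Measurable fun ξ : Word → ℕ → Hyperplane ℓ =>
        F (e, t, hitValue (hit (cell W s.2 e)) (ξ e)) (z, ξ) :=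
      hF.comp (f := fun ξ : Word → ℕ → Hyperplane ℓ =>
        ((e, t, hitValue (hit (cell W s.2 e)) (ξ e)), (z, ξ))) (by fun_prop)
    rw [lintegral_infinitePi_update PG e hm]
    simp only [Function.update_self, hinvX e he]
    refine lintegral_hitValue (windowLaw Λ W) hA (windowLaw_hit_ne_zero hΛ hW
      (cell_subset W s.2 e) (hs.interior_nonempty e he))
      (f := fun h => ∫⁻ ξ, F (e, t, h) (z, ξ) ∂PX) ?_
    exact (hΨm' e).comp (f := fun h => ((t, z), h)) (by fun_prop)
  have mF : Measurable fun d : ClockSupply ℓ =>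
      F ((clockDriver Λ W).out s d) ((clockDriver Λ W).nxt s d) :=
    hF.comp (((measurable_clockDriver_out hΛ hW).comp measurable_prodMk_left).prodMk
      ((measurable_clockDriver_nxt hΛ hW).comp measurable_prodMk_left))
  rw [clockSupplyLaw, lintegral_prod _ mF.aemeasurable]
  -- almost surely exactly one clock rings first
  have hne : ∀ᵐ z ∂PZ, ∫⁻ ξ, F ((clockDriver Λ W).out s (z, ξ))
      ((clockDriver Λ W).nxt s (z, ξ)) ∂PX =
      ∑ e ∈ s.1, {z : Word → ℝ | ∀ e' ∈ s.1.erase e,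
        (rate Λ W s e)⁻¹ * z e ≤ (rate Λ W s e')⁻¹ * z e'}.indicator
        (fun z => Ψ e ((rate Λ W s e)⁻¹ * z e) (residual Λ W s e z)) z := by
    filter_upwards [ae_clocks_ne (c := fun e => (rate Λ W s e)⁻¹) (A := s.1)
      fun e he => inv_ne_zero (hs.rate_pos hΛ hW he).ne'] with z hz
    obtain ⟨hw, hmin⟩ := ringingWord_spec Λ W hs.isLeafSet.nonempty z
    rw [Finset.sum_eq_single_of_mem _ hw]
    · rw [Set.indicator_of_mem]
      · exact hX _ hw ((rate Λ W s (ringingWord Λ W s z))⁻¹ * z (ringingWord Λ W s z))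
          (residual Λ W s (ringingWord Λ W s z) z)
      · exact fun e' he' => hmin e' (Finset.mem_of_mem_erase he')
    · intro e he hne
      rw [Set.indicator_of_notMem]
      intro h
      exact hz _ hw e he hne.symm (le_antisymm (hmin e he)
        (h _ (Finset.mem_erase.2 ⟨hne.symm, hw⟩)))
  rw [lintegral_congr_ae hne, lintegral_finsetSum]
  · have m3 : Measurable fun o : Division ℓ => ∫⁻ d, F o d ∂(PZ.prod PX) :=
      hF.lintegral_prod_right'
    rw [lintegral_divisionLaw Λ W s m3]
    refine Finset.sum_congr rfl fun e he => ?_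
    rw [lintegral_ring_first hΛ hW hs he (hΨm e)]
    · congr 1
      refine lintegral_congr fun v => ?_
      have hsw : Measurable fun p : (Word → ℝ) × Hyperplane ℓ =>
          ∫⁻ ξ, F (e, (totalRate Λ W s)⁻¹ * v, p.2) (p.1, ξ) ∂PX :=
        (hΨm' e).comp (f := fun p : (Word → ℝ) × Hyperplane ℓ =>
          (((totalRate Λ W s)⁻¹ * v, p.1), p.2)) (by fun_prop)
      rw [hΨdef]
      refine (lintegral_lintegral_swap hsw.aemeasurable).trans ?_
      refine lintegral_congr fun h => ?_
      exact (lintegral_prod (fun d => F (e, (totalRate Λ W s)⁻¹ * v, h) d)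
        (hF.comp measurable_prodMk_left).aemeasurable).symm
    · intro t z y
      simp only [hΨdef, hinvZ e he]
  · intro e _
    refine Measurable.indicator ?_ (measurableSet_rings_first s.1 _ e)
    exact (hΨm e).comp (Measurable.prodMk (by fun_prop)
      (measurable_residual hΛ hW measurable_const measurable_const measurable_id))

/-- Cells with independent lifetimes are divided with the transition law `divisionLaw`. -/
theorem isDriven_clockDriver {ℓ : ℕ} {Λ : Measure (Hyperplane ℓ)}
    (hΛ : IsHyperplaneMeasure Λ) {W : Set (Space ℓ)} (hW : IsCell W) :
    (clockDriver Λ W).IsDriven divide (clockSupplyLaw Λ W) (divisionLaw Λ W)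
      (fun s => IsLeafSet s.1) (IsGoodTree W) (fun s o => o.1 ∈ s.1) (IsValidDivision W)
      AgreeBelow := by
  have hw : ∀ s : Tree ℓ, ∀ d d' : ClockSupply ℓ, AgreeBelow s d d' →
      ringingWord Λ W s d.1 = ringingWord Λ W s d'.1 := fun s d d' h =>
    ringingWord_congr Λ W fun e he => (h e ⟨e, he, List.suffix_rfl⟩).1
  have hmem : ∀ s : Tree ℓ, IsLeafSet s.1 → ∀ d : ClockSupply ℓ, ringingWord Λ W s d.1 ∈ s.1 :=
    fun s hs d => (ringingWord_spec Λ W hs.nonempty d.1).1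
  refine ⟨measurable_clockDriver_out hΛ hW, measurable_clockDriver_nxt hΛ hW,
    fun s hs => hs.isLeafSet, fun s o hs ho => hs.split ho, fun s d hs => hmem s hs d, ?_, ?_,
    fun s hs F hF hinv => clockDriver_law hΛ hW hs hF hinv, fun s o hs ho => hs.divide ho,
    fun s hs => ae_divisionLaw hΛ hW hs⟩
  · intro s d d' hs h
    have hl := h _ ⟨_, hmem s hs d, List.suffix_rfl⟩
    simp only [clockDriver, ← hw s d d' h, hl.1, hl.2]
  · rintro s d d' hs h e ⟨l, hl, hle⟩
    have hl0 : ∃ l ∈ s.1, l <:+ e := by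
      rcases mem_splitLeaves.1 hl with ⟨b, rfl⟩ | ⟨-, hlE⟩
      · exact ⟨_, hmem s hs d, (List.suffix_cons _ _).trans hle⟩
      · exact ⟨l, hlE, hle⟩
    have hl := h _ ⟨_, hmem s hs d, List.suffix_rfl⟩
    refine ⟨?_, (h e hl0).2⟩
    simp only [clockDriver, residual, ← hw s d d' h, hl.1, (h e hl0).1]

/-! ### The hyperplanes of the words, chosen in the order of the words -/

/-- The number of words that are already treated, and their hyperplanes. -/
abbrev Partial (ℓ : ℕ) : Type := ℕ × (Word → Hyperplane ℓ)

/-- The next word in the order of the words receives its hyperplane. -/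
def assign {ℓ : ℕ} (s : Partial ℓ) (h : Hyperplane ℓ) : Partial ℓ :=
  (s.1 + 1, Function.update s.2 (unrank s.1) h)

/-- The hyperplanes that hit the cell of the next word. -/
def nextHit {ℓ : ℕ} (W : Set (Space ℓ)) (s : Partial ℓ) : Set (Hyperplane ℓ) :=
  hit (cell W s.2 (unrank s.1))

/-- The cells whose bounding hyperplanes are already chosen have nonempty interior. -/
def IsGoodPartial {ℓ : ℕ} (W : Set (Space ℓ)) (s : Partial ℓ) : Prop :=
  ∀ e : Word, (∀ b e', e = b :: e' → Word.rank e' < s.1) → (interior (cell W s.2 e)).Nonempty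

/-- The hyperplane divides the cell of the next word. -/
def IsValidAssignment {ℓ : ℕ} (W : Set (Space ℓ)) (s : Partial ℓ) (h : Hyperplane ℓ) : Prop :=
  h ∈ nextHit W s ∧ ∀ b, (interior (cell W s.2 (unrank s.1) ∩ halfSpace h b)).Nonempty

/-- All hyperplanes are taken from a single stream. -/
noncomputable def singleStreamDriver {ℓ : ℕ} (W : Set (Space ℓ)) :
    Driver (Partial ℓ) (Hyperplane ℓ) (ℕ → Hyperplane ℓ) where
  out s G := hitValue (nextHit W s) G
  nxt s G := hitTail (nextHit W s) G

/-- Each word has its own stream of hyperplanes. -/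
noncomputable def wordStreamDriver {ℓ : ℕ} (W : Set (Space ℓ)) :
    Driver (Partial ℓ) (Hyperplane ℓ) (Word → ℕ → Hyperplane ℓ) where
  out s ξ := hitValue (nextHit W s) (ξ (unrank s.1))
  nxt _ ξ := ξ

theorem IsGoodPartial.interior_next {ℓ : ℕ} {W : Set (Space ℓ)} {s : Partial ℓ}
    (hs : IsGoodPartial W s) : (interior (cell W s.2 (unrank s.1))).Nonempty := by
  refine hs _ fun b e' he => ?_
  have h := rank_cons b e'
  rw [← he, rank_unrank] at h
  omega

theorem IsGoodPartial.assign {ℓ : ℕ} {W : Set (Space ℓ)} {s : Partial ℓ} {h : Hyperplane ℓ}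
    (hs : IsGoodPartial W s) (hh : IsValidAssignment W s h) : IsGoodPartial W (assign s h) := by
  intro e he
  cases e with
  | nil =>
    have := hs [] (by simp)
    simpa [cell] using this
  | cons b e =>
    have hlt : Word.rank e < s.1 + 1 := he b e rfl
    rcases Nat.lt_succ_iff_lt_or_eq.1 hlt with h1 | h1
    · have e1 : cell W (STIT.assign s h).2 (b :: e) = cell W s.2 (b :: e) := by
        refine cell_congr_suffix W fun e' he' hne => Function.update_of_ne ?_ _ _
        rintro rfl
        rcases List.suffix_cons_iff.1 he' with h2 | h2
        · exact hne h2
        · have h3 : Word.rank (unrank s.1) ≤ Word.rank e := by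
            by_cases h4 : unrank s.1 = e
            · rw [h4]
            · exact (rank_lt_of_suffix h2 h4).le
          rw [rank_unrank] at h3
          omega
      rw [e1]
      refine hs _ fun b' e' he' => ?_
      obtain ⟨rfl, rfl⟩ := List.cons.inj he'
      exact h1
    · have h2 : e = unrank s.1 := by rw [← h1, unrank_rank]
      subst h2
      rw [STIT.assign, cell_update_cons]
      exact hh.2 b

theorem isGoodPartial_zero {ℓ : ℕ} {W : Set (Space ℓ)} (hW : IsCell W) (H : Word → Hyperplane ℓ) :
    IsGoodPartial W (0, H) := by
  intro e he
  cases e with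
  | nil => exact hW.2
  | cons b e => exact absurd (he b e rfl) (Nat.not_lt_zero _)

theorem measurable_assign {ℓ : ℕ} :
    Measurable fun p : Partial ℓ × Hyperplane ℓ => assign p.1 p.2 := by
  refine Measurable.prodMk ?_ ?_
  · exact (measurable_of_countable (· + 1)).comp measurable_fst.fst
  · exact measurable_of_countable_index (f := fun p : Partial ℓ × Hyperplane ℓ => p.1.1)
      (g := fun k p => Function.update p.1.2 (unrank k) p.2) measurable_fst.fst fun k =>
      (measurable_update_family _).comp (measurable_fst.snd.prodMk measurable_snd)

theorem measurableSet_nextHit {ℓ : ℕ} {W : Set (Space ℓ)} (hW : IsCell W) {α : Type*}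
    [MeasurableSpace α] {s : α → Partial ℓ} (hs : Measurable s) :
    MeasurableSet {p : α × Hyperplane ℓ | p.2 ∈ nextHit W (s p.1)} :=
  measurableSet_hit_word hW ((measurable_of_countable unrank).comp hs.fst) hs.snd

theorem measurableSet_isValidAssignment {ℓ : ℕ} {W : Set (Space ℓ)} (hW : IsCell W) :
    MeasurableSet {p : Partial ℓ × Hyperplane ℓ | IsValidAssignment W p.1 p.2} := by
  have h1 : Measurable fun p : Partial ℓ × Hyperplane ℓ =>
      (((∅ : Finset Word), p.1.2), (unrank p.1.1, (0 : ℝ), p.2)) :=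
    (measurable_const.prodMk measurable_fst.snd).prodMk
      (((measurable_of_countable unrank).comp measurable_fst.fst).prodMk
        (measurable_const.prodMk measurable_snd))
  have h2 := h1 ((MeasurableSet.iInter (measurableSet_cut W)))
  convert (measurableSet_nextHit hW measurable_id).inter h2 using 1
  ext p
  simp [IsValidAssignment]

/-- The law of the hyperplane of the next word. -/
noncomputable def assignmentLaw {ℓ : ℕ} (Λ : Measure (Hyperplane ℓ)) (W : Set (Space ℓ))
    (s : Partial ℓ) : Measure (Hyperplane ℓ) :=
  cond (windowLaw Λ W) (nextHit W s)

/-- With a single stream, the hyperplane of each word is independent of the earlier ones up to the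
location of the cell, because rejection sampling restarts the stream. -/
theorem isDriven_singleStreamDriver {ℓ : ℕ} {Λ : Measure (Hyperplane ℓ)}
    (hΛ : IsHyperplaneMeasure Λ) {W : Set (Space ℓ)} (hW : IsCell W) :
    (singleStreamDriver W).IsDriven assign (Measure.infinitePi fun _ : ℕ => windowLaw Λ W)
      (assignmentLaw Λ W) (fun _ => True) (IsGoodPartial W) (fun _ _ => True)
      (IsValidAssignment W) (fun _ d d' => d = d') := by
  have := isProbabilityMeasure_windowLaw hΛ hW
  have hA := measurableSet_nextHit hW
    (measurable_fst : Measurable fun p : Partial ℓ × (ℕ → Hyperplane ℓ) => p.1)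
  refine ⟨measurable_hitValue hA measurable_snd, measurable_hitTail hA measurable_snd,
    fun _ _ => trivial, fun _ _ _ _ => trivial, fun _ _ _ => trivial, ?_, ?_, ?_,
    fun s h hs hh => hs.assign hh, fun s hs => ae_cond_hit hΛ hW hs.interior_next⟩
  · rintro s d _ - rfl; rfl
  · rintro s d _ - rfl; rfl
  · intro s hs F hF _
    exact lintegral_hit (windowLaw Λ W) (measurableSet_hit (isCompact_cell hW _ _))
      (windowLaw_hit_ne_zero hΛ hW (cell_subset W _ _) hs.interior_next)
      (f := fun q => F q.1 q.2) hF

/-- With a stream for each word, only the streams of the words that are not yet treated matter. -/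
theorem isDriven_wordStreamDriver {ℓ : ℕ} {Λ : Measure (Hyperplane ℓ)}
    (hΛ : IsHyperplaneMeasure Λ) {W : Set (Space ℓ)} (hW : IsCell W) :
    (wordStreamDriver W).IsDriven assign
      (Measure.infinitePi fun _ : Word => Measure.infinitePi fun _ : ℕ => windowLaw Λ W)
      (assignmentLaw Λ W) (fun _ => True) (IsGoodPartial W) (fun _ _ => True)
      (IsValidAssignment W) (fun s d d' => ∀ e, s.1 ≤ Word.rank e → d e = d' e) := by
  have := isProbabilityMeasure_windowLaw hΛ hW
  have hA := measurableSet_nextHit hW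
    (measurable_fst : Measurable fun p : Partial ℓ × (Word → ℕ → Hyperplane ℓ) => p.1)
  refine ⟨measurable_hitValue hA ?_, measurable_snd,
    fun _ _ => trivial, fun _ _ _ _ => trivial, fun _ _ _ => trivial, ?_, ?_, ?_,
    fun s h hs hh => hs.assign hh, fun s hs => ae_cond_hit hΛ hW hs.interior_next⟩
  · exact measurable_of_countable_index
      (f := fun p : Partial ℓ × (Word → ℕ → Hyperplane ℓ) => p.1.1)
      (g := fun k p => p.2 (unrank k)) measurable_fst.fst fun k =>
      (measurable_pi_apply _).comp measurable_snd
  · rintro s d d' - h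
    simp only [wordStreamDriver]
    rw [h _ (by rw [rank_unrank])]
  · rintro s d d' - h e he
    exact h e ((Nat.le_succ _).trans he)
  · intro s hs F hF hinv
    set PG := Measure.infinitePi fun _ : ℕ => windowLaw Λ W
    set PX := Measure.infinitePi fun _ : Word => PG
    have hB : MeasurableSet (nextHit W s) := measurableSet_hit (isCompact_cell hW _ _)
    have hv : Measurable fun x : ℕ → Hyperplane ℓ => hitValue (nextHit W s) x :=
      measurable_hitValue (A := fun _ => nextHit W s) (measurable_snd hB) measurable_id
    have hm : Measurable fun ξ : Word → ℕ → Hyperplane ℓ =>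
        F (hitValue (nextHit W s) (ξ (unrank s.1))) ξ :=
      hF.comp (f := fun ξ : Word → ℕ → Hyperplane ℓ =>
        (hitValue (nextHit W s) (ξ (unrank s.1)), ξ)) (by fun_prop)
    have hupd : ∀ h ξ y, F h (Function.update ξ (unrank s.1) y) = F h ξ := by
      intro h ξ y
      refine hinv _ _ _ trivial fun e he => Function.update_of_ne ?_ _ _
      rintro rfl
      rw [rank_unrank] at he
      exact Nat.not_succ_le_self _ he
    refine (lintegral_infinitePi_update PG (unrank s.1) hm).trans ?_
    simp only [Function.update_self, hupd]
    exact lintegral_hitValue (windowLaw Λ W) hB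
      (windowLaw_hit_ne_zero hΛ hW (cell_subset W _ _) hs.interior_next)
      (f := fun h => ∫⁻ ξ, F h ξ ∂PX) hF.lintegral_prod_right'

/-- The family of hyperplanes that is obtained from a sequence in the order of the words. -/
def ofSeq {ℓ : ℕ} (x : ℕ → Hyperplane ℓ) : Word → Hyperplane ℓ := fun e => x (Word.rank e)

theorem measurable_ofSeq {ℓ : ℕ} : Measurable (ofSeq (ℓ := ℓ)) :=
  measurable_pi_lambda _ fun _ => measurable_pi_apply _

theorem stateAt_assign_fst {ℓ : ℕ} (H : Word → Hyperplane ℓ) (x : ℕ → Hyperplane ℓ) (n : ℕ) :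
    (stateAt assign (0, H) x n).1 = n := by
  induction n with
  | zero => rfl
  | succ n ih => rw [stateAt, assign, ih]

theorem stateAt_assign_snd {ℓ : ℕ} (H : Word → Hyperplane ℓ) (x : ℕ → Hyperplane ℓ) (n : ℕ)
    (e : Word) (he : Word.rank e < n) : (stateAt assign (0, H) x n).2 e = x (Word.rank e) := by
  induction n with
  | zero => exact absurd he (Nat.not_lt_zero _)
  | succ n ih =>
    rw [stateAt, assign, stateAt_assign_fst]
    dsimp only
    rcases Nat.lt_succ_iff_lt_or_eq.1 he with h | h
    · rw [Function.update_of_ne, ih h]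
      rintro rfl
      rw [rank_unrank] at h
      exact lt_irrefl _ h
    · rw [← h, unrank_rank, Function.update_self]

theorem nextHit_stateAt {ℓ : ℕ} (W : Set (Space ℓ)) (H : Word → Hyperplane ℓ)
    (x : ℕ → Hyperplane ℓ) (n : ℕ) :
    nextHit W (stateAt assign (0, H) x n) = hit (cell W (ofSeq x) (unrank n)) := by
  rw [nextHit, stateAt_assign_fst]
  congr 1
  refine cell_congr_suffix W fun e' he' hne => ?_
  have := rank_lt_of_suffix he' hne
  rw [rank_unrank] at this
  exact stateAt_assign_snd H x n e' this

/-- The hyperplanes of the words when each word has its own stream. -/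
noncomputable def wordHyperplanes {ℓ : ℕ} (W : Set (Space ℓ)) (H : Word → Hyperplane ℓ)
    (ξ : Word → ℕ → Hyperplane ℓ) : Word → Hyperplane ℓ :=
  ofSeq ((wordStreamDriver W).outputs assign (0, H) ξ)

/-- The hyperplane of a word is the first one of its own stream that hits its cell. -/
theorem wordHyperplanes_eq {ℓ : ℕ} (W : Set (Space ℓ)) (H : Word → Hyperplane ℓ)
    (ξ : Word → ℕ → Hyperplane ℓ) (e : Word) :
    wordHyperplanes W H ξ e = hitValue (hit (cell W (wordHyperplanes W H ξ) e)) (ξ e) := by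
  have hsup : ∀ n, (wordStreamDriver W).supply assign (0, H) ξ n = ξ := by
    intro n
    induction n with
    | zero => rfl
    | succ n ih => rw [Driver.supply_succ, ih]; rfl
  conv_lhs => rw [wordHyperplanes, ofSeq, Driver.outputs_eq, hsup]
  simp only [wordStreamDriver]
  rw [stateAt_assign_fst, unrank_rank]
  congr 1
  exact (nextHit_stateAt W H _ _).trans (by rw [unrank_rank]; rfl)

theorem sInf_lt_and {p : ℕ → Prop} {c : ℕ} (h : ∃ j, p (c + 1 + j)) :
    sInf {m | c < m ∧ p m} = c + 1 + sInf {j | p (c + 1 + j)} := by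
  have h1 : p (c + 1 + sInf {j | p (c + 1 + j)}) := Nat.sInf_mem (s := {j | p (c + 1 + j)}) h
  refine le_antisymm (Nat.sInf_le ⟨by omega, h1⟩) ?_
  obtain ⟨h2, h3⟩ : c < sInf {m | c < m ∧ p m} ∧ p (sInf {m | c < m ∧ p m}) :=
    Nat.sInf_mem (s := {m | c < m ∧ p m}) ⟨_, by omega, h1⟩
  obtain ⟨j, hj⟩ := Nat.exists_eq_add_of_le (Nat.succ_le_of_lt h2)
  have h4 : sInf {j | p (c + 1 + j)} ≤ j := Nat.sInf_le (by
    change p (c + 1 + j)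
    rw [hj] at h3
    exact h3)
  omega

/-- The hyperplanes of the words in the construction of the STIT process are those that are
obtained from a single stream. -/
theorem hyperplane_kappa_eq {ℓ : ℕ} (W : Set (Space ℓ)) (H : Word → Hyperplane ℓ)
    (G : ℕ → Hyperplane ℓ) (h1 : G 1 ∈ hit W)
    (hvalid : ∀ n, (singleStreamDriver W).outputs assign (0, H) (fun k => G (k + 1)) n ∈
      nextHit W (stateAt assign (0, H)
        ((singleStreamDriver W).outputs assign (0, H) (fun k => G (k + 1))) n)) (e : Word) :
    G (kappa W G e) =
      ofSeq ((singleStreamDriver W).outputs assign (0, H) (fun k => G (k + 1))) e := by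
  set x := (singleStreamDriver W).outputs assign (0, H) (fun k => G (k + 1)) with hx
  set A : ℕ → Set (Hyperplane ℓ) := fun n => hit (cell W (ofSeq x) (unrank n)) with hA
  -- the index of the last hyperplane that was used for the first `n` words
  let c : ℕ → ℕ := fun n => n.rec 0 fun n c => c + 1 + firstHit (A n) (fun j => G (c + 1 + j))
  have hc0 : c 0 = 0 := rfl
  have hc : ∀ n, c (n + 1) = c n + 1 + firstHit (A n) (fun j => G (c n + 1 + j)) := fun n => rfl
  have hmono : StrictMono c := strictMono_nat_of_lt_succ fun n => by rw [hc]; omega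
  have hsup : ∀ n, (singleStreamDriver W).supply assign (0, H) (fun k => G (k + 1)) n =
      fun j => G (c n + 1 + j) := by
    intro n
    induction n with
    | zero =>
      funext j
      change G (j + 1) = G (c 0 + 1 + j)
      rw [hc0]
      congr 1
      omega
    | succ n ih =>
      rw [Driver.supply_succ, ih]
      simp only [singleStreamDriver]
      rw [nextHit_stateAt]
      funext j
      change G (c n + 1 + (firstHit (A n) (fun j => G (c n + 1 + j)) + 1 + j)) = _
      rw [hc]
      congr 1
      omega
  have hxn : ∀ n, x n = hitValue (A n) (fun j => G (c n + 1 + j)) := by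
    intro n
    have h := Driver.outputs_eq (singleStreamDriver W) assign (0, H) (fun k => G (k + 1)) n
    rw [hsup, ← hx] at h
    refine h.trans ?_
    have hout : ∀ s d, (singleStreamDriver W).out s d = hitValue (nextHit W s) d :=
      fun _ _ => rfl
    rw [hout, nextHit_stateAt]
  have hxc : ∀ n, x n = G (c (n + 1)) := fun n => by rw [hxn, hc]; rfl
  have hex : ∀ n, ∃ j, G (c n + 1 + j) ∈ A n := by
    intro n
    have := hvalid n
    rw [nextHit_stateAt] at this
    refine exists_of_hitValue_mem (G := fun j => G (c n + 1 + j)) (A := A n) ?_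
    rw [← hxn]
    exact this
  have key : ∀ n, kappa W G (unrank n) = c (n + 1) := by
    intro n
    induction n using Nat.strong_induction_on with
    | _ n ih =>
      rcases Nat.eq_zero_or_pos n with rfl | hn
      · have h0 : firstHit (A 0) (fun j => G (c 0 + 1 + j)) = 0 := by
          refine Nat.sInf_eq_zero.2 (Or.inl ?_)
          have : unrank 0 = [] := by simp [unrank]
          simpa [hA, this, hc0, cell] using h1
        rw [hc, h0, hc0, show unrank 0 = [] by simp [unrank], kappa_nil]
      · have hne : unrank n ≠ [] := by
          intro h
          have h2 := rank_unrank n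
          rw [h] at h2
          simp [Word.rank] at h2
          omega
        have hcell : cell W (fun e' => G (kappa W G e')) (unrank n) =
            cell W (ofSeq x) (unrank n) := by
          refine cell_congr_suffix W fun e' he' hne => ?_
          have hlt := rank_lt_of_suffix he' hne
          rw [rank_unrank] at hlt
          have := ih _ hlt
          rw [unrank_rank] at this
          rw [this, ofSeq, hxc]
        have hset : {m | (∀ e', Word.Before e' (unrank n) → kappa W G e' < m) ∧
            G m ∈ hit (cell W (fun e' => G (kappa W G e')) (unrank n))} =
            {m | c n < m ∧ G m ∈ A n} := by
          ext m
          simp only [Set.mem_ofPred_eq, hcell]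
          refine and_congr_left fun _ => ⟨fun h => ?_, fun h e' he' => ?_⟩
          · have h2 := ih (n - 1) (by omega)
            rw [Nat.sub_add_cancel hn] at h2
            rw [← h2]
            refine h _ (rank_lt_iff.1 ?_)
            rw [rank_unrank, rank_unrank]
            omega
          · have hlt := rank_lt_iff.2 he'
            rw [rank_unrank] at hlt
            have h2 := ih _ hlt
            rw [unrank_rank] at h2
            rw [h2]
            exact (hmono.monotone hlt).trans_lt h
        rw [kappa_of_ne W G _ hne, hset, sInf_lt_and (hex n), hc]
        rfl
  have := key (Word.rank e)
  rw [unrank_rank] at this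
  rw [this, ofSeq, hxc]

/-! ### The tessellation of a tree -/

/-- The cells of the leaves of a tree. -/
def leafCells {ℓ : ℕ} (W : Set (Space ℓ)) (s : Tree ℓ) : Family W :=
  ⟨{C | ∃ e ∈ s.1, C = cell W s.2 e}⟩

/-- The cells of different leaves have disjoint interiors, and the cells of the leaves cover the
window. -/
structure IsDissection {ℓ : ℕ} (W : Set (Space ℓ)) (s : Tree ℓ) : Prop where
  disjoint : ∀ e ∈ s.1, ∀ e' ∈ s.1, e ≠ e' →
    Disjoint (interior (cell W s.2 e)) (interior (cell W s.2 e'))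
  cover : ⋃ e ∈ s.1, cell W s.2 e = W

theorem isDissection_root {ℓ : ℕ} (W : Set (Space ℓ)) (H : Word → Hyperplane ℓ) :
    IsDissection W ({[]}, H) := by
  refine ⟨fun e he e' he' hne => ?_, by simp [cell]⟩
  rw [Finset.mem_singleton] at he he'
  exact absurd (he.trans he'.symm) hne

theorem IsDissection.divide {ℓ : ℕ} {W : Set (Space ℓ)} {s : Tree ℓ} {o : Division ℓ}
    (hs : IsDissection W s) (hE : IsLeafSet s.1) (ho : o.1 ∈ s.1) :
    IsDissection W (divide s o) := by
  have hchild : ∀ b, cell W (STIT.divide s o).2 (b :: o.1) = cell W s.2 o.1 ∩ halfSpace o.2.2 b :=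
    fun b => cell_update_cons W s.2 o.1 o.2.2 b
  have hold : ∀ e ∈ s.1, cell W (STIT.divide s o).2 e = cell W s.2 e := fun e he =>
    hE.cell_update W s.2 ho he o.2.2
  constructor
  · have key : ∀ b, ∀ e' ∈ s.1, e' ≠ o.1 →
        Disjoint (interior (cell W (STIT.divide s o).2 (b :: o.1)))
          (interior (cell W (STIT.divide s o).2 e')) := by
      intro b e' he' hne
      rw [hchild, hold e' he']
      exact (hs.disjoint _ ho _ he' hne.symm).mono_left (interior_mono Set.inter_subset_left)
    intro e he e' he' hne
    rcases mem_splitLeaves.1 he with ⟨b, rfl⟩ | ⟨h, he⟩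
    · rcases mem_splitLeaves.1 he' with ⟨b', rfl⟩ | ⟨h', he'⟩
      · have hb : b ≠ b' := fun h => hne (by rw [h])
        rw [hchild, hchild, interior_inter, interior_inter, interior_halfSpace,
          interior_halfSpace]
        refine Disjoint.mono Set.inter_subset_right Set.inter_subset_right ?_
        cases b <;> cases b'
        · exact absurd rfl hb
        · exact disjoint_openHalfSpace _
        · exact (disjoint_openHalfSpace _).symm
        · exact absurd rfl hb
      · exact key b e' he' h'
    · rcases mem_splitLeaves.1 he' with ⟨b', rfl⟩ | ⟨h', he'⟩
      · exact (key b' e he h).symm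
      · rw [hold e he, hold e' he']
        exact hs.disjoint e he e' he' hne
  · refine subset_antisymm (Set.iUnion₂_subset fun e _ => cell_subset W _ e) fun x hx => ?_
    rw [← hs.cover] at hx
    obtain ⟨e, he, hxe⟩ := Set.mem_iUnion₂.1 hx
    rw [Set.mem_iUnion₂]
    by_cases h : e = o.1
    · subst h
      have hx' : x ∈ halfSpace o.2.2 false ∪ halfSpace o.2.2 true := by
        rw [halfSpace_union]; trivial
      have : ∃ b, x ∈ halfSpace o.2.2 b := hx'.elim (fun h => ⟨_, h⟩) fun h => ⟨_, h⟩
      obtain ⟨b, hb⟩ := this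
      refine ⟨b :: o.1, mem_splitLeaves.2 (Or.inl ⟨b, rfl⟩), ?_⟩
      rw [hchild]
      exact ⟨hxe, hb⟩
    · refine ⟨e, mem_splitLeaves.2 (Or.inr ⟨h, he⟩), ?_⟩
      rw [hold e he]
      exact hxe

theorem IsGoodTree.isTessellation {ℓ : ℕ} {W : Set (Space ℓ)} (hW : IsCell W) {s : Tree ℓ}
    (hs : IsGoodTree W s) (hd : IsDissection W s) : (leafCells W s).IsTessellation where
  finite := (s.1.finite_toSet.image (cell W s.2)).subset (by
    rintro C ⟨e, he, rfl⟩
    exact ⟨e, he, rfl⟩)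
  isCell := by
    rintro C ⟨e, he, rfl⟩
    exact isCell_cell hW s.2 (hs.interior_nonempty e he)
  disjoint := by
    rintro C ⟨e, he, rfl⟩ D ⟨e', he', rfl⟩ hne
    exact hd.disjoint e he e' he' fun h => hne (by rw [h])
  cover := by
    refine Eq.trans ?_ hd.cover
    ext x
    simp only [leafCells, Set.mem_ofPred_eq, Set.mem_iUnion, exists_prop]
    constructor
    · rintro ⟨C, ⟨e, he, rfl⟩, hx⟩
      exact ⟨e, he, hx⟩
    · rintro ⟨e, he, hx⟩
      exact ⟨_, ⟨e, he, rfl⟩, hx⟩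

/-! ### Sequences of divisions -/

/-- The tree before any division; the hyperplanes are irrelevant. -/
def rootTree {ℓ : ℕ} (H : Word → Hyperplane ℓ) : Tree ℓ := ({[]}, H)

/-- All divisions of the sequence are valid. -/
def IsValidSequence {ℓ : ℕ} (W : Set (Space ℓ)) (H : Word → Hyperplane ℓ) (x : ℕ → Division ℓ) :
    Prop :=
  ∀ n, IsValidDivision W (stateAt divide (rootTree H) x n) (x n)

theorem IsValidSequence.isGoodTree {ℓ : ℕ} {W : Set (Space ℓ)} (hW : IsCell W)
    {H : Word → Hyperplane ℓ} {x : ℕ → Division ℓ} (hx : IsValidSequence W H x) (n : ℕ) :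
    IsGoodTree W (stateAt divide (rootTree H) x n) := by
  induction n with
  | zero => exact isGoodTree_root hW H
  | succ n ih => exact ih.divide (hx n)

theorem IsValidSequence.isDissection {ℓ : ℕ} {W : Set (Space ℓ)} (hW : IsCell W)
    {H : Word → Hyperplane ℓ} {x : ℕ → Division ℓ} (hx : IsValidSequence W H x) (n : ℕ) :
    IsDissection W (stateAt divide (rootTree H) x n) := by
  induction n with
  | zero => exact isDissection_root W H
  | succ n ih => exact ih.divide (hx.isGoodTree hW n).isLeafSet (hx n).mem

/-- The time of the `n`-th division. -/
def divisionTime {ℓ : ℕ} (x : ℕ → Division ℓ) (n : ℕ) : ℝ := ∑ k ∈ Finset.range n, (x k).2.1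

theorem divisionTime_succ {ℓ : ℕ} (x : ℕ → Division ℓ) (n : ℕ) :
    divisionTime x (n + 1) = divisionTime x n + (x n).2.1 := Finset.sum_range_succ _ _

theorem measurable_divisionTime {ℓ : ℕ} (n : ℕ) :
    Measurable fun x : ℕ → Division ℓ => divisionTime x n :=
  Finset.measurable_fun_sum _ fun k _ => (measurable_pi_apply k).snd.fst

theorem IsValidSequence.monotone_divisionTime {ℓ : ℕ} {W : Set (Space ℓ)}
    {H : Word → Hyperplane ℓ} {x : ℕ → Division ℓ} (hx : IsValidSequence W H x) :
    Monotone (divisionTime x) :=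
  monotone_nat_of_le_succ fun n => by
    rw [divisionTime_succ]
    exact le_add_of_nonneg_right (hx n).nonneg

/-- The process of the cells of the leaves, as time goes on. -/
def divisionPath {ℓ : ℕ} (W : Set (Space ℓ)) (H : Word → Hyperplane ℓ) (x : ℕ → Division ℓ)
    (t : ℝ≥0) : Family W :=
  ⟨{C | ∃ n : ℕ, divisionTime x n ≤ t ∧ (t : ℝ) < divisionTime x (n + 1) ∧
    ∃ e ∈ (stateAt divide (rootTree H) x n).1, C = cell W (stateAt divide (rootTree H) x n).2 e}⟩

/-- Every time lies between two successive terms of a sequence that starts at zero and tends to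
infinity. -/
theorem exists_between_of_tendsto {τ : ℕ → ℝ} (h0 : τ 0 = 0) (hτ : Tendsto τ atTop atTop)
    (t : ℝ≥0) : ∃ n, τ n ≤ t ∧ (t : ℝ) < τ (n + 1) := by
  have hex : ∃ n, (t : ℝ) < τ n := (hτ.eventually_gt_atTop (t : ℝ)).exists
  classical
  have hpos : Nat.find hex ≠ 0 := fun h => by
    have := Nat.find_spec hex
    rw [h, h0] at this
    exact absurd this (not_lt.2 t.2)
  obtain ⟨n, hn⟩ := Nat.exists_eq_succ_of_ne_zero hpos
  exact ⟨n, not_lt.1 (Nat.find_min hex (by omega)), by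
    rw [← Nat.succ_eq_add_one, ← hn]
    exact Nat.find_spec hex⟩

theorem IsValidSequence.divisionPath_eq {ℓ : ℕ} {W : Set (Space ℓ)}
    {H : Word → Hyperplane ℓ} {x : ℕ → Division ℓ} (hx : IsValidSequence W H x) {t : ℝ≥0} {n : ℕ}
    (h1 : divisionTime x n ≤ t) (h2 : (t : ℝ) < divisionTime x (n + 1)) :
    divisionPath W H x t = leafCells W (stateAt divide (rootTree H) x n) := by
  ext C
  constructor
  · rintro ⟨m, h3, h4, hC⟩
    have h5 : m < n + 1 := hx.monotone_divisionTime.reflect_lt (h3.trans_lt h2)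
    have h6 : n < m + 1 := hx.monotone_divisionTime.reflect_lt (h1.trans_lt h4)
    obtain rfl : m = n := by omega
    exact hC
  · exact fun hC => ⟨n, h1, h2, hC⟩

theorem IsValidSequence.isTessellation {ℓ : ℕ} {W : Set (Space ℓ)} (hW : IsCell W)
    {H : Word → Hyperplane ℓ} {x : ℕ → Division ℓ} (hx : IsValidSequence W H x)
    (hτ : Tendsto (divisionTime x) atTop atTop) (t : ℝ≥0) :
    (divisionPath W H x t).IsTessellation := by
  obtain ⟨n, h1, h2⟩ := exists_between_of_tendsto (by simp [divisionTime]) hτ t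
  rw [hx.divisionPath_eq h1 h2]
  exact (hx.isGoodTree hW n).isTessellation hW (hx.isDissection hW n)

/-! ### Paths with given lifetimes of the cells -/

/-- The time of birth of a cell, for dividing hyperplanes `H` and normalized lifetimes `Z`. -/
noncomputable def birthTime {ℓ : ℕ} (Λ : Measure (Hyperplane ℓ)) (W : Set (Space ℓ))
    (H : Word → Hyperplane ℓ) (Z : Word → ℝ) : Word → ℝ
  | [] => 0
  | _ :: e => birthTime Λ W H Z e + (mass Λ (cell W H e))⁻¹ * Z e

/-- The process of the cells that are alive, for dividing hyperplanes `H` and normalized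
lifetimes `Z`. -/
noncomputable def lifetimePath {ℓ : ℕ} (Λ : Measure (Hyperplane ℓ)) (W : Set (Space ℓ))
    (H : Word → Hyperplane ℓ) (Z : Word → ℝ) (t : ℝ≥0) : Family W :=
  ⟨{C | ∃ e : Word, birthTime Λ W H Z e ≤ t ∧
    (t : ℝ) < birthTime Λ W H Z e + (mass Λ (cell W H e))⁻¹ * Z e ∧ C = cell W H e}⟩

theorem birth_eq_birthTime {ℓ : ℕ} (Λ : Measure (Hyperplane ℓ)) (W : Set (Space ℓ)) (Z : Word → ℝ)
    (G : ℕ → Hyperplane ℓ) (e : Word) :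
    birth Λ W Z G e = birthTime Λ W (fun e => G (kappa W G e)) Z e := by
  induction e with
  | nil => rfl
  | cons b e ih => rw [birth, birthTime, ih]; rfl

theorem stit_eq_lifetimePath {ℓ : ℕ} (Λ : Measure (Hyperplane ℓ)) (W : Set (Space ℓ))
    (Z : Word → ℝ) (G : ℕ → Hyperplane ℓ) (t : ℝ≥0) :
    stit Λ W Z G t = lifetimePath Λ W (fun e => G (kappa W G e)) Z t := by
  ext C
  simp only [stit, lifetimePath, birth_eq_birthTime]
  rfl

theorem measurable_birthTime {ℓ : ℕ} {Λ : Measure (Hyperplane ℓ)}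
    (hΛ : IsHyperplaneMeasure Λ) {W : Set (Space ℓ)} (hW : IsCell W) (e : Word) :
    Measurable fun p : (Word → Hyperplane ℓ) × (Word → ℝ) => birthTime Λ W p.1 p.2 e := by
  induction e with
  | nil => exact measurable_const
  | cons b e ih =>
    exact ih.add (((measurable_mass_cell hΛ hW.isCompact e).comp measurable_fst).inv.mul
      ((measurable_pi_apply e).comp measurable_snd))

/-! ### Measurability of the paths -/

/-- A family of countably many cells, each of them present on a measurable event. -/
theorem measurable_family {ℓ : ℕ} {W : Set (Space ℓ)} (hW : IsCell W) {α ι : Type*}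
    [MeasurableSpace α] [Countable ι] {p : ι → α → Prop} (hp : ∀ i, MeasurableSet {a | p i a})
    {H : ι → α → Word → Hyperplane ℓ} (hH : ∀ i, Measurable (H i)) (w : ι → Word) :
    Measurable fun a => (⟨{C | ∃ i, p i a ∧ C = cell W (H i a) (w i)}⟩ : Family W) := by
  refine measurable_generateFrom ?_
  rintro S ⟨A, -, hA, rfl⟩
  have : (fun a => (⟨{C | ∃ i, p i a ∧ C = cell W (H i a) (w i)}⟩ : Family W)) ⁻¹'
      {T : Family W | T.boundary ∩ A = ∅} =
      ⋂ i, ({a | p i a} ∩ {a | (frontier (cell W (H i a) (w i)) ∩ A).Nonempty})ᶜ := by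
    ext a
    simp only [Set.mem_preimage, Set.mem_ofPred_eq, Set.mem_iInter, Set.mem_compl_iff,
      Set.mem_inter_iff, not_and, Set.not_nonempty_iff_eq_empty, Family.boundary]
    constructor
    · intro h i hi
      refine Set.subset_empty_iff.1 (h ▸ Set.inter_subset_inter_left _ ?_)
      exact Set.subset_biUnion_of_mem (u := fun C => frontier C)
        (show cell W (H i a) (w i) ∈ {C | ∃ i, p i a ∧ C = cell W (H i a) (w i)} from ⟨i, hi, rfl⟩)
    · intro h
      refine Set.eq_empty_of_forall_notMem ?_
      rintro x ⟨hx, hxA⟩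
      obtain ⟨C, ⟨i, hi, rfl⟩, hxC⟩ := Set.mem_iUnion₂.1 hx
      exact Set.notMem_empty x (h i hi ▸ ⟨hxC, hxA⟩)
  rw [this]
  exact MeasurableSet.iInter fun i =>
    ((hp i).inter (hH i (measurableSet_frontier_cell hW.isCompact.isClosed (w i) hA))).compl

theorem measurable_lifetimePath {ℓ : ℕ} {Λ : Measure (Hyperplane ℓ)}
    (hΛ : IsHyperplaneMeasure Λ) {W : Set (Space ℓ)} (hW : IsCell W) :
    Measurable fun p : (Word → Hyperplane ℓ) × (Word → ℝ) => lifetimePath Λ W p.1 p.2 := by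
  refine measurable_pi_lambda _ fun t => ?_
  have h := measurable_family hW (ι := Word)
    (p := fun e (p : (Word → Hyperplane ℓ) × (Word → ℝ)) => birthTime Λ W p.1 p.2 e ≤ t ∧
      (t : ℝ) < birthTime Λ W p.1 p.2 e + (mass Λ (cell W p.1 e))⁻¹ * p.2 e)
    (fun e => ?_) (fun _ => measurable_fst) id
  · simp only [and_assoc] at h
    exact h
  · exact (measurableSet_le (measurable_birthTime hΛ hW e) measurable_const).inter
      (measurableSet_lt measurable_const (measurable_birthTime hΛ hW (false :: e)))

theorem measurable_divisionPath {ℓ : ℕ} {W : Set (Space ℓ)} (hW : IsCell W)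
    (H : Word → Hyperplane ℓ) : Measurable (divisionPath W H) := by
  refine measurable_pi_lambda _ fun t => ?_
  have hs : ∀ n, Measurable fun x : ℕ → Division ℓ => stateAt divide (rootTree H) x n := fun n =>
    (measurable_stateAt divide measurable_divide n).comp measurable_prodMk_left
  have h := measurable_family hW (ι := ℕ × Word)
    (p := fun i (x : ℕ → Division ℓ) => divisionTime x i.1 ≤ t ∧
      (t : ℝ) < divisionTime x (i.1 + 1) ∧ i.2 ∈ (stateAt divide (rootTree H) x i.1).1)
    (fun i => ?_) (fun i => (hs i.1).snd) Prod.snd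
  · convert h using 2 with x
    ext C
    simp only [divisionPath, Set.mem_ofPred_eq, Prod.exists, and_assoc, ← exists_and_left]
  · refine (measurableSet_le (measurable_divisionTime _) measurable_const).inter
      ((measurableSet_lt measurable_const (measurable_divisionTime _)).inter ?_)
    exact (hs i.1).fst (Set.to_countable {E : Finset Word | i.2 ∈ E}).measurableSet

theorem measurableSet_tendsto_divisionTime {ℓ : ℕ} :
    MeasurableSet {x : ℕ → Division ℓ | Tendsto (divisionTime x) atTop atTop} :=
  measurableSet_tendsto atTop fun n => measurable_divisionTime n

/-! ### The jump times tend to infinity -/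

/-- If the weighted sums `∑ a k / (k + 1)` converge, then the means of `a` tend to zero. -/
theorem tendsto_mean_of_tendsto_sum {a : ℕ → ℝ} {l : ℝ}
    (h : Tendsto (fun n => ∑ k ∈ Finset.range n, ((k : ℝ) + 1)⁻¹ * a k) atTop (𝓝 l)) :
    Tendsto (fun n : ℕ => (∑ k ∈ Finset.range n, a k) / n) atTop (𝓝 0) := by
  set T : ℕ → ℝ := fun n => ∑ k ∈ Finset.range n, ((k : ℝ) + 1)⁻¹ * a k with hT
  -- summation by parts
  have hparts : ∀ n : ℕ, ∑ k ∈ Finset.range n, a k = n * T n - ∑ k ∈ Finset.range n, T k := by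
    intro n
    induction n with
    | zero => simp
    | succ n ih =>
      have h1 : T (n + 1) = T n + ((n : ℝ) + 1)⁻¹ * a n := Finset.sum_range_succ _ _
      have h2 : (n : ℝ) + 1 ≠ 0 := by positivity
      rw [Finset.sum_range_succ, Finset.sum_range_succ, ih, h1]
      push_cast
      field_simp
      ring
  have h1 := h.sub h.cesaro
  rw [sub_self] at h1
  refine h1.congr' ?_
  filter_upwards [eventually_gt_atTop 0] with n hn
  have hn' : (n : ℝ) ≠ 0 := by positivity
  rw [hparts]
  field_simp

/-- The harmonic sums of independent exponential variables diverge, by the law of large numbers. -/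
theorem ae_tendsto_harmonic_sum :
    ∀ᵐ v ∂(Measure.infinitePi fun _ : ℕ => expMeasure 1),
      Tendsto (fun n => ∑ k ∈ Finset.range n, ((k : ℝ) + 1)⁻¹ * v k) atTop atTop := by
  set μ := Measure.infinitePi fun _ : ℕ => expMeasure 1 with hμ
  have hmin : Measurable fun x : ℝ => min x 1 := measurable_id.min measurable_const
  have hmap : ∀ k : ℕ, μ.map (fun v => v k) = expMeasure 1 := fun k =>
    Measure.infinitePi_map_eval (fun _ : ℕ => expMeasure 1) k
  have hnn : ∀ᵐ v ∂μ, ∀ k, 0 ≤ v k := by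
    rw [ae_all_iff]
    intro k
    have := ae_nonneg_expMeasure
    rw [← hmap k] at this
    exact ae_of_ae_map (measurable_pi_apply k).aemeasurable this
  -- truncation makes the variables integrable
  let X : ℕ → (ℕ → ℝ) → ℝ := fun k v => min (v k) 1
  have hXm : ∀ k, Measurable (X k) := fun k => hmin.comp (measurable_pi_apply k)
  have hint : Integrable (X 0) μ := by
    refine Integrable.of_bound (hXm 0).aestronglyMeasurable 1 ?_
    filter_upwards [hnn] with v hv
    rw [Real.norm_eq_abs, abs_of_nonneg (le_min (hv 0) zero_le_one)]
    exact min_le_right _ _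
  have hind : iIndepFun X μ :=
    iIndepFun_infinitePi (P := fun _ : ℕ => expMeasure 1) (X := fun _ x => min x 1) fun _ => hmin
  have hident : ∀ k, IdentDistrib (X k) (X 0) μ μ := fun k =>
    IdentDistrib.comp (f := fun v : ℕ → ℝ => v k) (g := fun v : ℕ → ℝ => v 0)
      ⟨(measurable_pi_apply k).aemeasurable, (measurable_pi_apply 0).aemeasurable,
        (hmap k).trans (hmap 0).symm⟩ hmin
  have hpos : 0 < ∫ v, X 0 v ∂μ := by
    rw [integral_pos_iff_support_of_nonneg_ae
      (hnn.mono fun v hv => le_min (hv 0) zero_le_one) hint]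
    have : ∀ᵐ v ∂μ, v ∈ Function.support (X 0) := by
      have h0 : ∀ᵐ x ∂(expMeasure 1), x ≠ 0 := by
        rw [ae_iff]
        simp
      rw [← hmap 0] at h0
      filter_upwards [hnn, ae_of_ae_map (measurable_pi_apply 0).aemeasurable h0] with v hv hv0
      exact (lt_min (lt_of_le_of_ne (hv 0) (Ne.symm hv0)) one_pos).ne'
    have h1 : μ (Function.support (X 0)) = 1 :=
      (measure_congr (eventuallyEq_univ.2 this)).trans measure_univ
    exact h1.symm ▸ one_pos
  have hslln := strong_law_ae_real X hint (fun i j hij => hind.indepFun hij) hident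
  filter_upwards [hslln, hnn] with v hv hv0
  have hmono : Monotone fun n => ∑ k ∈ Finset.range n, ((k : ℝ) + 1)⁻¹ * X k v :=
    monotone_nat_of_le_succ fun n => by
      rw [Finset.sum_range_succ]
      exact le_add_of_nonneg_right (mul_nonneg (by positivity) (le_min (hv0 n) zero_le_one))
  rcases tendsto_atTop_of_monotone hmono with h | ⟨l, h⟩
  · refine tendsto_atTop_mono (fun n => Finset.sum_le_sum fun k _ => ?_) h
    exact mul_le_mul_of_nonneg_left (min_le_left _ _) (by positivity)
  · exact absurd (tendsto_nhds_unique hv (tendsto_mean_of_tendsto_sum h)) hpos.ne'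

theorem rate_le {ℓ : ℕ} {Λ : Measure (Hyperplane ℓ)}
    (hΛ : IsHyperplaneMeasure Λ) {W : Set (Space ℓ)} (hW : IsCell W) (s : Tree ℓ) (e : Word) :
    rate Λ W s e ≤ mass Λ W :=
  measureReal_mono (hit_mono (cell_subset W s.2 e)) (hΛ.hit_lt_top hW.isCompact.isBounded).ne

theorem IsValidSequence.card_leaves {ℓ : ℕ} {W : Set (Space ℓ)} (hW : IsCell W)
    {H : Word → Hyperplane ℓ} {x : ℕ → Division ℓ} (hx : IsValidSequence W H x) (n : ℕ) :
    (stateAt divide (rootTree H) x n).1.card = n + 1 := by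
  induction n with
  | zero => rfl
  | succ n ih => exact ((hx.isGoodTree hW n).isLeafSet.card_split (hx n).mem).trans (by rw [ih])

theorem chainDriver_supply {ℓ : ℕ} (Λ : Measure (Hyperplane ℓ)) (W : Set (Space ℓ)) (s : Tree ℓ)
    (d : ChainSupply ℓ) (n : ℕ) :
    ((chainDriver Λ W).supply divide s d n).1 = (fun k => d.1 (n + k)) ∧
      ((chainDriver Λ W).supply divide s d n).2.1 = fun k => d.2.1 (n + k) := by
  induction n with
  | zero => simp [Driver.supply]
  | succ n ih =>
    rw [Driver.supply_succ]
    constructor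
    · funext k
      exact (congrFun ih.1 (k + 1)).trans (congrArg d.1 (by omega))
    · funext k
      exact (congrFun ih.2 (k + 1)).trans (congrArg d.2.1 (by omega))

theorem chainDriver_outputs_time {ℓ : ℕ} (Λ : Measure (Hyperplane ℓ)) (W : Set (Space ℓ))
    (s : Tree ℓ) (d : ChainSupply ℓ) (n : ℕ) :
    ((chainDriver Λ W).outputs divide s d n).2.1 =
      (totalRate Λ W (stateAt divide s ((chainDriver Λ W).outputs divide s d) n))⁻¹ *
        d.2.1 n := by
  conv_lhs => rw [Driver.outputs_eq]
  change _ * ((chainDriver Λ W).supply divide s d n).2.1 0 = _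
  rw [(chainDriver_supply Λ W s d n).2]
  rfl

/-- After `n` divisions the total rate is at most `n + 1` times the rate of the window. -/
theorem IsValidSequence.totalRate_le {ℓ : ℕ} {Λ : Measure (Hyperplane ℓ)}
    (hΛ : IsHyperplaneMeasure Λ) {W : Set (Space ℓ)} (hW : IsCell W)
    {H : Word → Hyperplane ℓ} {x : ℕ → Division ℓ} (hx : IsValidSequence W H x) (n : ℕ) :
    totalRate Λ W (stateAt divide (rootTree H) x n) ≤ ((n : ℝ) + 1) * mass Λ W := by
  have := Finset.sum_le_card_nsmul (stateAt divide (rootTree H) x n).1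
    (rate Λ W (stateAt divide (rootTree H) x n)) (mass Λ W) fun e _ => rate_le hΛ hW _ e
  rw [hx.card_leaves hW, nsmul_eq_mul] at this
  exact_mod_cast this

theorem ae_isValidSequence_chain {ℓ : ℕ} {Λ : Measure (Hyperplane ℓ)}
    (hΛ : IsHyperplaneMeasure Λ) {W : Set (Space ℓ)} (hW : IsCell W) (H : Word → Hyperplane ℓ) :
    ∀ᵐ d ∂(chainSupplyLaw Λ W),
      IsValidSequence W H ((chainDriver Λ W).outputs divide (rootTree H) d) := by
  have := isProbabilityMeasure_chainSupplyLaw hΛ hW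
  exact (isDriven_chainDriver hΛ hW).ae_valid_outputs measurable_divide
    (measurableSet_isValidDivision hW) (isGoodTree_root hW H)

theorem ae_tendsto_divisionTime_chain {ℓ : ℕ} {Λ : Measure (Hyperplane ℓ)}
    (hΛ : IsHyperplaneMeasure Λ) {W : Set (Space ℓ)} (hW : IsCell W) (H : Word → Hyperplane ℓ) :
    ∀ᵐ d ∂(chainSupplyLaw Λ W),
      Tendsto (divisionTime ((chainDriver Λ W).outputs divide (rootTree H) d)) atTop atTop := by
  have := isProbabilityMeasure_windowLaw hΛ hW
  have hV : ∀ᵐ d ∂(chainSupplyLaw Λ W),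
      Tendsto (fun n => ∑ k ∈ Finset.range n, ((k : ℝ) + 1)⁻¹ * d.2.1 k) atTop atTop := by
    have h : (chainSupplyLaw Λ W).map (fun d => d.2.1) =
        Measure.infinitePi fun _ : ℕ => expMeasure 1 := by
      change (chainSupplyLaw Λ W).map (Prod.fst ∘ Prod.snd) = _
      rw [← Measure.map_map measurable_fst measurable_snd, chainSupplyLaw, Measure.map_snd_prod,
        measure_univ, one_smul, Measure.map_fst_prod, measure_univ, one_smul]
    have h2 := ae_tendsto_harmonic_sum
    rw [← h] at h2
    exact ae_of_ae_map measurable_snd.fst.aemeasurable h2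
  have hm : 0 < mass Λ W := mass_pos hΛ hW.isCompact.isBounded hW.2
  filter_upwards [hV, ae_isValidSequence_chain hΛ hW H] with d hd hx
  set x := (chainDriver Λ W).outputs divide (rootTree H) d with hxdef
  refine tendsto_atTop_mono (fun n => ?_) (hd.const_mul_atTop (inv_pos.2 hm))
  rw [Finset.mul_sum]
  refine Finset.sum_le_sum fun k _ => ?_
  have hR := (hx.isGoodTree hW k).totalRate_pos hΛ hW
  have ht := chainDriver_outputs_time Λ W (rootTree H) d k
  rw [← hxdef] at ht
  have h0 : 0 ≤ d.2.1 k := by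
    have := (hx k).nonneg
    rw [ht] at this
    exact nonneg_of_mul_nonneg_right this (inv_pos.2 hR)
  rw [ht, ← mul_assoc, ← mul_inv]
  refine mul_le_mul_of_nonneg_right (inv_anti₀ hR ?_) h0
  rw [mul_comm]
  exact hx.totalRate_le hΛ hW k

/-! ### The rejection-based chain and its tree -/

/-- The state of the algorithm carries the same leaves and cells as the tree. -/
structure State.Represents {ℓ : ℕ} (W : Set (Space ℓ)) (c : State ℓ) (s : Tree ℓ) : Prop where
  leaves : c.leaves = s.1
  cell : ∀ e ∈ s.1, c.cell e = STIT.cell W s.2 e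

section
variable {ℓ : ℕ} {Λ : Measure (Hyperplane ℓ)} {W : Set (Space ℓ)} {c : State ℓ} {s : Tree ℓ}

theorem State.Represents.mass_cell (h : c.Represents W s) {e : Word} (he : e ∈ s.1) :
    mass Λ (c.cell e) = rate Λ W s e := by rw [h.cell e he, rate]

theorem State.Represents.zeta (h : c.Represents W s) : c.zeta Λ = totalRate Λ W s := by
  rw [State.zeta, totalRate, h.leaves]
  exact Finset.sum_congr rfl fun e he => h.mass_cell he

theorem State.Represents.left (h : c.Represents W s) (e : Word) :
    c.left Λ e =
      ∑ e' ∈ s.1 with Word.rank e' < Word.rank e, (totalRate Λ W s)⁻¹ * rate Λ W s e' := by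
  rw [State.left, h.leaves, h.zeta]
  refine Finset.sum_congr ?_ fun e' he' => ?_
  · ext e'
    simp [rank_lt_iff]
  · rw [h.mass_cell (Finset.mem_filter.1 he').1]

theorem State.Represents.select (h : c.Represents W s) (hΛ : IsHyperplaneMeasure Λ)
    (hW : IsCell W) (hs : IsGoodTree W s) {u : ℝ} (hu : u ∈ Set.Ico (0 : ℝ) 1) :
    c.select Λ u = selectWord Λ W s u := by
  have hp : ∀ e, (e ∈ c.leaves ∧ c.left Λ e ≤ u ∧
      u < c.left Λ e + (c.zeta Λ)⁻¹ * mass Λ (c.cell e)) ↔ InSlot Λ W s u e := by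
    intro e
    rw [h.leaves, h.left, h.zeta]
    exact and_congr_right fun he => by rw [h.mass_cell he]
  obtain ⟨e, he⟩ := hs.exists_inSlot hΛ hW hu
  rw [hs.selectWord_eq hΛ hW he, State.select]
  refine hs.inSlot_unique hΛ hW ((hp _).1 ?_) he
  exact Classical.epsilon_spec (p := fun e => e ∈ c.leaves ∧ c.left Λ e ≤ u ∧
    u < c.left Λ e + (c.zeta Λ)⁻¹ * mass Λ (c.cell e)) ⟨e, (hp e).2 he⟩

theorem State.Represents.next (h : c.Represents W s) (hΛ : IsHyperplaneMeasure Λ)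
    (hW : IsCell W) (hs : IsGoodTree W s) {u : ℝ} (hu : u ∈ Set.Ico (0 : ℝ) 1)
    (G : ℕ → Hyperplane ℓ) {w : Word} (hw : w ∈ s.1) (hsel : selectWord Λ W s u = w) (t : ℝ) :
    (c.next Λ G u).Represents W (divide s (w, t, G (sInf (c.candidates G w)))) := by
  have hsel' := (h.select hΛ hW hs hu).trans hsel
  have hfalse := hs.isLeafSet.cons_notMem hw (b := false)
  have htrue := hs.isLeafSet.cons_notMem hw (b := true)
  constructor
  · simp only [State.next, hsel', h.leaves, divide, splitLeaves]
  · intro e he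
    simp only [State.next, hsel']
    rcases mem_splitLeaves.1 he with ⟨b, rfl⟩ | ⟨hne, he⟩
    · rw [divide, cell_update_cons]
      cases b
      · rw [Function.update_of_ne (by simp), Function.update_self, h.cell w hw]
      · rw [Function.update_self, h.cell w hw]
    · rw [Function.update_of_ne (ne_of_mem_of_not_mem he htrue),
        Function.update_of_ne (ne_of_mem_of_not_mem he hfalse), h.cell e he, divide,
        hs.isLeafSet.cell_update W s.2 hw he]

end

/-- The randomness that the chain uses, as a supply of the driven recursion: the indices of the
given sequences start at one. -/
def chainSupply {ℓ : ℕ} (U V : ℕ → ℝ) (G : ℕ → Hyperplane ℓ) : ChainSupply ℓ :=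
  (fun k => U (k + 1), fun k => V (k + 1), fun k => G (k + 1))

section
variable {ℓ : ℕ} {Λ : Measure (Hyperplane ℓ)} {W : Set (Space ℓ)} {H : Word → Hyperplane ℓ}
  {U V : ℕ → ℝ} {G : ℕ → Hyperplane ℓ}

/-- Step by step, the chain goes through the trees of the driven recursion, and what is left of
the stream of hyperplanes starts after the index `κ_n`. -/
theorem chain_represents (hΛ : IsHyperplaneMeasure Λ) (hW : IsCell W)
    (hU : ∀ n, U (n + 1) ∈ Set.Ico (0 : ℝ) 1)
    (hx : IsValidSequence W H ((chainDriver Λ W).outputs divide (rootTree H) (chainSupply U V G)))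
    (n : ℕ) :
    (chain Λ W U G n).Represents W (stateAt divide (rootTree H)
      ((chainDriver Λ W).outputs divide (rootTree H) (chainSupply U V G)) n) ∧
    ((chainDriver Λ W).supply divide (rootTree H) (chainSupply U V G) n).2.2 =
      (fun j => G ((chain Λ W U G n).index + 1 + j)) ∧
    ((chain Λ W U G n).candidates G ((chain Λ W U G n).select Λ (U (n + 1)))).Nonempty := by
  set x := (chainDriver Λ W).outputs divide (rootTree H) (chainSupply U V G) with hxdef
  set s := stateAt divide (rootTree H) x with hs
  set c := chain Λ W U G with hc
  -- the data of step `n + 1`, given the first two claims for `n`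
  have hstep : ∀ n, (c n).Represents W (s n) →
      ((chainDriver Λ W).supply divide (rootTree H) (chainSupply U V G) n).2.2 =
        (fun j => G ((c n).index + 1 + j)) →
      (x n).1 = selectWord Λ W (s n) (U (n + 1)) ∧
      (c n).select Λ (U (n + 1)) = (x n).1 ∧
      (x n).2.2 = hitValue (hit (cell W (s n).2 (x n).1)) (fun j => G ((c n).index + 1 + j)) ∧
      (∃ j, G ((c n).index + 1 + j) ∈ hit (cell W (s n).2 (x n).1)) ∧
      (c n).candidates G (x n).1 =
        {j | (c n).index < j ∧ G j ∈ hit (cell W (s n).2 (x n).1)} := by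
    intro n h1 h2
    have hd := (chainDriver_supply Λ W (rootTree H) (chainSupply U V G) n).1
    have hout := Driver.outputs_eq (chainDriver Λ W) divide (rootTree H) (chainSupply U V G) n
    rw [← hxdef, ← hs] at hout
    have hw : (x n).1 = selectWord Λ W (s n) (U (n + 1)) := by
      rw [hout]
      change selectWord Λ W (s n) (((chainDriver Λ W).supply divide (rootTree H)
        (chainSupply U V G) n).1 0) = _
      rw [hd]
      rfl
    have hv : (x n).2.2 =
        hitValue (hit (cell W (s n).2 (x n).1)) (fun j => G ((c n).index + 1 + j)) := by
      rw [← h2, hout]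
      rfl
    have hhit := (hx n).hits
    rw [← hs] at hhit
    refine ⟨hw, (h1.select hΛ hW (hx.isGoodTree hW n) (hU n)).trans hw.symm, hv, ?_, ?_⟩
    · rw [hv] at hhit
      exact exists_of_hitValue_mem (G := fun j => G ((c n).index + 1 + j)) hhit
    · rw [State.candidates, h1.cell _ (hx n).mem]
  have hboth : ∀ n, (c n).Represents W (s n) ∧
      ((chainDriver Λ W).supply divide (rootTree H) (chainSupply U V G) n).2.2 =
        (fun j => G ((c n).index + 1 + j)) := by
    intro n
    induction n with
    | zero =>
      refine ⟨⟨rfl, fun e he => ?_⟩, ?_⟩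
      · rw [Finset.mem_singleton.1 he]
        rfl
      · funext j
        exact congrArg G (by simp [hc, chain]; omega)
    | succ n ih =>
      obtain ⟨h1, h2⟩ := ih
      obtain ⟨hw, hsel, hv, hex, hcand⟩ := hstep n h1 h2
      have hinf : sInf ((c n).candidates G (x n).1) = (c n).index + 1 +
          firstHit (hit (cell W (s n).2 (x n).1)) (fun j => G ((c n).index + 1 + j)) := by
        rw [hcand]
        exact sInf_lt_and hex
      constructor
      · have h3 := h1.next hΛ hW (hx.isGoodTree hW n) (hU n) G (hx n).mem hw.symm (x n).2.1
        have h4 : (x n).2.2 = G (sInf ((c n).candidates G (x n).1)) := by rw [hv, hinf]; rfl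
        rw [← h4] at h3
        exact h3
      · rw [Driver.supply_succ]
        have h3 : (c (n + 1)).index = sInf ((c n).candidates G (x n).1) := by
          rw [← hsel]; rfl
        rw [h3, hinf]
        have h4 : ((chainDriver Λ W).nxt (s n) ((chainDriver Λ W).supply divide (rootTree H)
            (chainSupply U V G) n)).2.2 = hitTail (hit (cell W (s n).2 (x n).1))
            (fun j => G ((c n).index + 1 + j)) := by
          have h5 : (x n).1 = selectWord Λ W (s n) (((chainDriver Λ W).supply divide (rootTree H)
              (chainSupply U V G) n).1 0) :=
            congrArg Prod.fst (Driver.outputs_eq (chainDriver Λ W) divide (rootTree H) _ n)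
          rw [← h2, h5]
          rfl
        refine h4.trans ?_
        funext j
        exact congrArg G (by omega)
  obtain ⟨h1, h2⟩ := hboth n
  obtain ⟨hw, hsel, hv, ⟨j, hj⟩, hcand⟩ := hstep n h1 h2
  refine ⟨h1, h2, ?_⟩
  rw [hsel, hcand]
  exact ⟨_, by omega, hj⟩

theorem jumpTime_eq_divisionTime (hΛ : IsHyperplaneMeasure Λ) (hW : IsCell W)
    (hU : ∀ n, U (n + 1) ∈ Set.Ico (0 : ℝ) 1)
    (hx : IsValidSequence W H
      ((chainDriver Λ W).outputs divide (rootTree H) (chainSupply U V G))) :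
    jumpTime Λ W U V G = divisionTime
      ((chainDriver Λ W).outputs divide (rootTree H) (chainSupply U V G)) := by
  funext n
  refine Finset.sum_congr rfl fun k _ => ?_
  rw [chainDriver_outputs_time, (chain_represents hΛ hW hU hx k).1.zeta]
  rfl

theorem rejectionProcess_eq_divisionPath (hΛ : IsHyperplaneMeasure Λ) (hW : IsCell W)
    (hU : ∀ n, U (n + 1) ∈ Set.Ico (0 : ℝ) 1)
    (hx : IsValidSequence W H
      ((chainDriver Λ W).outputs divide (rootTree H) (chainSupply U V G))) :
    rejectionProcess Λ W U V G = divisionPath W H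
      ((chainDriver Λ W).outputs divide (rootTree H) (chainSupply U V G)) := by
  funext t
  ext C
  simp only [rejectionProcess, divisionPath, jumpTime_eq_divisionTime hΛ hW hU hx,
    Set.mem_ofPred_eq]
  refine exists_congr fun n => and_congr_right fun _ => and_congr_right fun _ => ?_
  have h := (chain_represents hΛ hW hU hx n).1
  rw [h.leaves]
  exact exists_congr fun e => and_congr_right fun he => by rw [h.cell e he]

end

/-! ### The path of independent lifetimes -/

/-- The time of death of a cell, for dividing hyperplanes `H` and normalized lifetimes `Z`. -/
noncomputable def deathTime {ℓ : ℕ} (Λ : Measure (Hyperplane ℓ)) (W : Set (Space ℓ))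
    (H : Word → Hyperplane ℓ) (Z : Word → ℝ) (e : Word) : ℝ :=
  birthTime Λ W H Z e + (mass Λ (cell W H e))⁻¹ * Z e

theorem birthTime_cons {ℓ : ℕ} (Λ : Measure (Hyperplane ℓ)) (W : Set (Space ℓ))
    (H : Word → Hyperplane ℓ) (Z : Word → ℝ) (b : Bool) (e : Word) :
    birthTime Λ W H Z (b :: e) = deathTime Λ W H Z e := rfl

section
variable {ℓ : ℕ} {Λ : Measure (Hyperplane ℓ)} {W : Set (Space ℓ)} {H : Word → Hyperplane ℓ}
  {Z : Word → ℝ}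

theorem birthTime_le_deathTime (hZ : ∀ e, 0 ≤ Z e) (e : Word) :
    birthTime Λ W H Z e ≤ deathTime Λ W H Z e :=
  le_add_of_nonneg_right (mul_nonneg (inv_nonneg.2 measureReal_nonneg) (hZ e))

theorem deathTime_le_birthTime (hZ : ∀ e, 0 ≤ Z e) {e e' : Word} (h : e <:+ e') (hne : e ≠ e') :
    deathTime Λ W H Z e ≤ birthTime Λ W H Z e' := by
  induction e' with
  | nil => exact absurd (List.suffix_nil.1 h) hne
  | cons b e' ih =>
    rw [birthTime_cons]
    rcases List.suffix_cons_iff.1 h with rfl | h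
    · exact absurd rfl hne
    · by_cases he : e = e'
      · rw [he]
      · exact (ih h he).trans (birthTime_le_deathTime hZ e')

end

/-- The state of the recursion by independent lifetimes, in terms of the dividing hyperplanes `K`
and the normalized lifetimes `Z` of all words, at the time `t` of a division: `s` is the tree and
`z` holds the residual lifetimes. -/
structure ClockState {ℓ : ℕ} (Λ : Measure (Hyperplane ℓ)) (W : Set (Space ℓ))
    (K : Word → Hyperplane ℓ) (Z : Word → ℝ) (s : Tree ℓ) (z : Word → ℝ) (t : ℝ) : Prop where
  hyperplane : ∀ e ∈ s.1, ∀ e', e' <:+ e → e' ≠ e → s.2 e' = K e'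
  residual : ∀ e ∈ s.1, (mass Λ (cell W K e))⁻¹ * z e = deathTime Λ W K Z e - t
  born : ∀ e ∈ s.1, birthTime Λ W K Z e ≤ t
  dead : ∀ e ∈ s.1, ∀ e', e' <:+ e → e' ≠ e → deathTime Λ W K Z e' ≤ t
  unborn : ∀ l ∈ s.1, ∀ e, l <:+ e → l ≠ e → z e = Z e

section
variable {ℓ : ℕ} {Λ : Measure (Hyperplane ℓ)} {W : Set (Space ℓ)} {K : Word → Hyperplane ℓ}
  {Z : Word → ℝ} {s : Tree ℓ} {z : Word → ℝ} {t : ℝ}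

theorem clockState_root (H : Word → Hyperplane ℓ) : ClockState Λ W K Z (rootTree H) Z 0 := by
  constructor
  · intro e he e' h hne
    rw [Finset.mem_singleton.1 he] at h hne
    exact absurd (List.suffix_nil.1 h) hne
  · intro e he
    rw [Finset.mem_singleton.1 he, deathTime, birthTime, zero_add, sub_zero]
  · intro e he
    rw [Finset.mem_singleton.1 he, birthTime]
  · intro e he e' h hne
    rw [Finset.mem_singleton.1 he] at h hne
    exact absurd (List.suffix_nil.1 h) hne
  · exact fun _ _ _ _ _ => rfl

theorem ClockState.cell_eq (h : ClockState Λ W K Z s z t) {e : Word} (he : e ∈ s.1) :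
    cell W s.2 e = cell W K e := cell_congr_suffix W (h.hyperplane e he)

theorem ClockState.rate_eq (h : ClockState Λ W K Z s z t) {e : Word} (he : e ∈ s.1) :
    rate Λ W s e = mass Λ (cell W K e) := by rw [rate, h.cell_eq he]

/-- The cell of `w` is divided at its time of death. -/
theorem ClockState.divide (h : ClockState Λ W K Z s z t) (hΛ : IsHyperplaneMeasure Λ)
    (hW : IsCell W) (hs : IsGoodTree W s) {w : Word} (hw : w ∈ s.1)
    (ht : t ≤ deathTime Λ W K Z w) (r : ℝ) :
    ClockState Λ W K Z (divide s (w, r, K w)) (STIT.residual Λ W s w z)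
      (deathTime Λ W K Z w) := by
  have hE := hs.isLeafSet
  constructor
  · intro e he e' h1 hne
    rcases mem_splitLeaves.1 he with ⟨b, rfl⟩ | ⟨hew, he⟩
    · by_cases h2 : e' = w
      · rw [h2]; exact Function.update_self _ _ _
      · refine (Function.update_of_ne h2 _ _).trans (h.hyperplane w hw e' ?_ h2)
        exact (List.suffix_cons_iff.1 h1).resolve_left hne
    · refine (Function.update_of_ne (fun h2 : e' = w => ?_) _ _).trans
        (h.hyperplane e he e' h1 hne)
      exact hew (hE.eq_of_suffix w hw e he (h2 ▸ h1)).symm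
  · intro e he
    rcases mem_splitLeaves.1 he with ⟨b, rfl⟩ | ⟨hew, he⟩
    · rw [STIT.residual, if_neg fun h => hE.cons_notMem hw b (Finset.mem_of_mem_erase h),
        h.unborn w hw _ (List.suffix_cons b w) (cons_ne_self' b).symm, deathTime, birthTime_cons]
      ring
    · have h1 := h.residual e he
      have h2 := h.residual w hw
      have h3 := hs.rate_pos hΛ hW he
      rw [h.rate_eq he] at h3
      rw [STIT.residual, if_pos (Finset.mem_erase.2 ⟨hew, he⟩), h.rate_eq he, h.rate_eq hw, h2,
        mul_sub, h1, ← mul_assoc, inv_mul_cancel₀ h3.ne']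
      ring
  · intro e he
    rcases mem_splitLeaves.1 he with ⟨b, rfl⟩ | ⟨hew, he⟩
    · exact le_of_eq (birthTime_cons _ _ _ _ _ _)
    · exact (h.born e he).trans ht
  · intro e he e' h1 hne
    rcases mem_splitLeaves.1 he with ⟨b, rfl⟩ | ⟨hew, he⟩
    · by_cases h2 : e' = w
      · rw [h2]
      · exact (h.dead w hw e' ((List.suffix_cons_iff.1 h1).resolve_left hne) h2).trans ht
    · exact (h.dead e he e' h1 hne).trans ht
  · intro l hl e h1 hne
    have key : ∀ l ∈ s.1, l <:+ e → l ≠ e → STIT.residual Λ W s w z e = Z e := by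
      intro l hl h1 hne
      rw [STIT.residual, if_neg, h.unborn l hl e h1 hne]
      exact fun he => hne (hE.eq_of_suffix _ hl _ (Finset.mem_of_mem_erase he) h1)
    rcases mem_splitLeaves.1 hl with ⟨b, rfl⟩ | ⟨_, hl⟩
    · refine key w hw ((List.suffix_cons b w).trans h1) ?_
      rintro rfl
      simpa using h1.length_le
    · exact key l hl h1 hne

end

theorem clockDriver_supply_snd {ℓ : ℕ} (Λ : Measure (Hyperplane ℓ)) (W : Set (Space ℓ))
    (s : Tree ℓ) (d : ClockSupply ℓ) (n : ℕ) :
    ((clockDriver Λ W).supply divide s d n).2 = d.2 := by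
  induction n with
  | zero => rfl
  | succ n ih => rw [Driver.supply_succ]; exact ih

section
variable {ℓ : ℕ} {Λ : Measure (Hyperplane ℓ)} {W : Set (Space ℓ)} {H : Word → Hyperplane ℓ}
  {d : ClockSupply ℓ}

/-- The cells of the leaves are alive between two divisions: they are born before the first and do
not die before the second. -/
theorem clockState_stateAt (hΛ : IsHyperplaneMeasure Λ) (hW : IsCell W)
    (hx : IsValidSequence W H ((clockDriver Λ W).outputs divide (rootTree H) d)) (n : ℕ) :
    ClockState Λ W (wordHyperplanes W H d.2) d.1
      (stateAt divide (rootTree H) ((clockDriver Λ W).outputs divide (rootTree H) d) n)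
      ((clockDriver Λ W).supply divide (rootTree H) d n).1
      (divisionTime ((clockDriver Λ W).outputs divide (rootTree H) d) n) ∧
    (∀ e ∈ (stateAt divide (rootTree H) ((clockDriver Λ W).outputs divide (rootTree H) d) n).1,
      divisionTime ((clockDriver Λ W).outputs divide (rootTree H) d) (n + 1) ≤
        deathTime Λ W (wordHyperplanes W H d.2) d.1 e) := by
  set x := (clockDriver Λ W).outputs divide (rootTree H) d with hxdef
  set s := stateAt divide (rootTree H) x with hs
  set z : ℕ → Word → ℝ := fun n => ((clockDriver Λ W).supply divide (rootTree H) d n).1 with hz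
  set K := wordHyperplanes W H d.2 with hK
  have hout : ∀ n, x n = (clockDriver Λ W).out (s n)
      ((clockDriver Λ W).supply divide (rootTree H) d n) := fun n =>
    Driver.outputs_eq (clockDriver Λ W) divide (rootTree H) d n
  have hword : ∀ n, (x n).1 = ringingWord Λ W (s n) (z n) := fun n => congrArg Prod.fst (hout n)
  have htime : ∀ n, (x n).2.1 = (rate Λ W (s n) (x n).1)⁻¹ * z n (x n).1 := fun n => by
    rw [hword, hout]; rfl
  have hplane : ∀ n, (x n).2.2 = hitValue (hit (cell W (s n).2 (x n).1)) (d.2 (x n).1) :=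
    fun n => by
      rw [hword, hout, ← clockDriver_supply_snd Λ W (rootTree H) d n]; rfl
  have hnext : ∀ n, z (n + 1) = residual Λ W (s n) (x n).1 (z n) := fun n => by
    rw [hword]
    exact congrArg Prod.fst (Driver.supply_succ (clockDriver Λ W) divide (rootTree H) d n)
  have hdeath : ∀ n, ClockState Λ W K d.1 (s n) (z n) (divisionTime x n) →
      divisionTime x (n + 1) = deathTime Λ W K d.1 (x n).1 := by
    intro n h
    have h1 := h.residual _ (hx n).mem
    rw [divisionTime_succ, htime, h.rate_eq (hx n).mem, h1]
    ring
  have hinv : ∀ n, ClockState Λ W K d.1 (s n) (z n) (divisionTime x n) := by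
    intro n
    induction n with
    | zero =>
      have h0 : divisionTime x 0 = 0 := by simp [divisionTime]
      rw [h0]
      exact clockState_root H
    | succ n ih =>
      have hw := (hx n).mem
      have h1 : (x n).2.2 = K (x n).1 := by
        rw [hplane, ih.cell_eq hw, hK, ← wordHyperplanes_eq]
      have h2 := ih.divide hΛ hW (hx.isGoodTree hW n) hw (by
        rw [← hdeath n ih]
        exact hx.monotone_divisionTime (Nat.le_succ n)) (x n).2.1
      rw [← h1, ← hdeath n ih, ← hnext] at h2
      exact h2
  refine ⟨hinv n, fun e he => ?_⟩
  have h1 := (ringingWord_spec Λ W (hx.isGoodTree hW n).isLeafSet.nonempty (z n)).2 e he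
  rw [← hword, ← htime, (hinv n).rate_eq he, (hinv n).residual e he] at h1
  rw [divisionTime_succ]
  linarith

/-- The path of the divisions is the path of the lifetimes: between two divisions the leaves are
alive, their proper ancestors are dead, and their proper descendants are not yet born. -/
theorem divisionPath_eq_lifetimePath (hΛ : IsHyperplaneMeasure Λ) (hW : IsCell W)
    (hZ : ∀ e, 0 ≤ d.1 e)
    (hx : IsValidSequence W H ((clockDriver Λ W).outputs divide (rootTree H) d))
    (hτ : Tendsto (divisionTime ((clockDriver Λ W).outputs divide (rootTree H) d)) atTop atTop) :
    divisionPath W H ((clockDriver Λ W).outputs divide (rootTree H) d) =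
      lifetimePath Λ W (wordHyperplanes W H d.2) d.1 := by
  funext t
  obtain ⟨n, h1, h2⟩ := exists_between_of_tendsto (by simp [divisionTime]) hτ t
  rw [hx.divisionPath_eq h1 h2]
  obtain ⟨h, hle⟩ := clockState_stateAt hΛ hW hx n
  ext C
  constructor
  · rintro ⟨e, he, rfl⟩
    exact ⟨e, (h.born e he).trans h1, h2.trans_le (hle e he), h.cell_eq he⟩
  · rintro ⟨e, hb, hd, rfl⟩
    obtain ⟨l, hl, hel⟩ := (hx.isGoodTree hW n).isLeafSet.comparable e
    by_cases hne : e = l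
    · subst hne
      exact ⟨e, hl, (h.cell_eq hl).symm⟩
    · rcases hel with hel | hel
      · exact absurd (hd.trans_le ((h.dead l hl e hel hne).trans h1)) (lt_irrefl _)
      · exact absurd (h2.trans_le ((hle l hl).trans
          ((deathTime_le_birthTime hZ hel (Ne.symm hne)).trans hb))) (lt_irrefl _)

end

/-! ### Comparison of the laws -/

theorem iIndepFun_of_map_eq_infinitePi {Ω α ι : Type*} [MeasurableSpace Ω] [MeasurableSpace α]
    {P : Measure Ω} [IsProbabilityMeasure P] {ρ : Measure α} [IsProbabilityMeasure ρ]
    {X : ι → Ω → α} (hX : ∀ i, Measurable (X i))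
    (h : P.map (fun ω i => X i ω) = Measure.infinitePi fun _ => ρ) :
    (∀ i, P.map (X i) = ρ) ∧ iIndepFun X P := by
  have hmap : ∀ i, P.map (X i) = ρ := fun i => by
    have h1 := Measure.infinitePi_map_eval (fun _ : ι => ρ) i
    rw [← h, Measure.map_map (measurable_pi_apply i) (measurable_pi_lambda _ hX)] at h1
    exact h1
  refine ⟨hmap, (iIndepFun_iff_map_fun_eq_infinitePi_map hX).2 ?_⟩
  simp only [hmap]
  exact h

/-- The terms of an i.i.d. sequence indexed from one, as a sequence indexed from zero. -/
theorem map_shift_eq_infinitePi {Ω α : Type*} [MeasurableSpace Ω] [MeasurableSpace α]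
    {P : Measure Ω} {ρ : Measure α} {X : ℕ → Ω → α}
    (hX : ∀ n : ℕ+, Measurable (X n) ∧ P.map (X n) = ρ) (hi : iIndepFun (fun n : ℕ+ => X n) P) :
    P.map (fun ω k => X (k + 1) ω) = Measure.infinitePi fun _ : ℕ => ρ := by
  have hi' : iIndepFun (fun k : ℕ => X (k + 1)) P :=
    hi.precomp (g := Nat.succPNat) Nat.succPNat_injective
  refine (hi'.map_fun_eq_infinitePi_map fun k => (hX (Nat.succPNat k)).1).trans ?_
  congr 1
  funext k
  exact (hX k.succPNat).2

/-- The given sequences are a supply with the law `chainSupplyLaw`. -/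
theorem map_chainSupply {ℓ : ℕ} {Λ : Measure (Hyperplane ℓ)} {W : Set (Space ℓ)}
    {Ω : Type*} [MeasurableSpace Ω] {P : Measure Ω} [IsProbabilityMeasure P]
    {U V : ℕ → Ω → ℝ} {G : ℕ → Ω → Hyperplane ℓ}
    (hU : ∀ n : ℕ+, Measurable (U n) ∧ P.map (U n) = volume.restrict (Set.Ico (0 : ℝ) 1))
    (hV : ∀ n : ℕ+, Measurable (V n) ∧ P.map (V n) = expMeasure 1)
    (hG : ∀ n : ℕ+, Measurable (G n) ∧ P.map (G n) = windowLaw Λ W)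
    (hUi : iIndepFun (fun n : ℕ+ => U n) P)
    (hVi : iIndepFun (fun n : ℕ+ => V n) P)
    (hGi : iIndepFun (fun n : ℕ+ => G n) P)
    (hVG : IndepFun (fun ω (n : ℕ+) => V n ω) (fun ω (n : ℕ+) => G n ω) P)
    (hUVG : IndepFun (fun ω (n : ℕ+) => U n ω)
      (fun ω => ((fun n : ℕ+ => V n ω), (fun n : ℕ+ => G n ω))) P) :
    Measurable (fun ω => chainSupply (fun n => U n ω) (fun n => V n ω) fun n => G n ω) ∧
    P.map (fun ω => chainSupply (fun n => U n ω) (fun n => V n ω) fun n => G n ω) =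
      chainSupplyLaw Λ W := by
  have mU : Measurable fun ω k => U (k + 1) ω :=
    measurable_pi_lambda _ fun k => (hU k.succPNat).1
  have mV : Measurable fun ω k => V (k + 1) ω :=
    measurable_pi_lambda _ fun k => (hV k.succPNat).1
  have mG : Measurable fun ω k => G (k + 1) ω :=
    measurable_pi_lambda _ fun k => (hG k.succPNat).1
  have hs : ∀ {α : Type} [MeasurableSpace α],
      Measurable fun (x : ℕ+ → α) (k : ℕ) => x k.succPNat := fun {α} _ =>
    measurable_pi_lambda _ fun k => measurable_pi_apply _
  have iVG : IndepFun (fun ω k => V (k + 1) ω) (fun ω k => G (k + 1) ω) P := hVG.comp hs hs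
  have iUVG : IndepFun (fun ω k => U (k + 1) ω)
      (fun ω => ((fun k => V (k + 1) ω), (fun k => G (k + 1) ω))) P :=
    hUVG.comp hs ((hs.comp measurable_fst).prodMk (hs.comp measurable_snd))
  refine ⟨mU.prodMk (mV.prodMk mG), ?_⟩
  have e1 := (indepFun_iff_map_prod_eq_prod_map_map mV.aemeasurable mG.aemeasurable).1 iVG
  have e2 := (indepFun_iff_map_prod_eq_prod_map_map mU.aemeasurable
    (mV.prodMk mG).aemeasurable).1 iUVG
  refine e2.trans ?_
  rw [e1, map_shift_eq_infinitePi hU hUi, map_shift_eq_infinitePi hV hVi,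
    map_shift_eq_infinitePi hG hGi, chainSupplyLaw]

theorem map_fst_prod_probability {α β : Type*} [MeasurableSpace α] [MeasurableSpace β]
    (μ : Measure α) (ν : Measure β) [IsProbabilityMeasure ν] : (μ.prod ν).map Prod.fst = μ := by
  rw [Measure.map_fst_prod, measure_univ, one_smul]

theorem map_snd_prod_probability {α β : Type*} [MeasurableSpace α] [MeasurableSpace β]
    (μ : Measure α) (ν : Measure β) [IsProbabilityMeasure μ] [SFinite ν] :
    (μ.prod ν).map Prod.snd = ν := by
  rw [Measure.map_snd_prod, measure_univ, one_smul]

section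
variable {ℓ : ℕ} {Λ : Measure (Hyperplane ℓ)} {W : Set (Space ℓ)}

theorem measurable_chain_outputs (hΛ : IsHyperplaneMeasure Λ) (hW : IsCell W)
    (H : Word → Hyperplane ℓ) :
    Measurable ((chainDriver Λ W).outputs divide (rootTree H)) :=
  (isDriven_chainDriver hΛ hW).measurable_outputs_right measurable_divide _

theorem measurable_clock_outputs (hΛ : IsHyperplaneMeasure Λ) (hW : IsCell W)
    (H : Word → Hyperplane ℓ) :
    Measurable ((clockDriver Λ W).outputs divide (rootTree H)) :=
  (isDriven_clockDriver hΛ hW).measurable_outputs_right measurable_divide _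

/-- The divisions of the rejection-based chain and those of cells with independent lifetimes have
the same law. -/
theorem map_outputs_chain_eq_clock (hΛ : IsHyperplaneMeasure Λ) (hW : IsCell W)
    (H : Word → Hyperplane ℓ) :
    (chainSupplyLaw Λ W).map ((chainDriver Λ W).outputs divide (rootTree H)) =
      (clockSupplyLaw Λ W).map ((clockDriver Λ W).outputs divide (rootTree H)) := by
  have := isProbabilityMeasure_chainSupplyLaw hΛ hW
  have := isProbabilityMeasure_clockSupplyLaw hΛ hW
  exact (isDriven_chainDriver hΛ hW).map_outputs_eq measurable_divide
    (isDriven_clockDriver hΛ hW) (isGoodTree_root hW H)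

theorem measurable_wordHyperplanes (hΛ : IsHyperplaneMeasure Λ) (hW : IsCell W)
    (H : Word → Hyperplane ℓ) : Measurable (wordHyperplanes W H) :=
  measurable_ofSeq.comp
    ((isDriven_wordStreamDriver hΛ hW).measurable_outputs_right measurable_assign _)

/-- Independent lifetimes, with one stream of hyperplanes for each word, give the law of the
divisions. -/
theorem map_lifetimePath_wordHyperplanes (hΛ : IsHyperplaneMeasure Λ) (hW : IsCell W)
    (H : Word → Hyperplane ℓ) :
    (clockSupplyLaw Λ W).map (fun d => lifetimePath Λ W (wordHyperplanes W H d.2) d.1) =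
      ((chainSupplyLaw Λ W).map ((chainDriver Λ W).outputs divide (rootTree H))).map
        (divisionPath W H) := by
  have := isProbabilityMeasure_windowLaw hΛ hW
  have := isProbabilityMeasure_clockSupplyLaw hΛ hW
  have hmc := measurable_clock_outputs hΛ hW H
  have hlaw := map_outputs_chain_eq_clock hΛ hW H
  have hvalid : ∀ᵐ d ∂(clockSupplyLaw Λ W),
      IsValidSequence W H ((clockDriver Λ W).outputs divide (rootTree H) d) :=
    (isDriven_clockDriver hΛ hW).ae_valid_outputs measurable_divide
      (measurableSet_isValidDivision hW) (isGoodTree_root hW H)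
  -- the times of the divisions tend to infinity because this only depends on their law
  have htend : ∀ᵐ d ∂(clockSupplyLaw Λ W),
      Tendsto (divisionTime ((clockDriver Λ W).outputs divide (rootTree H) d)) atTop atTop := by
    have h := ae_tendsto_divisionTime_chain hΛ hW H
    rw [← ae_map_iff (p := fun x => Tendsto (divisionTime x) atTop atTop)
      (measurable_chain_outputs hΛ hW H).aemeasurable measurableSet_tendsto_divisionTime,
      hlaw] at h
    exact ae_of_ae_map hmc.aemeasurable h
  have hnn : ∀ᵐ d ∂(clockSupplyLaw Λ W), ∀ e, 0 ≤ d.1 e := by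
    rw [ae_all_iff]
    intro e
    have hm : ∀ e, Measurable fun d : ClockSupply ℓ => d.1 e := fun e =>
      (measurable_pi_apply e).comp measurable_fst
    have h := (iIndepFun_of_map_eq_infinitePi (P := clockSupplyLaw Λ W) (ρ := expMeasure 1) hm
      (map_fst_prod_probability _ _)).1 e
    have h2 := ae_nonneg_expMeasure
    rw [← h] at h2
    exact ae_of_ae_map (hm e).aemeasurable h2
  rw [hlaw, Measure.map_map (measurable_divisionPath hW H) hmc]
  refine Measure.map_congr ?_
  filter_upwards [hvalid, htend, hnn] with d h1 h2 h3
  exact (divisionPath_eq_lifetimePath hΛ hW h3 h1 h2).symm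

/-- The law of the hyperplanes of the words does not change when the streams of the words are
replaced by successive parts of a single stream. -/
theorem map_ofSeq_singleStream (hΛ : IsHyperplaneMeasure Λ) (hW : IsCell W)
    (H : Word → Hyperplane ℓ) :
    (Measure.infinitePi fun _ : ℕ => windowLaw Λ W).map
        (fun G => ofSeq ((singleStreamDriver W).outputs assign (0, H) G)) =
      (Measure.infinitePi fun _ : Word => Measure.infinitePi fun _ : ℕ => windowLaw Λ W).map
        (wordHyperplanes W H) := by
  have := isProbabilityMeasure_windowLaw hΛ hW
  have h1 := (isDriven_singleStreamDriver hΛ hW).measurable_outputs_right measurable_assign (0, H)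
  have h2 := (isDriven_wordStreamDriver hΛ hW).measurable_outputs_right measurable_assign (0, H)
  have h := (isDriven_singleStreamDriver hΛ hW).map_outputs_eq measurable_assign
    (isDriven_wordStreamDriver hΛ hW) (isGoodPartial_zero hW H)
  have h3 := congrArg (Measure.map ofSeq) h
  rw [Measure.map_map measurable_ofSeq h1, Measure.map_map measurable_ofSeq h2] at h3
  exact h3

/-- The process that is constructed from lifetimes `Z` and hyperplanes `G n`, `n ≥ 1`, has the law
of the divisions of the rejection-based chain. -/
theorem map_stit (hΛ : IsHyperplaneMeasure Λ) (hW : IsCell W) (H : Word → Hyperplane ℓ) :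
    AEMeasurable (fun (p : (Word → ℝ) × (ℕ → Hyperplane ℓ)) t => stit Λ W p.1 p.2 t)
      ((Measure.infinitePi fun _ : Word => expMeasure 1).prod
        (Measure.infinitePi fun _ : ℕ => windowLaw Λ W)) ∧
    ((Measure.infinitePi fun _ : Word => expMeasure 1).prod
        (Measure.infinitePi fun _ : ℕ => windowLaw Λ W)).map
        (fun (p : (Word → ℝ) × (ℕ → Hyperplane ℓ)) t => stit Λ W p.1 p.2 t) =
      ((chainSupplyLaw Λ W).map ((chainDriver Λ W).outputs divide (rootTree H))).map
        (divisionPath W H) := by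
  have := isProbabilityMeasure_windowLaw hΛ hW
  set PZ := Measure.infinitePi fun _ : Word => expMeasure 1 with hPZ
  set PG := Measure.infinitePi fun _ : ℕ => windowLaw Λ W with hPG
  set PX := Measure.infinitePi fun _ : Word => PG with hPX
  let shift : (ℕ → Hyperplane ℓ) → ℕ → Hyperplane ℓ := fun G k => G (k + 1)
  have mshift : Measurable shift := measurable_pi_lambda _ fun k => measurable_pi_apply _
  have hshift : PG.map shift = PG :=
    Measure.map_infinitePi_infinitePi_of_inj (P := fun _ : ℕ => windowLaw Λ W)
      (f := fun k : ℕ => k + 1) (add_left_injective 1)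
  let f : (ℕ → Hyperplane ℓ) → Word → Hyperplane ℓ := fun G =>
    ofSeq ((singleStreamDriver W).outputs assign (0, H) G)
  have mf : Measurable f := measurable_ofSeq.comp
    ((isDriven_singleStreamDriver hΛ hW).measurable_outputs_right measurable_assign _)
  let L : (Word → ℝ) × (Word → Hyperplane ℓ) → ℝ≥0 → Family W := fun p =>
    lifetimePath Λ W p.2 p.1
  have mL : Measurable L := (measurable_lifetimePath hΛ hW).comp measurable_swap
  have hvalid : ∀ᵐ G ∂PG, ∀ n, IsValidAssignment W
      (stateAt assign (0, H) ((singleStreamDriver W).outputs assign (0, H) (shift G)) n)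
      ((singleStreamDriver W).outputs assign (0, H) (shift G) n) := by
    have h := (isDriven_singleStreamDriver hΛ hW).ae_valid_outputs measurable_assign
      (measurableSet_isValidAssignment hW) (isGoodPartial_zero hW H)
    rw [← hPG, ← hshift] at h
    exact ae_of_ae_map mshift.aemeasurable h
  have hone : ∀ᵐ G ∂PG, G 1 ∈ hit W := by
    have h : ∀ᵐ h ∂(windowLaw Λ W), h ∈ hit W := ae_cond_mem (measurableSet_hit hW.isCompact)
    rw [← Measure.infinitePi_map_eval (fun _ : ℕ => windowLaw Λ W) 1] at h
    exact ae_of_ae_map (measurable_pi_apply 1).aemeasurable h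
  have hae : (fun (p : (Word → ℝ) × (ℕ → Hyperplane ℓ)) t => stit Λ W p.1 p.2 t) =ᵐ[PZ.prod PG]
      L ∘ Prod.map id (f ∘ shift) := by
    have h : ∀ᵐ p ∂(PZ.prod PG), ∀ e, p.2 (kappa W p.2 e) = f (shift p.2) e := by
      refine (Measure.quasiMeasurePreserving_snd (μ := PZ) (ν := PG)).ae
        (p := fun G => ∀ e, G (kappa W G e) = f (shift G) e) ?_
      filter_upwards [hvalid, hone] with G h1 h2
      exact hyperplane_kappa_eq W H G h2 fun n => (h1 n).1
    filter_upwards [h] with p hp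
    funext t
    rw [stit_eq_lifetimePath, funext hp]
    rfl
  have mfs : Measurable (Prod.map id (f ∘ shift) :
      (Word → ℝ) × (ℕ → Hyperplane ℓ) → (Word → ℝ) × (Word → Hyperplane ℓ)) :=
    measurable_id.prodMap (mf.comp mshift)
  refine ⟨⟨_, mL.comp mfs, hae⟩, ?_⟩
  rw [Measure.map_congr hae, ← Measure.map_map mL mfs,
    ← Measure.map_prod_map PZ PG measurable_id (mf.comp mshift), ← Measure.map_map mf mshift,
    hshift, map_ofSeq_singleStream hΛ hW H,
    Measure.map_prod_map PZ PX measurable_id (measurable_wordHyperplanes hΛ hW H),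
    Measure.map_map mL (measurable_id.prodMap (measurable_wordHyperplanes hΛ hW H)),
    ← map_lifetimePath_wordHyperplanes hΛ hW H]
  rfl

end

/-- Almost surely the sequences that drive the chain are such that all divisions are valid, their
times tend to infinity, and the chain selects a leaf in each step. -/
theorem ae_chainSupply {ℓ : ℕ} {Λ : Measure (Hyperplane ℓ)} (hΛ : IsHyperplaneMeasure Λ)
    {W : Set (Space ℓ)} (hW : IsCell W) {Ω : Type*} [MeasurableSpace Ω] {P : Measure Ω}
    {U V : ℕ → Ω → ℝ} {G : ℕ → Ω → Hyperplane ℓ}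
    (hU : ∀ n : ℕ+, Measurable (U n) ∧ P.map (U n) = volume.restrict (Set.Ico (0 : ℝ) 1))
    (hm : Measurable (fun ω => chainSupply (fun n => U n ω) (fun n => V n ω) fun n => G n ω))
    (hlaw : P.map (fun ω => chainSupply (fun n => U n ω) (fun n => V n ω) fun n => G n ω) =
      chainSupplyLaw Λ W) (H : Word → Hyperplane ℓ) :
    ∀ᵐ ω ∂P, (∀ n, U (n + 1) ω ∈ Set.Ico (0 : ℝ) 1) ∧
      IsValidSequence W H ((chainDriver Λ W).outputs divide (rootTree H)
        (chainSupply (fun n => U n ω) (fun n => V n ω) fun n => G n ω)) ∧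
      Tendsto (divisionTime ((chainDriver Λ W).outputs divide (rootTree H)
        (chainSupply (fun n => U n ω) (fun n => V n ω) fun n => G n ω))) atTop atTop := by
  have h1 := ae_isValidSequence_chain hΛ hW H
  have h2 := ae_tendsto_divisionTime_chain hΛ hW H
  rw [← hlaw] at h1 h2
  have h3 : ∀ᵐ ω ∂P, ∀ n, U (n + 1) ω ∈ Set.Ico (0 : ℝ) 1 := by
    rw [ae_all_iff]
    intro n
    have h : ∀ᵐ u ∂(volume.restrict (Set.Ico (0 : ℝ) 1)), u ∈ Set.Ico (0 : ℝ) 1 :=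
      ae_restrict_mem measurableSet_Ico
    rw [← (hU n.succPNat).2] at h
    exact ae_of_ae_map (hU n.succPNat).1.aemeasurable h
  filter_upwards [ae_of_ae_map hm.aemeasurable h1, ae_of_ae_map hm.aemeasurable h2, h3]
    with ω a b c
  exact ⟨c, a, b⟩

end STIT

open STIT in
theorem mainTheorem3 {ℓ : ℕ} (Λ : Measure (STIT.Hyperplane ℓ)) (hΛ : STIT.IsHyperplaneMeasure Λ)
    (W : Set (STIT.Space ℓ)) (hW : STIT.IsCell W)
    {Ω : Type*} [MeasurableSpace Ω] (P : Measure Ω) [IsProbabilityMeasure P]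
    (U V : ℕ → Ω → ℝ) (G : ℕ → Ω → STIT.Hyperplane ℓ)
    (hU : ∀ n : ℕ+, Measurable (U n) ∧ P.map (U n) = volume.restrict (Set.Ico (0 : ℝ) 1))
    (hV : ∀ n : ℕ+, Measurable (V n) ∧ P.map (V n) = expMeasure 1)
    (hG : ∀ n : ℕ+, Measurable (G n) ∧ P.map (G n) = cond Λ (STIT.hit W))
    (hUi : iIndepFun (fun n : ℕ+ => U n) P)
    (hVi : iIndepFun (fun n : ℕ+ => V n) P)
    (hGi : iIndepFun (fun n : ℕ+ => G n) P)
    (hVG : IndepFun (fun ω (n : ℕ+) => V n ω) (fun ω (n : ℕ+) => G n ω) P)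
    (hUVG : IndepFun (fun ω (n : ℕ+) => U n ω)
      (fun ω => ((fun n : ℕ+ => V n ω), (fun n : ℕ+ => G n ω))) P) :
    (∀ᵐ ω ∂P,
      (∀ n : ℕ,
        let s := STIT.chain Λ W (fun n => U n ω) (fun n => G n ω) n
        (s.candidates (fun n => G n ω) (s.select Λ (U (n + 1) ω))).Nonempty) ∧
      Tendsto (STIT.jumpTime Λ W (fun n => U n ω) (fun n => V n ω) (fun n => G n ω)) atTop atTop ∧
      ∀ t : ℝ≥0, (STIT.rejectionProcess Λ W (fun n => U n ω) (fun n => V n ω)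
        (fun n => G n ω) t).IsTessellation) ∧
    STIT.IsSTITProcess Λ W P (fun t ω =>
      STIT.rejectionProcess Λ W (fun n => U n ω) (fun n => V n ω) (fun n => G n ω) t) := by
  have hprob := isProbabilityMeasure_windowLaw hΛ hW
  obtain ⟨h0⟩ : Nonempty (Hyperplane ℓ) := by
    by_contra h
    rw [not_nonempty_iff] at h
    exact hΛ.ne_zero (Measure.eq_zero_of_isEmpty Λ)
  let H : Word → Hyperplane ℓ := fun _ => h0
  obtain ⟨hm, hlaw⟩ := map_chainSupply hU hV hG hUi hVi hGi hVG hUVG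
  have hae := ae_chainSupply hΛ hW hU hm hlaw H
  refine ⟨?_, ?_⟩
  · filter_upwards [hae] with ω hω
    obtain ⟨hu, hx, hτ⟩ := hω
    refine ⟨fun n => (chain_represents hΛ hW hu hx n).2.2, ?_, fun t => ?_⟩
    · rw [jumpTime_eq_divisionTime hΛ hW hu hx]
      exact hτ
    · rw [rejectionProcess_eq_divisionPath hΛ hW hu hx]
      exact hx.isTessellation hW hτ t
  · set P' := (Measure.infinitePi fun _ : Word => expMeasure 1).prod
      (Measure.infinitePi fun _ : ℕ => windowLaw Λ W) with hP'
    have mZ : ∀ e : Word, Measurable fun ω : (Word → ℝ) × (ℕ → Hyperplane ℓ) => ω.1 e :=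
      fun e => (measurable_pi_apply e).comp measurable_fst
    have mG : ∀ n : ℕ, Measurable fun ω : (Word → ℝ) × (ℕ → Hyperplane ℓ) => ω.2 n :=
      fun n => (measurable_pi_apply n).comp measurable_snd
    obtain ⟨lZ, iZ⟩ := iIndepFun_of_map_eq_infinitePi (P := P') mZ
      (map_fst_prod_probability _ _)
    obtain ⟨lG, iG⟩ := iIndepFun_of_map_eq_infinitePi (P := P') mG
      (map_snd_prod_probability _ _)
    refine ⟨(Word → ℝ) × (ℕ → Hyperplane ℓ), Prod.instMeasurableSpace, P', inferInstance,
      fun e ω => ω.1 e, fun n ω => ω.2 n, fun e => ⟨mZ e, lZ e⟩, iZ,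
      fun n => ⟨mG n, lG n⟩, iG.precomp (g := fun n : ℕ+ => (n : ℕ)) PNat.coe_injective, ?_, ?_⟩
    · exact indepFun_prod (X := fun z : Word → ℝ => z)
        (Y := fun (x : ℕ → Hyperplane ℓ) (n : ℕ+) => x n) measurable_id
        (measurable_pi_lambda _ fun n => measurable_pi_apply _)
    · have heq : (fun ω t => rejectionProcess Λ W (fun n => U n ω) (fun n => V n ω)
          (fun n => G n ω) t) =ᵐ[P] (divisionPath W H ∘
            (chainDriver Λ W).outputs divide (rootTree H)) ∘
            fun ω => chainSupply (fun n => U n ω) (fun n => V n ω) fun n => G n ω := by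
        filter_upwards [hae] with ω hω
        exact rejectionProcess_eq_divisionPath hΛ hW hω.1 hω.2.1
      have hmc := measurable_chain_outputs hΛ hW H
      have hmp := measurable_divisionPath hW H
      obtain ⟨hs1, hs2⟩ := map_stit hΛ hW H
      refine ⟨⟨_, (hmp.comp hmc).comp hm, heq⟩, hs1, ?_⟩
      rw [Measure.map_congr heq, ← Measure.map_map (hmp.comp hmc) hm, hlaw,
        ← Measure.map_map hmp hmc]
      exact hs2.symm
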